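/- Let $k\in\{0,1,2,\dots\}\cup\{\infty\}$ and let $M$ be a (Hausdorff, real, $n$-dimensional, boundaryless) manifold of class $C^{k+2}$. Paths are $C^1$ maps $\gamma:J\to M$ on non-degenerate real intervals $J$ of any kind. A *linear transport along paths* $L$ in the tangent bundle $TM$ assigns to every path $\gamma:J\to M$ and all $s,t\in J$ a linear map $L^\gamma_{s\to t}:T_{\gamma(s)}M\to T_{\gamma(t)}M$ with $L^\gamma_{s\to t}\circ L^\gamma_{r\to s}=L^\gamma_{r\to t}$ and $L^\gamma_{s\to s}=\mathrm{id}$. It is *local* if $L^{\gamma|_{J'}}_{s\to t}=L^\gamma_{s\to t}$ for all non-degenerate subintervals $J'\subseteq J$ and $s,t\in J'$. A $C^{k+1}$ frame $(e_i)$ of $TM$ over a set $N\subseteq M$ is *normal for $L$ on $N$* if $L^\gamma_{s\to t}e_i(\gamma(s))=e_i(\gamma(t))$ for all paths $\gamma$ in $N$, all $s,t$ and all $i$. A coordinate system (chart) $x$ of class $C^{k+2}$ with domain $D$ is *normal on $N$* if its coordinate frame $(\partial/\partial x^i)$ is normal on $N\cap D$; $L$ *admits normal coordinates on $N$* if every point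 of $N$ lies in the domain of such a chart, and *admits normal frames near each point of $N$* if every point of $N$ has an open neighbourhood $V$ with a $C^{k+1}$ frame normal on $N\cap V$. The derivation generated by $L$ is $D^\gamma_sX=\lim_{\tau\to s}\frac{1}{\tau-s}\bigl(L^\gamma_{\tau\to s}X(\tau)-X(s)\bigr)$, and the torsion of $L$ on a $C^2$ map $\chi:J\times J'\to M$ is $T^\chi(s,t)=D^{\chi(\cdot,t)}_s\bigl(\partial_t\chi(\cdot,t)\bigr)-D^{\chi(s,\cdot)}_t\bigl(\partial_s\chi(s,\cdot)\bigr)$. The torsion *vanishes on $N$* if, for every $C^2$ map $\chi:J\times J'\to N$ and all $(s,t)$, both derivatives exist and $T^\chi(s,t)=0$. Let $L$ be a linear transport along paths in $TM$. **1. Torsion and normal coordinates.** Let $N\subseteq M$ be an (embedded) submanifold of class $C^{k+2}$. (a) $L$ admits normal coordinates on $N$ if and only if every point of $N$ has an open neighbourhood $V$ such that there is a $C^{k+1}$ frame normal for $L$ on $N\cap V$ and the torsion of $L$ vanishes on $N\cap V$. (b) Let $(e_j)$ be a $C^{k+1}$ frame normal for $L$ on $N$. Then $L$ admits normal coordinates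 on $N$ if and only if the torsion of $L$ vanishes on $N$. A $C^{k+2}$ chart $x$ with domain $D$ such that $N\cap D$ is connected or empty is normal on $N$ if and only if there are constant vectors $B_j\in\mathbb R^n$ with $dx_p(e_j(p))=B_j$ for all $p\in N\cap D$ and all $j$. For a $C^{k+2}$ chart $x$ with domain $D$ and constant vectors $B_j$ related in this way, $x(\gamma(t))=x(\gamma(s))+\sum_j\bigl(\int_s^tc^j(u)\,du\bigr)B_j$ for every path $\gamma$ in $N\cap D$, where $\dot\gamma(u)=\sum_jc^j(u)e_j(\gamma(u))$. If the torsion vanishes on $N$, then for every $p\in N$, every basis $(B_j)$ of $\mathbb R^n$ and every $b\in\mathbb R^n$ there is a chart $x$ around $p$ which is normal on $N$ and satisfies $x(p)=b$ and $dx_q(e_j(q))=B_j$ for all $q\in N\cap D$ and all $j$, where $D$ is its domain. (c) Let $x$ be a chart around $p\in N$ which is normal on $N$. Every chart $x'$ around $p$ normal on $N$ is near $p$ of the form $x'=Ax+b+f$ with $A\in GL_n(\mathbb R)$, $b\in\mathbb R^n$ and an $\mathbb R^n$-valued function $f$ of class $C^{k+2}$ near $p$ such that $f=0$ and $df=0$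 at the points of $N$. Conversely, for all such $A,b,f$ the functions $Ax+b+f$ form, on some open neighbourhood of $p$ (contained in the domains of $x$ and $f$), a chart which is normal on $N$. **2. Flat parallel transports.** Let $k\ge1$ and let $U\subseteq M$ be open. Call $L$ a *flat parallel transport on $U$* if there is a linear connection $\nabla$ of class $C^k$ on $U$ with zero curvature such that, for all paths $\gamma$ in $U$, all $s$ and all $u\in T_{\gamma(s)}M$, the vector field $\tau\mapsto L^\gamma_{s\to\tau}u$ along $\gamma$ is $\nabla$-parallel. If there is a $C^{k+1}$ frame normal for $L$ on $U$, then $L$ is a flat parallel transport on $U$. If $L$ is a flat parallel transport on $U$, then $L$ admits normal frames (of class $C^{k+1}$) near each point of $U$. If $L$ is local, then $L$ admits normal frames near each point of $U$ if and only if it is a flat parallel transport on $U$. **3. Autoparallels.** Let $U\subseteq M$ be open, let $\nabla$ be a linear connection on $U$, and let $L$ be on $U$ the parallel transport generated by $\nabla$ (in the sense of part 2, flatness not being required). A path $\gamma$ in $U$ is an autoparallel of $L$, i.e. $L^\gamma_{s\to t}\dot\gamma(s)=\dot\gamma(t)$ for all $s,t$, if and only if it is a geodesic of $\nabla$, i.e.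 $\dot\gamma$ is differentiable along $\gamma$ and $\nabla_{\dot\gamma}\dot\gamma=0$. -/

import Mathlib

open Set Filter Topology
open scoped Manifold ContDiff

namespace NormalFrames

noncomputable section

variable {n : ℕ} {M : Type*} [TopologicalSpace M] [ChartedSpace (EuclideanSpace ℝ (Fin n)) M]

/-- A `C^1` path in the `n`-dimensional manifold `M`: a non-degenerate real interval `dom` (of any
kind) and a map which is `C^1` on `dom`. Only the values on `dom` are relevant. -/
structure Path (n : ℕ) (M : Type*) [TopologicalSpace M]
    [ChartedSpace (EuclideanSpace ℝ (Fin n)) M] where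
  /-- the interval of parameters -/
  dom : Set ℝ
  ordConnected : dom.OrdConnected
  nontrivial : dom.Nontrivial
  /-- the map -/
  toFun : ℝ → M
  contMDiffOn : ContMDiffOn 𝓘(ℝ, ℝ) (𝓡 n) 1 toFun dom

instance : CoeFun (Path n M) (fun _ => ℝ → M) := ⟨Path.toFun⟩

/-- The tangent vector `γ̇(t)` of a path (one-sided at an end point of the interval). -/
def Path.velocity (γ : Path n M) (t : ℝ) : TangentSpace (𝓡 n) (γ t) :=
  mfderivWithin 𝓘(ℝ, ℝ) (𝓡 n) γ γ.dom t ((NormedSpace.fromTangentSpace (𝕜 := ℝ) t).symm 1)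

/-- The restriction of a path to a non-degenerate subinterval. -/
def Path.restrict (γ : Path n M) (J : Set ℝ) (hJ : J.OrdConnected) (hJ' : J.Nontrivial)
    (h : J ⊆ γ.dom) : Path n M where
  dom := J
  ordConnected := hJ
  nontrivial := hJ'
  toFun := γ
  contMDiffOn := γ.contMDiffOn.mono h

/-- The path lies in the set `N`. -/
def Path.LiesIn (γ : Path n M) (N : Set M) : Prop := MapsTo γ γ.dom N

/-- A linear transport along (`C^1`) paths in the tangent bundle: to every path `γ : J → M` and all
`s, t ∈ J` it assigns a linear map `L^γ_{s→t} : T_{γ(s)} M → T_{γ(t)} M`, such that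
`L^γ_{s→t} ∘ L^γ_{r→s} = L^γ_{r→t}` and `L^γ_{s→s} = id`. The field `tr_congr` says that
`L^γ` depends on the restriction of `γ` to its interval only. -/
structure LinearTransport (n : ℕ) (M : Type*) [TopologicalSpace M]
    [ChartedSpace (EuclideanSpace ℝ (Fin n)) M] where
  /-- the map `L^γ_{s→t}` -/
  tr : (γ : Path n M) → (s t : γ.dom) →
    TangentSpace (𝓡 n) (γ s) →ₗ[ℝ] TangentSpace (𝓡 n) (γ t)
  tr_comp : ∀ (γ : Path n M) (r s t : γ.dom), tr γ s t ∘ₗ tr γ r s = tr γ r t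
  tr_self : ∀ (γ : Path n M) (s : γ.dom), tr γ s s = LinearMap.id
  tr_congr : ∀ γ γ' : Path n M, γ.dom = γ'.dom → EqOn γ γ' γ.dom →
    ∀ (s t : γ.dom) (s' t' : γ'.dom), (s : ℝ) = s' → (t : ℝ) = t' →
      HEq (tr γ s t) (tr γ' s' t')

/-- The transport is local: the transport along a restricted path is the restriction of the
transport along the path. (Not part of the definition of a linear transport.) -/
def LinearTransport.IsLocal (L : LinearTransport n M) : Prop :=
  ∀ (γ : Path n M) (J : Set ℝ) (hJ : J.OrdConnected) (hJ' : J.Nontrivial) (h : J ⊆ γ.dom)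
    (s t : J), L.tr (γ.restrict J hJ hJ' h) s t = L.tr γ ⟨s, h s.2⟩ ⟨t, h t.2⟩

/-- The derivation along paths generated by the transport: `D^γ_s X = v`, i.e.
`v = lim_{τ → s} (L^γ_{τ→s} X(τ) - X(s)) / (τ - s)`, for a lifting `X` of `γ`. -/
def LinearTransport.HasDerivationAt (L : LinearTransport n M) (γ : Path n M)
    (X : (t : γ.dom) → TangentSpace (𝓡 n) (γ t)) (s : γ.dom)
    (v : TangentSpace (𝓡 n) (γ s)) : Prop :=
  Tendsto (fun τ : γ.dom => ((τ : ℝ) - (s : ℝ))⁻¹ • (L.tr γ τ s (X τ) - X s)) (𝓝[≠] s) (𝓝 v)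

/-- A `C^2` map `χ : J × J' → M`, with `J`, `J'` non-degenerate real intervals. -/
structure Surface (n : ℕ) (M : Type*) [TopologicalSpace M]
    [ChartedSpace (EuclideanSpace ℝ (Fin n)) M] where
  /-- the first interval -/
  dom₁ : Set ℝ
  /-- the second interval -/
  dom₂ : Set ℝ
  ordConnected₁ : dom₁.OrdConnected
  ordConnected₂ : dom₂.OrdConnected
  nontrivial₁ : dom₁.Nontrivial
  nontrivial₂ : dom₂.Nontrivial
  /-- the map -/
  toFun : ℝ × ℝ → M
  contMDiffOn : ContMDiffOn 𝓘(ℝ, ℝ × ℝ) (𝓡 n) 2 toFun (dom₁ ×ˢ dom₂)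

/-- The path `χ(·, t)`. -/
def Surface.path₁ (χ : Surface n M) (t : χ.dom₂) : Path n M where
  dom := χ.dom₁
  ordConnected := χ.ordConnected₁
  nontrivial := χ.nontrivial₁
  toFun := fun s => χ.toFun (s, t)
  contMDiffOn := (χ.contMDiffOn.of_le (by norm_num)).comp
    (t := χ.dom₁ ×ˢ χ.dom₂) (f := fun s : ℝ => (s, (t : ℝ)))
    (ContDiff.contMDiff (by fun_prop)).contMDiffOn (fun _ hs => ⟨hs, t.2⟩)

/-- The path `χ(s, ·)`. -/
def Surface.path₂ (χ : Surface n M) (s : χ.dom₁) : Path n M where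
  dom := χ.dom₂
  ordConnected := χ.ordConnected₂
  nontrivial := χ.nontrivial₂
  toFun := fun t => χ.toFun (s, t)
  contMDiffOn := (χ.contMDiffOn.of_le (by norm_num)).comp
    (t := χ.dom₁ ×ˢ χ.dom₂) (f := fun t : ℝ => ((s : ℝ), t))
    (ContDiff.contMDiff (by fun_prop)).contMDiffOn (fun _ ht => ⟨s.2, ht⟩)

/-- `T` is the torsion of `L` on `χ` at `(s, t)`:
`T^χ(s, t) = D^{χ(·, t)}_s (∂χ/∂t) - D^{χ(s, ·)}_t (∂χ/∂s)`, both derivatives being defined. -/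
def LinearTransport.HasTorsionAt (L : LinearTransport n M) (χ : Surface n M)
    (s : χ.dom₁) (t : χ.dom₂) (T : TangentSpace (𝓡 n) (χ.toFun (s, t))) : Prop :=
  ∃ a b : TangentSpace (𝓡 n) (χ.toFun (s, t)),
    L.HasDerivationAt (χ.path₁ t) (fun σ : χ.dom₁ => (χ.path₂ σ).velocity t) s a ∧
    L.HasDerivationAt (χ.path₂ s) (fun τ : χ.dom₂ => (χ.path₁ τ).velocity s) t b ∧
    T = a - b

/-- The torsion of `L` vanishes on the set `N`: `T^χ = 0` for all `C^2` maps `χ : J × J' → N`. -/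
def LinearTransport.TorsionFreeOn (L : LinearTransport n M) (N : Set M) : Prop :=
  ∀ χ : Surface n M, MapsTo χ.toFun (χ.dom₁ ×ˢ χ.dom₂) N →
    ∀ (s : χ.dom₁) (t : χ.dom₂), L.HasTorsionAt χ s t 0

/-- `N` is an (embedded) submanifold of class `C^r`: near each of its points, a `C^r` chart of `M`
maps `N` onto a piece of a linear subspace `W`. -/
def IsSubmanifold (n : ℕ) {M : Type*} [TopologicalSpace M]
    [ChartedSpace (EuclideanSpace ℝ (Fin n)) M] (r : ℕ∞ω) (N : Set M) : Prop :=
  ∃ W : Submodule ℝ (EuclideanSpace ℝ (Fin n)), ∀ p ∈ N,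
    ∃ φ ∈ IsManifold.maximalAtlas (𝓡 n) r M, p ∈ φ.source ∧ ∀ q ∈ φ.source, q ∈ N ↔ φ q ∈ W

/-- The vector `∂/∂x^i` at `p` of the coordinate system `x = φ`. -/
def coordFrame (φ : OpenPartialHomeomorph M (EuclideanSpace ℝ (Fin n))) (i : Fin n) (p : M) :
    TangentSpace (𝓡 n) p :=
  (mfderiv (𝓡 n) (𝓡 n) φ p).inverse
    ((NormedSpace.fromTangentSpace (𝕜 := ℝ) (φ p)).symm (EuclideanSpace.single i 1))

/-- The differential at `p` of a map into `ℝ^n`, as a map with values in `ℝ^n`. -/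
def differential (f : M → EuclideanSpace ℝ (Fin n)) (p : M) :
    TangentSpace (𝓡 n) p →L[ℝ] EuclideanSpace ℝ (Fin n) :=
  (NormedSpace.fromTangentSpace (𝕜 := ℝ) (f p)).toContinuousLinearMap ∘L
    mfderiv (𝓡 n) (𝓡 n) f p

section Tangent

variable [IsManifold (𝓡 n) 1 M]

/-- The sections `e_1, ..., e_n` form a `C^r` frame over `N` which is normal for `L` on `N`: in it
the matrix of `L` along every path lying in `N` is the identity matrix. -/
structure LinearTransport.IsNormalFrame (L : LinearTransport n M) (r : ℕ∞ω)
    (e : Fin n → (p : M) → TangentSpace (𝓡 n) p) (N : Set M) : Prop where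
  frame : IsLocalFrameOn (𝓡 n) (EuclideanSpace ℝ (Fin n)) r e N
  transport : ∀ γ : Path n M, γ.LiesIn N → ∀ (s t : γ.dom) (i : Fin n),
    L.tr γ s t (e i (γ s)) = e i (γ t)

/-- `L` admits `C^r` frames normal near each point of `N`. -/
def LinearTransport.AdmitsNormalFrames (L : LinearTransport n M) (r : ℕ∞ω) (N : Set M) : Prop :=
  ∀ p ∈ N, ∃ V : Set M, IsOpen V ∧ p ∈ V ∧ ∃ e, L.IsNormalFrame r e (N ∩ V)

/-- `φ` is a coordinate system of class `C^(r+1)`, normal for `L` on the part of `N` in its domain: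
its coordinate frame is normal there. -/
def LinearTransport.IsNormalCoord (L : LinearTransport n M) (r : ℕ∞ω)
    (φ : OpenPartialHomeomorph M (EuclideanSpace ℝ (Fin n))) (N : Set M) : Prop :=
  φ ∈ IsManifold.maximalAtlas (𝓡 n) (r + 1) M ∧
    L.IsNormalFrame r (coordFrame φ) (N ∩ φ.source)

/-- `L` admits normal coordinates on `N`: near every point of `N` there are such coordinates. -/
def LinearTransport.AdmitsNormalCoords (L : LinearTransport n M) (r : ℕ∞ω) (N : Set M) : Prop :=
  ∀ p ∈ N, ∃ φ : OpenPartialHomeomorph M (EuclideanSpace ℝ (Fin n)),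
    p ∈ φ.source ∧ L.IsNormalCoord r φ N

/-- The type of the map underlying a linear connection on `M`; `cov Z p u` is `(∇_u Z)(p)`. -/
abbrev Cov (n : ℕ) (M : Type*) [TopologicalSpace M]
    [ChartedSpace (EuclideanSpace ℝ (Fin n)) M] : Type _ :=
  ((p : M) → TangentSpace (𝓡 n) p) →
    ((p : M) → TangentSpace (𝓡 n) p →L[ℝ] TangentSpace (𝓡 n) p)

/-- `cov` is a linear connection on the open set `U`. -/
abbrev IsLinearConnectionOn (cov : Cov n M) (U : Set M) : Prop :=
  IsCovariantDerivativeOn (I := 𝓡 n) (EuclideanSpace ℝ (Fin n)) cov U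

/-- `cov` is of class `C^k` on `U`. -/
abbrev IsOfClassOn (k : ℕ∞ω) (cov : Cov n M) (U : Set M) : Prop :=
  ContMDiffCovariantDerivativeOn (I := 𝓡 n) (EuclideanSpace ℝ (Fin n)) k cov U

/-- `X` is a vector field of class `C^r` on `U`. -/
def IsVectorFieldOn (r : ℕ∞ω) (X : (p : M) → TangentSpace (𝓡 n) p) (U : Set M) : Prop :=
  ContMDiffOn (𝓡 n) ((𝓡 n).prod (𝓡 n)) r (fun p => (⟨p, X p⟩ : TangentBundle (𝓡 n) M)) U

/-- The connection is flat on `U`: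
`R(X, Y) Z = ∇_X ∇_Y Z - ∇_Y ∇_X Z - ∇_{[X, Y]} Z = 0` on `U`. -/
def IsFlatOn (cov : Cov n M) (U : Set M) : Prop :=
  ∀ X Y Z : (p : M) → TangentSpace (𝓡 n) p,
    IsVectorFieldOn 1 X U → IsVectorFieldOn 1 Y U → IsVectorFieldOn 2 Z U → ∀ p ∈ U,
      cov (fun q => cov Z q (Y q)) p (X p) - cov (fun q => cov Z q (X q)) p (Y p)
        - cov Z p (VectorField.mlieBracket (𝓡 n) X Y p) = 0

/-- The covariant derivative of the lifting `X` along the path `γ` at `s` is `v`: if, in some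
`C^1` frame around `γ(s)`, `X(τ) = ∑ f^i(τ) e_i(γ(τ))` for `τ` near `s`, then
`v = ∑ (f^i)'(s) e_i + f^i(s) ∇_{γ̇(s)} e_i`. -/
def HasCovDerivAlong (cov : Cov n M) (γ : Path n M)
    (X : (t : γ.dom) → TangentSpace (𝓡 n) (γ t)) (s : γ.dom)
    (v : TangentSpace (𝓡 n) (γ s)) : Prop :=
  ∃ (V : Set M) (e : Fin n → (p : M) → TangentSpace (𝓡 n) p) (f : Fin n → ℝ → ℝ)
    (f' : Fin n → ℝ),
    IsOpen V ∧ γ s ∈ V ∧ IsLocalFrameOn (𝓡 n) (EuclideanSpace ℝ (Fin n)) 1 e V ∧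
    (∀ᶠ τ in 𝓝 s, X τ = ∑ i, f i τ • e i (γ τ)) ∧
    (∀ i, HasDerivWithinAt (f i) (f' i) γ.dom s) ∧
    v = ∑ i, (f' i • e i (γ s) + f i s • cov (e i) (γ s) (γ.velocity s))

/-- On `U`, `L` is the parallel transport generated by the connection `cov`: along paths in `U`,
the lifting `τ ↦ L^γ_{s→τ} u` is parallel (and it has the value `u` at `s`). -/
def LinearTransport.IsParallelTransportOn (L : LinearTransport n M) (cov : Cov n M)
    (U : Set M) : Prop :=
  ∀ γ : Path n M, γ.LiesIn U → ∀ (s : γ.dom) (u : TangentSpace (𝓡 n) (γ s)) (t : γ.dom),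
    HasCovDerivAlong cov γ (fun τ => L.tr γ s τ u) t 0

/-- `L` is on `U` the parallel transport generated by some flat linear connection of class
`C^k`. -/
def LinearTransport.IsFlatParallelTransportOn (L : LinearTransport n M) (k : ℕ∞ω)
    (U : Set M) : Prop :=
  ∃ cov : Cov n M, IsLinearConnectionOn cov U ∧ IsOfClassOn k cov U ∧ IsFlatOn cov U ∧
    L.IsParallelTransportOn cov U

/-- `γ` is an autoparallel path of `L`: its tangent vector is transported by `L` along `γ`. -/
def LinearTransport.IsAutoparallel (L : LinearTransport n M) (γ : Path n M) : Prop :=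
  ∀ s t : γ.dom, L.tr γ s t (γ.velocity s) = γ.velocity t

/-- `γ` is a geodesic of the connection: `∇_{γ̇} γ̇ = 0` along `γ`. -/
def IsGeodesic (cov : Cov n M) (γ : Path n M) : Prop :=
  ∀ s : γ.dom, HasCovDerivAlong cov γ (fun τ => γ.velocity τ) s 0

end Tangent

end

end NormalFrames

/-! In a normal frame the transport has identity matrices. Hence a fibrewise linear map `Λ` into ℝⁿ
with constant values on the frame intertwines the transport with the identity, and `D^γ` becomes the
ordinary derivative of the `Λ`-components. Torsion and normal coordinates are compared by reading
this in charts.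

If `x` is a normal chart, `Λ = dx` is such a map and both terms of the torsion on `χ` are the mixed
second derivative of `x ∘ χ`, so they cancel (`hasTorsionAt_zero`). Conversely, take a chart `ψ`
flattening `N` to a linear subspace `W`, and let `A(y)` be the matrix taking the components of `e_j`
to `B_j`. A function `h` with `dh = A` at the points of `W` gives the normal chart `h ∘ ψ`. On
affine parallelograms in `W` the torsion is `∂_{w₁}A w₂ - ∂_{w₂}A w₁`, so its vanishing is symmetry
of `dA` along `W` (`fderiv_symm_of_torsionFree`). Extend `A` constantly along the orthogonal
projection `P` to `W`. Then `A ∘ P` is a closed form and has a primitive by the Poincaré lemma. The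
transverse part `A ∘ (1 - P)` has to be the differential only at the points of `W`, but the obvious
choice `A(y)(y - Py)` has only the class `C^(k+1)` of `A`, one derivative too few. Averaging `A` at
a scale equal to the transverse coordinate, as in Whitney extension, recovers the derivative
(`contDiff_smul_average`, `exists_contDiff_hasFDerivAt_comp`).

Normal objects have components relative to each other which are constant along paths in `N`, hence
locally constant on `N`. So the differentials of two normal charts near a point differ on `N` by one
constant matrix, and the charts differ by an affine map up to a function flat to first order along
`N`.

For open sets, a normal frame defines the connection that differentiates components. It is flat
because `[X, Y]` acts on functions as a commutator. Conversely, a flat connection form `Γ` satisfies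
the integrability condition of `dΦ = -ΓΦ`. This system is solved by a radial Picard iteration whose
failure to solve the equation is controlled by `fderiv_radialIntegral`, and the columns of `Φ` form
a parallel frame. A parallel lifting is moved by `L` because, carried to one tangent space, it has
zero derivative at every parameter (`tr_eq_of_parallel`). This needs no regularity of the
connection, and it also identifies autoparallels with geodesics. Locality of `L` serves for paths
which leave the domain of a normal frame. -/

set_option linter.unusedSectionVars false

namespace NormalFrames

noncomputable section

variable {n : ℕ} {M : Type*} [TopologicalSpace M] [ChartedSpace (EuclideanSpace ℝ (Fin n)) M]

/-! ### Averages at variable scale and the derivative they gain -/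

section Smoothing

open MeasureTheory

variable {E F : Type*} [NormedAddCommGroup E] [NormedSpace ℝ E] [FiniteDimensional ℝ E]
  [MeasurableSpace E] [BorelSpace E] [NormedAddCommGroup F] [NormedSpace ℝ F]

/-- The average of `a` around `y` at scale `z`, with weight `ρ`. -/
def average (ρ : E → ℝ) (a : E → F) (x : E × ℝ) : F :=
  ∫ u, ρ u • a (x.1 + x.2 • u) ∂Measure.addHaar

lemma average_zero_right [CompleteSpace F] (ρ : E → ℝ) (a : E → F) (y : E) :
    average ρ a (y, 0) = (∫ u, ρ u ∂Measure.addHaar) • a y := by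
  simp [average, integral_smul_const]

/-- This form makes the differentiation theorems for convolutions with a parameter applicable. The
constant 1 is convolved with the kernel and evaluated at 0; the signs of `u` undo the reflection in
a convolution. -/
lemma average_eq_convolution (ρ : E → ℝ) (a : E → F) (x : E × ℝ) :
    average ρ a x = convolution (fun _ => (1 : ℝ))
      (fun u : E => ρ (-u) • a (x.1 + x.2 • (-u))) (ContinuousLinearMap.lsmul ℝ ℝ)
      Measure.addHaar 0 := by
  simp [average, convolution_def]

lemma contDiff_average_integrand {r : ℕ∞} {ρ : E → ℝ} (hρ : ContDiff ℝ r ρ) {a : E → F}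
    (ha : ContDiff ℝ r a) :
    ContDiff ℝ r (fun x : (E × ℝ) × E => ρ (-x.2) • a (x.1.1 + x.1.2 • (-x.2))) := by
  have h1 : ContDiff ℝ r (fun x : (E × ℝ) × E => ρ (-x.2)) := hρ.comp (by fun_prop)
  have h2 : ContDiff ℝ r (fun x : (E × ℝ) × E => a (x.1.1 + x.1.2 • (-x.2))) :=
    ha.comp (by fun_prop)
  exact h1.smul h2

lemma contDiff_average {r : ℕ∞} {ρ : E → ℝ} (hρ : ContDiff ℝ r ρ) (hρc : HasCompactSupport ρ)
    {a : E → F} (ha : ContDiff ℝ r a) : ContDiff ℝ r (average ρ a) := by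
  have key := contDiffOn_convolution_right_with_param_comp (𝕜 := ℝ) (n := r)
    (μ := (Measure.addHaar : Measure E))
    (ContinuousLinearMap.lsmul ℝ ℝ : ℝ →L[ℝ] F →L[ℝ] F) (s := (univ : Set (E × ℝ)))
    (v := fun _ => (0 : E)) contDiffOn_const (f := fun _ => (1 : ℝ))
    (g := fun (x : E × ℝ) (u : E) => ρ (-u) • a (x.1 + x.2 • (-u)))
    (k := -(tsupport ρ)) isOpen_univ hρc.isCompact.neg
    (fun p x _ hx => by
      have : ρ (-x) = 0 := image_eq_zero_of_notMem_tsupport (by simpa using hx)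
      simp only [this, zero_smul])
    (locallyIntegrable_const _) (contDiff_average_integrand hρ ha).contDiffOn
  rw [contDiffOn_univ] at key
  simpa only [← average_eq_convolution] using! key

lemma integrable_smul_comp {ρ : E → ℝ} (hρ : Continuous ρ) (hρc : HasCompactSupport ρ)
    {g : E → F} (hg : Continuous g) :
    Integrable (fun u => ρ u • g u) (Measure.addHaar : Measure E) :=
  (hρ.smul hg).integrable_of_hasCompactSupport hρc.smul_right

/-- Differentiation under the integral sign: the weight does not depend on the parameters, so all
derivatives fall on `a`. This formula is for `C^1` maps; the gain of a derivative comes from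
integrating it by parts. -/
lemma fderiv_average {ρ : E → ℝ} (hρ : ContDiff ℝ 1 ρ) (hρc : HasCompactSupport ρ)
    {a : E → F} (ha : ContDiff ℝ 1 a) (x : E × ℝ) (w : E) (c : ℝ) :
    fderiv ℝ (average ρ a) x (w, c) =
      ∫ u, ρ u • fderiv ℝ a (x.1 + x.2 • u) (w + c • u) ∂Measure.addHaar := by
  have key := hasFDerivAt_convolution_right_with_param (𝕜 := ℝ)
    (μ := (Measure.addHaar : Measure E))
    (ContinuousLinearMap.lsmul ℝ ℝ : ℝ →L[ℝ] F →L[ℝ] F) (s := (univ : Set (E × ℝ)))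
    (f := fun _ => (1 : ℝ))
    (g := fun (x : E × ℝ) (u : E) => ρ (-u) • a (x.1 + x.2 • (-u)))
    (k := -(tsupport ρ)) isOpen_univ hρc.isCompact.neg
    (fun p x _ hx => by
      have : ρ (-x) = 0 := image_eq_zero_of_notMem_tsupport (by simpa using hx)
      simp only [this, zero_smul])
    (locallyIntegrable_const _) (contDiff_average_integrand (r := 1) hρ ha).contDiffOn
    (x, 0) (mem_univ _)
  -- The average is the convolution evaluated at 0, so only directions `((w, c), 0)` matter.
  have h1 := HasFDerivAt.comp (f := fun y : E × ℝ => (y, (0 : E))) x key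
    (hasFDerivAt_prodMk_left x (0 : E))
  have h2 := h1.congr_of_eventuallyEq
    (Eventually.of_forall fun y => average_eq_convolution ρ a y)
  rw [h2.fderiv]
  set G : (E × ℝ) × E → F := fun x => ρ (-x.2) • a (x.1.1 + x.1.2 • (-x.2)) with hG
  have hGd : ContDiff ℝ 1 G := contDiff_average_integrand (r := 1) hρ ha
  have hcont : Continuous fun t : E => fderiv ℝ G (x, 0 - t) :=
    (hGd.continuous_fderiv one_ne_zero).comp (by fun_prop)
  have hsupp : HasCompactSupport fun t : E => fderiv ℝ G (x, 0 - t) := by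
    refine HasCompactSupport.of_support_subset_isCompact hρc.isCompact fun t ht => ?_
    by_contra hts
    apply ht
    have : G =ᶠ[𝓝 (x, 0 - t)] fun _ => 0 := by
      have h0 : ρ =ᶠ[𝓝 t] 0 := notMem_tsupport_iff_eventuallyEq.1 hts
      have h1 : Tendsto (fun y : (E × ℝ) × E => -y.2) (𝓝 (x, 0 - t)) (𝓝 t) := by
        have : Continuous fun y : (E × ℝ) × E => -y.2 := by fun_prop
        simpa using this.tendsto (x, 0 - t)
      filter_upwards [h1.eventually h0] with y hy
      simp only [hG, hy, Pi.zero_apply, zero_smul]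
    simpa using this.fderiv_eq (𝕜 := ℝ)
  have hint : Integrable (fun t : E => fderiv ℝ G (x, 0 - t)) Measure.addHaar :=
    hcont.integrable_of_hasCompactSupport hsupp
  have h3 : (convolution (fun _ => (1 : ℝ)) (fun x_1 : E => fderiv ℝ G (x, x_1))
      ((ContinuousLinearMap.lsmul ℝ ℝ : ℝ →L[ℝ] F →L[ℝ] F).precompR ((E × ℝ) × E))
      Measure.addHaar 0) = ∫ t, fderiv ℝ G (x, 0 - t) ∂Measure.addHaar := by
    rw [convolution_def]
    congr 1
    ext1 t
    refine ContinuousLinearMap.ext fun v => ?_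
    simp [ContinuousLinearMap.precompR_apply]
  change (convolution (fun _ => (1 : ℝ)) (fun x_1 : E => fderiv ℝ G (x, x_1))
      ((ContinuousLinearMap.lsmul ℝ ℝ : ℝ →L[ℝ] F →L[ℝ] F).precompR ((E × ℝ) × E))
      Measure.addHaar 0) ((w, c), 0) = _
  rw [h3, ContinuousLinearMap.integral_apply hint]
  congr 1
  ext t
  have hGt : HasFDerivAt G (fderiv ℝ G (x, 0 - t)) (x, 0 - t) :=
    (hGd.differentiable one_ne_zero _).hasFDerivAt
  have h4 := HasFDerivAt.comp (f := fun y : E × ℝ => (y, 0 - t)) x hGt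
    (hasFDerivAt_prodMk_left x (0 - t))
  have h5 : HasFDerivAt (fun y : E × ℝ => a (y.1 + y.2 • t))
      ((fderiv ℝ a (x.1 + x.2 • t)).comp (ContinuousLinearMap.fst ℝ E ℝ +
        (ContinuousLinearMap.snd ℝ E ℝ).smulRight t)) x :=
    ((ha.differentiable one_ne_zero _).hasFDerivAt).comp x
      (hasFDerivAt_fst.add (hasFDerivAt_snd.smul_const t))
  have h6 : (G ∘ fun y : E × ℝ => (y, 0 - t)) = fun y => ρ t • a (y.1 + y.2 • t) := by
    ext y; simp [hG]
  rw [h6] at h4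
  have := congrArg (fun L : E × ℝ →L[ℝ] F => L (w, c)) (h4.unique (h5.const_smul (ρ t)))
  simpa using this

/-- By the chain rule the factor `x.2` turns the derivative of `a` into the `u`-derivative of `a
(x.1 + x.2 • u)`, and integration by parts moves the latter onto the weight. No derivative of `a` is
left. -/
lemma integral_smul_fderiv_eq_neg {σ : E → ℝ} (hσ : ContDiff ℝ 1 σ) (hσc : HasCompactSupport σ)
    {a : E → F} (ha : ContDiff ℝ 1 a) (x : E × ℝ) (v : E) :
    x.2 • ∫ u, σ u • fderiv ℝ a (x.1 + x.2 • u) v ∂Measure.addHaar =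
      - average (fun u => fderiv ℝ σ u v) a x := by
  have hb : ContDiff ℝ 1 fun u : E => a (x.1 + x.2 • u) := ha.comp (by fun_prop)
  have hD : ∀ u, fderiv ℝ (fun u : E => a (x.1 + x.2 • u)) u v =
      x.2 • fderiv ℝ a (x.1 + x.2 • u) v := by
    intro u
    have : HasFDerivAt (fun u : E => a (x.1 + x.2 • u))
        ((fderiv ℝ a (x.1 + x.2 • u)).comp (x.2 • ContinuousLinearMap.id ℝ E)) u :=
      ((ha.differentiable one_ne_zero _).hasFDerivAt).comp u
        (((hasFDerivAt_id u).const_smul x.2).const_add x.1)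
    rw [this.fderiv]
    simp
  have hσ' : Continuous fun u => fderiv ℝ σ u v :=
    (hσ.continuous_fderiv one_ne_zero).clm_apply continuous_const
  have hσc' : HasCompactSupport fun u => fderiv ℝ σ u v := hσc.fderiv_apply ℝ v
  have hb' : Continuous fun u => fderiv ℝ (fun u : E => a (x.1 + x.2 • u)) u v :=
    (hb.continuous_fderiv one_ne_zero).clm_apply continuous_const
  have := integral_smul_fderiv_eq_neg_fderiv_smul_of_integrable
    (μ := (Measure.addHaar : Measure E)) (v := v)
    (f := σ) (g := fun u : E => a (x.1 + x.2 • u))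
    (integrable_smul_comp hσ' hσc' hb.continuous)
    (integrable_smul_comp hσ.continuous hσc hb')
    (integrable_smul_comp hσ.continuous hσc hb.continuous)
    (fun u _ => hσ.differentiable one_ne_zero u) (fun u _ => hb.differentiable one_ne_zero u)
  rw [average, ← this, ← integral_smul]
  simp only [hD]
  congr 1
  ext u
  rw [smul_comm]

/-- Multiplying averages at scale `z` by `z` gains one derivative. -/
lemma contDiff_smul_average {r : ℕ∞} (hr : 1 ≤ r) {ρ : E → ℝ} (hρ : ContDiff ℝ ∞ ρ)
    (hρc : HasCompactSupport ρ) {a : E → F} (ha : ContDiff ℝ r a) :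
    ContDiff ℝ (r + 1) fun x : E × ℝ => x.2 • average ρ a x := by
  have hr' : (1 : ℕ∞ω) ≤ (r : ℕ∞ω) := by exact_mod_cast hr
  have ha1 : ContDiff ℝ 1 a := ha.of_le hr'
  have hle : ∀ m : ℕ∞, (m : ℕ∞ω) ≤ ∞ := fun m => by exact_mod_cast le_top
  have hρ1 : ContDiff ℝ 1 ρ := hρ.of_le (hle 1)
  set b := Module.finBasis ℝ E
  set ξ : Fin (Module.finrank ℝ E) → E →L[ℝ] ℝ := fun i => (b.coord i).toContinuousLinearMap
    with hξ
  have hsum : ∀ v : E, ∑ i, ξ i v • b i = v := fun v => b.sum_repr v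
  -- The derivative of the average in the direction `(w, c)` has integrand `ρ da(w + c u)`.
  -- Expanding `w` and `u` in the basis gives the weights `ρ` and `ξ i * ρ`, and integration by
  -- parts in the direction `b i` then produces `ρ₁` and `ρ₂`.
  set ρ₁ : Fin (Module.finrank ℝ E) → E → ℝ := fun i u => fderiv ℝ ρ u (b i)
  set ρ₂ : Fin (Module.finrank ℝ E) → E → ℝ := fun i u => fderiv ℝ (fun u => ξ i u * ρ u) u (b i)
  have hξρ : ∀ i, ContDiff ℝ ∞ fun u => ξ i u * ρ u := fun i => (ξ i).contDiff.mul hρ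
  have hξρc : ∀ i, HasCompactSupport fun u => ξ i u * ρ u := fun i => hρc.mul_left
  have hsm : ∀ σ : E → ℝ, ContDiff ℝ ∞ σ → HasCompactSupport σ → ∀ v,
      ContDiff ℝ r (average (fun u => fderiv ℝ σ u v) a) := fun σ hσ hσc v =>
    contDiff_average (((hσ.fderiv_right (m := ∞) (by simp)).clm_apply contDiff_const).of_le (hle r))
      (hσc.fderiv_apply ℝ v) ha
  have hav : ContDiff ℝ r (average ρ a) := contDiff_average (hρ.of_le (hle r)) hρc ha
  -- The total derivative is expressed by averages of `a` itself with smooth weights. Being of class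
  -- `C^r`, they make the function `C^(r+1)`.
  have hd : ∀ x, fderiv ℝ (fun x : E × ℝ => x.2 • average ρ a x) x =
      (ContinuousLinearMap.snd ℝ E ℝ).smulRight (average ρ a x - ∑ i, average (ρ₂ i) a x) -
      ∑ i, ((ξ i).comp (ContinuousLinearMap.fst ℝ E ℝ)).smulRight (average (ρ₁ i) a x) := by
    intro x
    have h1 : HasFDerivAt (fun x : E × ℝ => x.2 • average ρ a x) _ x :=
      hasFDerivAt_snd.smul ((hav.of_le hr').differentiable one_ne_zero x).hasFDerivAt
    rw [h1.fderiv]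
    have hfa : Continuous fun u : E => fderiv ℝ a (x.1 + x.2 • u) :=
      (ha1.continuous_fderiv one_ne_zero).comp (by fun_prop)
    have hint : ∀ (σ : E → ℝ), Continuous σ → HasCompactSupport σ → ∀ v,
        Integrable (fun u => σ u • fderiv ℝ a (x.1 + x.2 • u) v) (Measure.addHaar : Measure E) :=
      fun σ hσ hσc v => integrable_smul_comp hσ hσc (hfa.clm_apply continuous_const)
    refine ContinuousLinearMap.ext fun w => ?_
    obtain ⟨w, c⟩ := w
    have h2 : ∫ u, ρ u • fderiv ℝ a (x.1 + x.2 • u) (w + c • u) ∂Measure.addHaar =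
        (∑ i, ξ i w • ∫ u, ρ u • fderiv ℝ a (x.1 + x.2 • u) (b i) ∂Measure.addHaar) +
        c • ∑ i, ∫ u, (ξ i u * ρ u) • fderiv ℝ a (x.1 + x.2 • u) (b i) ∂Measure.addHaar := by
      have hint' : ∀ i, Integrable
          (fun u => ξ i w • ρ u • fderiv ℝ a (x.1 + x.2 • u) (b i)) (Measure.addHaar : Measure E) :=
        fun i => (hint _ hρ.continuous hρc _).smul _
      rw [← integral_finsetSum _ fun i _ => hint _ (hξρ i).continuous (hξρc i) _]
      simp only [← integral_smul]
      rw [← integral_finsetSum _ fun i _ => hint' i, ← integral_add]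
      · congr 1
        ext u
        have hL : ∀ v, fderiv ℝ a (x.1 + x.2 • u) v =
            ∑ i, ξ i v • fderiv ℝ a (x.1 + x.2 • u) (b i) := fun v => by
          conv_lhs => rw [← hsum v]
          simp only [map_sum, map_smul]
        rw [map_add, map_smul, hL w, hL u, smul_add, Finset.smul_sum, Finset.smul_sum,
          Finset.smul_sum, Finset.smul_sum]
        congr 1 <;> refine Finset.sum_congr rfl fun i _ => ?_ <;> module
      · exact integrable_finsetSum _ fun i _ => hint' i
      · exact (integrable_finsetSum _ fun i _ => hint _ (hξρ i).continuous (hξρc i) _).smul c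
    have h3 := fun i => integral_smul_fderiv_eq_neg hρ1 hρc ha1 x (b i)
    have h4 := fun i => integral_smul_fderiv_eq_neg ((hξρ i).of_le (hle 1)) (hξρc i) ha1 x (b i)
    have h5 : x.2 • fderiv ℝ (average ρ a) x (w, c) =
        -(∑ i, ξ i w • average (ρ₁ i) a x) - c • ∑ i, average (ρ₂ i) a x := by
      rw [fderiv_average hρ1 hρc ha1, h2, smul_add, Finset.smul_sum, smul_comm x.2 c,
        Finset.smul_sum]
      simp only [smul_comm x.2 (ξ _ w), h3, h4]
      simp [ρ₁, ρ₂, sub_eq_add_neg]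
    simp only [_root_.add_apply, _root_.smul_apply, h5,
      ContinuousLinearMap.smulRight_apply, _root_.sub_apply,
      _root_.sum_apply, ContinuousLinearMap.coe_snd', ContinuousLinearMap.comp_apply,
      ContinuousLinearMap.coe_fst']
    module
  rw [contDiff_succ_iff_fderiv]
  refine ⟨fun x => (differentiableAt_snd.smul
    ((hav.of_le hr').differentiable one_ne_zero x)), by simp, ?_⟩
  rw [funext hd]
  refine ContDiff.sub ?_ (ContDiff.sum fun i _ => ?_)
  · exact contDiff_const.smulRight (hav.sub (ContDiff.sum fun i _ => hsm _ (hξρ i) (hξρc i) _))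
  · exact contDiff_const.smulRight (hsm _ hρ hρc _)

end Smoothing

/-! ### Prescribing a transverse derivative without losing regularity -/

section Extension

variable {E F : Type*} [NormedAddCommGroup E] [NormedSpace ℝ E] [FiniteDimensional ℝ E]
  [NormedAddCommGroup F] [NormedSpace ℝ F]

/-- Cutting off a map which is `C^r` near a point. -/
lemma exists_contDiff_eqOn_ball {r : ℕ∞} {a : E → F} {y₀ : E} {ε : ℝ} (hε : 0 < ε)
    (ha : ContDiffOn ℝ r a (Metric.ball y₀ ε)) :
    ∃ a' : E → F, ContDiff ℝ r a' ∧ EqOn a' a (Metric.ball y₀ (ε / 2)) := by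
  let χ : ContDiffBump y₀ := ⟨ε / 2, ε * (3 / 4), by positivity, by linarith⟩
  refine ⟨fun y => χ y • a y, ?_, fun y hy => ?_⟩
  · rw [contDiff_iff_contDiffAt]
    intro y
    by_cases hy : y ∈ Metric.ball y₀ ε
    · exact χ.contDiffAt.smul (ha.contDiffAt (Metric.isOpen_ball.mem_nhds hy))
    · have : y ∉ tsupport χ := by
        rw [χ.tsupport_eq, Metric.mem_closedBall]
        rw [Metric.mem_ball] at hy
        change ¬ (dist y y₀ ≤ ε * (3 / 4))
        linarith
      have h0 := notMem_tsupport_iff_eventuallyEq.1 this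
      refine contDiffAt_const (c := (0 : F)) |>.congr_of_eventuallyEq ?_
      filter_upwards [h0] with z hz
      simp [hz]
  · have : χ y = 1 := χ.one_of_mem_closedBall (Metric.ball_subset_closedBall hy)
    simp [this]

/-- A `C^(r+1)` map which vanishes on the kernel of `Q` and has there a prescribed
derivative of class `C^r` only. -/
lemma exists_contDiff_hasFDerivAt_comp [CompleteSpace F] {r : ℕ∞} (hr : 1 ≤ r) (Q : E →L[ℝ] E)
    {A : E → E →L[ℝ] F} {y₀ : E} {ε : ℝ} (hε : 0 < ε)
    (hA : ContDiffOn ℝ r A (Metric.ball y₀ ε)) :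
    ∃ H : E → F, ContDiff ℝ (r + 1) H ∧ (∀ y, Q y = 0 → H y = 0) ∧
      ∀ y ∈ Metric.ball y₀ (ε / 2), Q y = 0 → HasFDerivAt H ((A y).comp Q) y := by
  borelize E
  obtain ⟨A', hA', hAA'⟩ := exists_contDiff_eqOn_ball hε hA
  let χ : ContDiffBump (0 : E) := ⟨1, 2, by norm_num, by norm_num⟩
  set ρ : E → ℝ := χ.normed MeasureTheory.Measure.addHaar with hρ
  set b := Module.finBasis ℝ E
  set ℓ : Fin (Module.finrank ℝ E) → E →L[ℝ] ℝ :=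
    fun i => (b.coord i).toContinuousLinearMap.comp Q with hℓ
  have hsum : ∀ v : E, ∑ i, ℓ i v • b i = Q v := fun v => b.sum_repr (Q v)
  -- Formally `(A y)(Q y) = ∑ ℓ i y • A y (b i)`. Each coefficient is replaced by its average at
  -- scale `ℓ i y`, which is the true coefficient where `ℓ i` vanishes, and the product with `ℓ i`
  -- is then `C^(r+1)`.
  set G : Fin (Module.finrank ℝ E) → E × ℝ → F :=
    fun i x => x.2 • average ρ (fun y => A' y (b i)) x with hG
  have ha : ∀ i, ContDiff ℝ r fun y => A' y (b i) := fun i => hA'.clm_apply contDiff_const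
  have hGd : ∀ i, ContDiff ℝ (r + 1) (G i) := fun i =>
    contDiff_smul_average hr χ.contDiff_normed χ.hasCompactSupport_normed (ha i)
  have hav : ∀ i, ContDiff ℝ r (average ρ fun y => A' y (b i)) := fun i =>
    contDiff_average χ.contDiff_normed χ.hasCompactSupport_normed (ha i)
  refine ⟨fun y => ∑ i, G i (y, ℓ i y), ?_, ?_, ?_⟩
  · exact ContDiff.sum fun i _ => (hGd i).comp (contDiff_id.prodMk (ℓ i).contDiff)
  · intro y hy
    simp [hG, hℓ, hy]
  · intro y hy hQ
    have hℓ0 : ∀ i, ℓ i y = 0 := fun i => by simp [hℓ, hQ]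
    have h1 : ∀ i, HasFDerivAt (fun y => ℓ i y • average ρ (fun y => A' y (b i)) (y, ℓ i y))
        ((ℓ i).smulRight (A y (b i))) y := by
      intro i
      have hd : DifferentiableAt ℝ (fun y => average ρ (fun y => A' y (b i)) (y, ℓ i y)) y := by
        refine DifferentiableAt.comp (g := average ρ fun y => A' y (b i))
          (f := fun y => (y, ℓ i y)) y ?_ ?_
        · exact (hav i).differentiable (by
            have : (0 : ℕ∞) < r := lt_of_lt_of_le one_pos hr
            exact_mod_cast this.ne') _
        · exact differentiableAt_id.prodMk (ℓ i).differentiableAt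
      -- At a point with `ℓ i y = 0` the derivative of the average drops out of the product rule.
      -- The value of the average at scale 0 remains, which is the coefficient because `ρ` has
      -- integral 1.
      have h2 := (ℓ i).hasFDerivAt.smul hd.hasFDerivAt (x := y)
      refine h2.congr_fderiv ?_
      rw [hℓ0 i, zero_smul, zero_add, average_zero_right, hρ, χ.integral_normed, one_smul,
        hAA' hy]
    refine (HasFDerivAt.fun_sum fun i _ => h1 i).congr_fderiv ?_
    refine ContinuousLinearMap.ext fun v => ?_
    simp only [_root_.sum_apply, ContinuousLinearMap.smulRight_apply,
      ContinuousLinearMap.comp_apply, ← hsum v, map_sum, map_smul]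

end Extension

/-! ### Total differential equations with an integrability condition -/

section Pfaff

variable {E 𝔸 : Type*} [NormedAddCommGroup E] [NormedSpace ℝ E] [FiniteDimensional ℝ E]
  [NormedRing 𝔸] [NormedAlgebra ℝ 𝔸] [CompleteSpace 𝔸]

lemma hasFDerivAt_intervalIntegral {F : Type*} [NormedAddCommGroup F] [NormedSpace ℝ F]
    [CompleteSpace F] {G : E × ℝ → F} (hG : ContDiff ℝ 1 G) (x : E) :
    HasFDerivAt (fun x => ∫ t in (0 : ℝ)..1, G (x, t))
      (∫ t in (0 : ℝ)..1, (fderiv ℝ G (x, t)).comp (ContinuousLinearMap.inl ℝ E ℝ)) x := by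
  have hc : Continuous fun p : E × ℝ => (fderiv ℝ G p).comp (ContinuousLinearMap.inl ℝ E ℝ) :=
    (hG.continuous_fderiv one_ne_zero).clm_comp continuous_const
  have hK : IsCompact (Metric.closedBall x 1 ×ˢ Icc (0 : ℝ) 1) :=
    (isCompact_closedBall x 1).prod isCompact_Icc
  obtain ⟨C, hC⟩ := hK.exists_bound_of_continuousOn hc.continuousOn
  refine intervalIntegral.hasFDerivAt_integral_of_dominated_of_fderiv_le (bound := fun _ => C)
    (F := fun x t => G (x, t)) (F' := fun x t => (fderiv ℝ G (x, t)).comp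
      (ContinuousLinearMap.inl ℝ E ℝ)) (Metric.closedBall_mem_nhds x one_pos) ?_ ?_ ?_ ?_ ?_ ?_
  · exact Eventually.of_forall fun y =>
      (hG.continuous.comp (by fun_prop : Continuous fun t : ℝ => (y, t))).aestronglyMeasurable
  · exact (hG.continuous.comp (by fun_prop : Continuous fun t : ℝ => (x, t))).intervalIntegrable _ _
  · exact (hc.comp (by fun_prop : Continuous fun t : ℝ => (x, t))).aestronglyMeasurable
  · refine Eventually.of_forall fun t ht y hy => hC (y, t) ⟨hy, ?_⟩
    rw [uIoc_of_le zero_le_one] at ht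
    exact ⟨ht.1.le, ht.2⟩
  · exact intervalIntegrable_const
  · refine Eventually.of_forall fun t _ y _ => ?_
    exact ((hG.differentiable one_ne_zero _).hasFDerivAt).comp y (hasFDerivAt_prodMk_left y t)

/-- The integral operator whose fixed points solve the radial equation. -/
def radialIntegral (a : E → E →L[ℝ] 𝔸) (S : E → 𝔸) (x : E) : 𝔸 :=
  -∫ t in (0 : ℝ)..1, a (t • x) x * S (t • x)

/-- The defect of `S` as a solution of `dS = - a S`. -/
def pfaffDefect (a : E → E →L[ℝ] 𝔸) (S : E → 𝔸) (x v : E) : 𝔸 :=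
  fderiv ℝ S x v + a x v * S x

lemma contDiff_radialIntegrand {a : E → E →L[ℝ] 𝔸} {S : E → 𝔸} (ha : ContDiff ℝ 1 a)
    (hS : ContDiff ℝ 1 S) :
    ContDiff ℝ 1 fun p : E × ℝ => a (p.2 • p.1) p.1 * S (p.2 • p.1) := by
  have h : ContDiff ℝ 1 fun p : E × ℝ => p.2 • p.1 := by fun_prop
  exact ((ha.comp h).clm_apply contDiff_fst).mul (hS.comp h)

lemma contDiff_radialIntegral {a : E → E →L[ℝ] 𝔸} {S : E → 𝔸} (ha : ContDiff ℝ 1 a)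
    (hS : ContDiff ℝ 1 S) : ContDiff ℝ 1 (radialIntegral a S) := by
  have hG := contDiff_radialIntegrand ha hS
  have h := hasFDerivAt_intervalIntegral hG
  refine ContDiff.neg ?_
  rw [contDiff_one_iff_fderiv]
  refine ⟨fun x => (h x).differentiableAt, ?_⟩
  rw [funext fun x => (h x).fderiv]
  refine intervalIntegral.continuous_parametric_intervalIntegral_of_continuous' ?_ 0 1
  exact ((hG.continuous_fderiv one_ne_zero).clm_comp continuous_const)

/-- Differentiate under the integral and subtract the integral of `d/dt (t a(tx)v S(tx))`, whose
value is `a(x)v S(x)`. What remains contains the antisymmetric part of `da`, which the integrability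
condition replaces by a commutator of values of `a`. The terms then assemble into defects of `S`, so
the error of an iterate is governed by the error of its predecessor. -/
lemma fderiv_radialIntegral {a : E → E →L[ℝ] 𝔸} {S : E → 𝔸} (ha : ContDiff ℝ 1 a)
    (hS : ContDiff ℝ 1 S) {δ : ℝ}
    (hflat : ∀ y ∈ Metric.ball (0 : E) δ, ∀ u v, fderiv ℝ a y u v + a y u * a y v =
      fderiv ℝ a y v u + a y v * a y u) {x : E} (hx : x ∈ Metric.ball (0 : E) δ) (v : E) :
    fderiv ℝ (radialIntegral a S) x v = -(a x v * S x) +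
      ∫ t in (0 : ℝ)..1, t • (a (t • x) v * pfaffDefect a S (t • x) x -
        a (t • x) x * pfaffDefect a S (t • x) v) := by
  have hG := contDiff_radialIntegrand ha hS
  have hsm : ∀ t : ℝ, HasDerivAt (fun t : ℝ => t • x) x t := fun t => by
    simpa using (hasDerivAt_id t).smul_const x
  have ha' : ∀ y, HasFDerivAt a (fderiv ℝ a y) y := fun y =>
    (ha.differentiable one_ne_zero y).hasFDerivAt
  have hS' : ∀ y, HasFDerivAt S (fderiv ℝ S y) y := fun y =>
    (hS.differentiable one_ne_zero y).hasFDerivAt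
  have hac : Continuous fun t : ℝ => a (t • x) := ha.continuous.comp (by fun_prop)
  have hSc : Continuous fun t : ℝ => S (t • x) := hS.continuous.comp (by fun_prop)
  have hac' : Continuous fun t : ℝ => fderiv ℝ a (t • x) :=
    (ha.continuous_fderiv one_ne_zero).comp (by fun_prop)
  have hSc' : Continuous fun t : ℝ => fderiv ℝ S (t • x) :=
    (hS.continuous_fderiv one_ne_zero).comp (by fun_prop)
  -- the derivative of the integrand
  have h1 : ∀ t : ℝ, fderiv ℝ (fun p : E × ℝ => a (p.2 • p.1) p.1 * S (p.2 • p.1)) (x, t) (v, 0) =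
      (t • fderiv ℝ a (t • x) v x + a (t • x) v) * S (t • x) +
        a (t • x) x * (t • fderiv ℝ S (t • x) v) := by
    intro t
    have h2 : HasFDerivAt (fun p : E × ℝ => p.2 • p.1) _ (x, t) :=
      (hasFDerivAt_snd (𝕜 := ℝ) (p := (x, t))).smul (hasFDerivAt_fst (𝕜 := ℝ) (p := (x, t)))
    have h3 := ((ha' (t • x)).comp (x, t) h2).clm_apply (hasFDerivAt_fst (𝕜 := ℝ) (p := (x, t)))
    have h4 : HasFDerivAt (fun p : E × ℝ => a (p.2 • p.1) p.1 * S (p.2 • p.1)) _ (x, t) :=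
      h3.mul' ((hS' (t • x)).comp (x, t) h2)
    rw [h4.fderiv]
    simp [add_mul]
    abel
  have h2 : ∀ t : ℝ, HasDerivAt (fun t : ℝ => t • (a (t • x) v * S (t • x)))
      (t • (fderiv ℝ a (t • x) x v * S (t • x) + a (t • x) v * fderiv ℝ S (t • x) x) +
        a (t • x) v * S (t • x)) t := by
    intro t
    have h30 : HasDerivAt (fun t : ℝ => a (t • x)) (fderiv ℝ a (t • x) x) t :=
      (ha' (t • x)).comp_hasDerivAt t (hsm t)
    have h3 : HasDerivAt (fun t : ℝ => a (t • x) v) (fderiv ℝ a (t • x) x v) t :=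
      ((ContinuousLinearMap.apply ℝ 𝔸 v).hasFDerivAt).comp_hasDerivAt t h30
    have h4 : HasDerivAt (fun t : ℝ => S (t • x)) (fderiv ℝ S (t • x) x) t :=
      (hS' (t • x)).comp_hasDerivAt t (hsm t)
    have h5 := (hasDerivAt_id t).smul (h3.mul h4)
    rw [one_smul] at h5
    exact h5
  have h3 : ∫ t in (0 : ℝ)..1,
      (t • (fderiv ℝ a (t • x) x v * S (t • x) + a (t • x) v * fderiv ℝ S (t • x) x) +
        a (t • x) v * S (t • x)) = a x v * S x := by
    rw [intervalIntegral.integral_eq_sub_of_hasDerivAt fun t _ => h2 t]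
    · simp
    · exact Continuous.intervalIntegrable (by fun_prop) _ _
  have h4 : fderiv ℝ (radialIntegral a S) x v = -∫ t in (0 : ℝ)..1,
      fderiv ℝ (fun p : E × ℝ => a (p.2 • p.1) p.1 * S (p.2 • p.1)) (x, t) (v, 0) := by
    have h5 : HasFDerivAt (radialIntegral a S) _ x := (hasFDerivAt_intervalIntegral hG x).neg
    rw [h5.fderiv, neg_apply, ContinuousLinearMap.intervalIntegral_apply]
    · simp
    · refine Continuous.intervalIntegrable ?_ _ _
      exact ((hG.continuous_fderiv one_ne_zero).comp (by fun_prop)).clm_comp continuous_const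
  rw [h4, ← h3, ← intervalIntegral.integral_neg, ← intervalIntegral.integral_neg,
    ← intervalIntegral.integral_add]
  · refine intervalIntegral.integral_congr fun t ht => ?_
    rw [uIcc_of_le zero_le_one] at ht
    have htx : t • x ∈ Metric.ball (0 : E) δ := by
      rw [mem_ball_zero_iff] at hx ⊢
      rw [norm_smul, Real.norm_of_nonneg ht.1]
      exact lt_of_le_of_lt (mul_le_of_le_one_left (norm_nonneg _) ht.2) hx
    have hf := hflat _ htx v x
    have hf' : fderiv ℝ a (t • x) v x = fderiv ℝ a (t • x) x v + a (t • x) x * a (t • x) v -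
        a (t • x) v * a (t • x) x := by rw [← hf]; abel
    simp only [h1, pfaffDefect, hf']
    simp only [smul_add, smul_sub, mul_add, add_mul, sub_mul, mul_smul_comm,
      smul_mul_assoc, mul_assoc]
    abel
  · exact Continuous.intervalIntegrable (by fun_prop) _ _
  · refine Continuous.intervalIntegrable ?_ _ _
    unfold pfaffDefect
    fun_prop

/-- Total differential equations `dΦ = - a Φ` which satisfy the integrability condition are locally
solvable. -/
lemma exists_pfaff_solution_aux {a : E → E →L[ℝ] 𝔸} (ha : ContDiff ℝ 1 a) {ε : ℝ} (hε : 0 < ε)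
    (hflat : ∀ y ∈ Metric.ball (0 : E) ε, ∀ u v, fderiv ℝ a y u v + a y u * a y v =
      fderiv ℝ a y v u + a y v * a y u) :
    ∃ δ > 0, δ ≤ ε ∧ ∃ Φ : E → 𝔸, Φ 0 = 1 ∧ ∀ y ∈ Metric.ball (0 : E) δ,
      HasFDerivAt Φ (-((ContinuousLinearMap.mul ℝ 𝔸).flip (Φ y)).comp (a y)) y := by
  obtain ⟨C, hC⟩ := (isCompact_closedBall (0 : E) 1).exists_bound_of_continuousOn
    ha.continuous.continuousOn
  have hC0 : 0 ≤ C := (norm_nonneg _).trans (hC 0 (by simp))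
  -- With `C * δ ≤ 1 / 8` the radial operator contracts with a ratio below `1 / 4`, while the
  -- integral of defects contributes at most a quarter of the previous bound.
  obtain ⟨δ, hδ0, hδε, hδ1, hδC⟩ : ∃ δ > 0, δ ≤ ε ∧ δ ≤ 1 ∧ C * δ ≤ 1 / 8 := by
    refine ⟨min ε (min 1 (1 / (8 * (C + 1)))), by positivity, min_le_left _ _,
      (min_le_right _ _).trans (min_le_left _ _), ?_⟩
    have h1 : min ε (min 1 (1 / (8 * (C + 1)))) ≤ 1 / (8 * (C + 1)) :=
      (min_le_right _ _).trans (min_le_right _ _)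
    refine (mul_le_mul_of_nonneg_left h1 hC0).trans ?_
    rw [mul_one_div, div_le_div_iff₀ (by positivity) (by norm_num)]
    linarith
  have hB : ∀ x ∈ Metric.ball (0 : E) δ, ∀ t ∈ Icc (0 : ℝ) 1, t • x ∈ Metric.ball (0 : E) δ := by
    intro x hx t ht
    rw [mem_ball_zero_iff] at hx ⊢
    rw [norm_smul, Real.norm_of_nonneg ht.1]
    exact lt_of_le_of_lt (mul_le_of_le_one_left (norm_nonneg _) ht.2) hx
  have hCB : ∀ x ∈ Metric.ball (0 : E) δ, ‖a x‖ ≤ C := fun x hx =>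
    hC x (Metric.ball_subset_closedBall (Metric.ball_subset_ball hδ1 hx))
  have hCx : ∀ x ∈ Metric.ball (0 : E) δ, ∀ y ∈ Metric.ball (0 : E) δ, ‖a y x‖ ≤ 1 / 8 := by
    intro x hx y hy
    refine ((a y).le_opNorm x).trans (le_trans ?_ hδC)
    exact mul_le_mul (hCB y hy) (mem_ball_zero_iff.1 hx).le (norm_nonneg _) hC0
  -- Picard iteration for `S = 1 + radialIntegral a S`. Starting from 0, the first defect vanishes
  -- and the first increment is the constant 1.
  set S : ℕ → E → 𝔸 := fun m => (fun f x => 1 + radialIntegral a f x)^[m] (fun _ => 0) with hS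
  have hS0 : S 0 = fun _ => 0 := rfl
  have hSs : ∀ m, S (m + 1) = fun x => 1 + radialIntegral a (S m) x := fun m => by
    simp only [hS, Function.iterate_succ_apply']
  have hSd : ∀ m, ContDiff ℝ 1 (S m) := fun m => by
    induction m with
    | zero => exact contDiff_const
    | succ m ih => rw [hSs]; exact contDiff_const.add (contDiff_radialIntegral ha ih)
  have hSz : ∀ m, S (m + 1) 0 = 1 := fun m => by simp [hSs, radialIntegral]
  set N : ℝ := ‖(1 : 𝔸)‖
  have hdiff : ∀ m, ∀ x ∈ Metric.ball (0 : E) δ, ‖S (m + 1) x - S m x‖ ≤ N * (1 / 4) ^ m := by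
    intro m
    induction m with
    | zero => intro x _; simp [hSs, hS0, radialIntegral, N]
    | succ m ih =>
      intro x hx
      have hc : ∀ m, IntervalIntegrable (fun t : ℝ => a (t • x) x * S m (t • x))
          MeasureTheory.volume 0 1 := fun m => by
        have := (hSd m).continuous
        have := ha.continuous
        exact Continuous.intervalIntegrable (by fun_prop) _ _
      have h1 : S (m + 1 + 1) x - S (m + 1) x =
          -∫ t in (0 : ℝ)..1, a (t • x) x * (S (m + 1) (t • x) - S m (t • x)) := by
        rw [congrFun (hSs (m + 1)) x, congrFun (hSs m) x]
        simp only [radialIntegral, mul_sub]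
        rw [intervalIntegral.integral_sub (hc _) (hc _)]
        abel
      rw [h1, norm_neg]
      have h2 := intervalIntegral.norm_integral_le_of_norm_le_const (a := (0 : ℝ)) (b := 1)
        (f := fun t => a (t • x) x * (S (m + 1) (t • x) - S m (t • x)))
        (C := 1 / 8 * (N * (1 / 4) ^ m)) fun t ht => by
          rw [uIoc_of_le zero_le_one] at ht
          have ht' : t ∈ Icc (0 : ℝ) 1 := ⟨ht.1.le, ht.2⟩
          exact (norm_mul_le _ _).trans (mul_le_mul (hCx x hx _ (hB x hx t ht'))
            (ih _ (hB x hx t ht')) (norm_nonneg _) (by norm_num))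
      refine h2.trans ?_
      have : 0 ≤ N * (1 / 4) ^ m := by positivity
      rw [pow_succ, sub_zero, abs_one, mul_one]
      linarith
  -- The defect of `S (m + 1)` is `a x v * (S (m + 1) x - S m x)` plus an integral of defects of `S
  -- m`. Each is at most a quarter of the bound for `m`: the former because the increments decay
  -- like `4⁻ᵐ` and `4 * C * N` has the factor 4, the latter by the choice of `δ`. Their sum gives
  -- ratio `1 / 2`.
  have hω : ∀ m, ∀ x ∈ Metric.ball (0 : E) δ, ∀ v,
      ‖pfaffDefect a (S m) x v‖ ≤ 4 * C * N * (1 / 2) ^ m * ‖v‖ := by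
    intro m
    induction m with
    | zero =>
      intro x _ v
      simp only [pfaffDefect, hS0, fderiv_fun_const, Pi.zero_apply, _root_.zero_apply, mul_zero,
        add_zero, norm_zero]
      positivity
    | succ m ih =>
      intro x hx v
      have h1 : pfaffDefect a (S (m + 1)) x v = a x v * (S (m + 1) x - S m x) +
          ∫ t in (0 : ℝ)..1, t • (a (t • x) v * pfaffDefect a (S m) (t • x) x -
            a (t • x) x * pfaffDefect a (S m) (t • x) v) := by
        have h2 : fderiv ℝ (S (m + 1)) x v = -(a x v * S m x) +
            ∫ t in (0 : ℝ)..1, t • (a (t • x) v * pfaffDefect a (S m) (t • x) x -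
              a (t • x) x * pfaffDefect a (S m) (t • x) v) := by
          rw [← fderiv_radialIntegral ha (hSd m) hflat (Metric.ball_subset_ball hδε hx), hSs m,
            fderiv_const_add]
        rw [pfaffDefect, h2, mul_sub]
        abel
      set K := 4 * C * N * (1 / 2 : ℝ) ^ m with hK
      have hK0 : 0 ≤ K := by positivity
      have h3 := intervalIntegral.norm_integral_le_of_norm_le_const (a := (0 : ℝ)) (b := 1)
        (f := fun t => t • (a (t • x) v * pfaffDefect a (S m) (t • x) x -
            a (t • x) x * pfaffDefect a (S m) (t • x) v))
        (C := K * ‖v‖ / 4) fun t ht => by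
          rw [uIoc_of_le zero_le_one] at ht
          have ht' : t ∈ Icc (0 : ℝ) 1 := ⟨ht.1.le, ht.2⟩
          have htx := hB x hx t ht'
          have h4 : ‖a (t • x) v * pfaffDefect a (S m) (t • x) x‖ ≤ K * ‖v‖ / 8 := by
            refine (norm_mul_le _ _).trans ?_
            have h5 : ‖a (t • x) v‖ ≤ C * ‖v‖ :=
              ((a (t • x)).le_opNorm v).trans
                (mul_le_mul_of_nonneg_right (hCB _ htx) (norm_nonneg _))
            have h6 : ‖pfaffDefect a (S m) (t • x) x‖ ≤ K * δ :=
              (ih _ htx x).trans (mul_le_mul_of_nonneg_left (mem_ball_zero_iff.1 hx).le hK0)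
            refine (mul_le_mul h5 h6 (norm_nonneg _) (by positivity)).trans ?_
            calc C * ‖v‖ * (K * δ) = K * ‖v‖ * (C * δ) := by ring
              _ ≤ K * ‖v‖ * (1 / 8) := mul_le_mul_of_nonneg_left hδC (by positivity)
              _ = K * ‖v‖ / 8 := by ring
          have h5 : ‖a (t • x) x * pfaffDefect a (S m) (t • x) v‖ ≤ K * ‖v‖ / 8 := by
            refine (norm_mul_le _ _).trans ((mul_le_mul (hCx x hx _ htx) (ih _ htx v)
              (norm_nonneg _) (by norm_num)).trans (le_of_eq ?_))
            ring
          rw [norm_smul, Real.norm_of_nonneg ht'.1]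
          refine (mul_le_of_le_one_left (norm_nonneg _) ht'.2).trans ?_
          refine (norm_sub_le _ _).trans ((add_le_add h4 h5).trans (le_of_eq ?_))
          ring
      rw [h1]
      refine (norm_add_le _ _).trans ?_
      have h7 : ‖a x v * (S (m + 1) x - S m x)‖ ≤ C * ‖v‖ * (N * (1 / 4) ^ m) := by
        refine (norm_mul_le _ _).trans (mul_le_mul ?_ (hdiff m x hx) (norm_nonneg _)
          (by positivity))
        exact ((a x).le_opNorm v).trans (mul_le_mul_of_nonneg_right (hCB _ hx) (norm_nonneg _))
      have h8 : (1 / 4 : ℝ) ^ m ≤ (1 / 2) ^ m := pow_le_pow_left₀ (by norm_num) (by norm_num) m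
      have h9 : C * ‖v‖ * (N * (1 / 4) ^ m) ≤ K * ‖v‖ / 4 := by
        calc C * ‖v‖ * (N * (1 / 4) ^ m) ≤ C * ‖v‖ * (N * (1 / 2) ^ m) := by gcongr
          _ = K * ‖v‖ / 4 := by rw [hK]; ring
      rw [sub_zero, abs_one, mul_one] at h3
      refine (add_le_add (h7.trans h9) h3).trans (le_of_eq ?_)
      rw [hK, pow_succ]
      ring
  -- the limit
  have hlim : ∀ x ∈ Metric.ball (0 : E) δ, ∃ l, Tendsto (fun m => S m x) atTop (𝓝 l) := by
    intro x hx
    refine cauchySeq_tendsto_of_complete (cauchySeq_of_le_geometric (1 / 4) N (by norm_num) ?_)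
    intro m
    rw [dist_eq_norm, ← norm_neg, neg_sub]
    exact hdiff m x hx
  choose! Φ hΦ using hlim
  have hΦd : ∀ x ∈ Metric.ball (0 : E) δ, ∀ m, ‖S m x - Φ x‖ ≤ N * (1 / 4) ^ m / (1 - 1 / 4) := by
    intro x hx m
    rw [← dist_eq_norm]
    refine dist_le_of_le_geometric_of_tendsto (1 / 4) N (by norm_num) (fun m => ?_) (hΦ x hx) m
    rw [dist_eq_norm, ← norm_neg, neg_sub]
    exact hdiff m x hx
  refine ⟨δ, hδ0, hδε, Φ, ?_, fun y hy => ?_⟩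
  · refine tendsto_nhds_unique (hΦ 0 (Metric.mem_ball_self hδ0)) ?_
    refine (tendsto_add_atTop_iff_nat 1).1 ?_
    simp only [hSz]
    exact tendsto_const_nhds
  -- Since `fderiv (S m)` is the defect minus `a * S m`, it converges uniformly to `-a Φ`, so the
  -- limit may be differentiated termwise.
  · refine hasFDerivAt_of_tendstoUniformlyOn (l := atTop) (f := S) (g := Φ)
      (f' := fun m x => fderiv ℝ (S m) x)
      (g' := fun y => -((ContinuousLinearMap.mul ℝ 𝔸).flip (Φ y)).comp (a y)) Metric.isOpen_ball ?_
      (fun m x _ => ((hSd m).differentiable one_ne_zero x).hasFDerivAt) hΦ hy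
    rw [Metric.tendstoUniformlyOn_iff]
    intro η hη
    have hlim0 : Tendsto (fun m : ℕ => 4 * C * N * (1 / 2 : ℝ) ^ m +
        C * (N * (1 / 4) ^ m / (1 - 1 / 4))) atTop (𝓝 0) := by
      have h2 := tendsto_pow_atTop_nhds_zero_of_lt_one (r := (1 / 2 : ℝ)) (by norm_num)
        (by norm_num)
      have h4 := tendsto_pow_atTop_nhds_zero_of_lt_one (r := (1 / 4 : ℝ)) (by norm_num)
        (by norm_num)
      simpa using (h2.const_mul (4 * C * N)).add
        (((h4.const_mul N).div_const (1 - 1 / 4)).const_mul C)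
    filter_upwards [hlim0.eventually (gt_mem_nhds hη)] with m hm x hx
    rw [dist_comm, dist_eq_norm]
    refine lt_of_le_of_lt (ContinuousLinearMap.opNorm_le_bound _ (by positivity) fun v => ?_) hm
    have h1 : (fderiv ℝ (S m) x - -((ContinuousLinearMap.mul ℝ 𝔸).flip (Φ x)).comp (a x)) v =
        pfaffDefect a (S m) x v - a x v * (S m x - Φ x) := by
      simp [pfaffDefect, mul_sub]
      abel
    rw [h1]
    refine (norm_sub_le _ _).trans ?_
    rw [add_mul]
    refine add_le_add (hω m x hx v) ((norm_mul_le _ _).trans ?_)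
    calc ‖a x v‖ * ‖S m x - Φ x‖ ≤ (C * ‖v‖) * (N * (1 / 4) ^ m / (1 - 1 / 4)) :=
          mul_le_mul (((a x).le_opNorm v).trans (mul_le_mul_of_nonneg_right (hCB _ hx)
            (norm_nonneg _))) (hΦd x hx m) (norm_nonneg _) (by positivity)
      _ = _ := by ring

/-- Bootstrapping: the equation shows that the derivative of `Φ` is as smooth as `a` and `Φ`
together. Each round raises the class of `Φ` by one until the class of `a` is exhausted. -/
lemma contDiffOn_pfaff_solution {k : ℕ∞} {a : E → E →L[ℝ] 𝔸} {Φ : E → 𝔸} {s : Set E}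
    (hs : IsOpen s) (ha : ContDiffOn ℝ k a s)
    (hΦ : ∀ y ∈ s, HasFDerivAt Φ (-((ContinuousLinearMap.mul ℝ 𝔸).flip (Φ y)).comp (a y)) y) :
    ContDiffOn ℝ (k + 1) Φ s := by
  have key : ∀ m : ℕ, (m : ℕ∞) ≤ k → ContDiffOn ℝ (m + 1 : ℕ) Φ s := by
    intro m hm
    have hstep : ∀ m : ℕ, (m : ℕ∞) ≤ k → ContDiffOn ℝ m Φ s → ContDiffOn ℝ (m + 1 : ℕ) Φ s := by
      intro m hm hc
      push_cast
      rw [contDiffOn_succ_iff_fderiv_of_isOpen hs]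
      refine ⟨fun y hy => (hΦ y hy).differentiableAt.differentiableWithinAt, by simp, ?_⟩
      have h1 : ContDiffOn ℝ m
          (fun y => -((ContinuousLinearMap.mul ℝ 𝔸).flip (Φ y)).comp (a y)) s :=
        ((((ContinuousLinearMap.mul ℝ 𝔸).flip).contDiff.comp_contDiffOn hc).clm_comp
          (ha.of_le (by exact_mod_cast hm))).neg
      exact h1.congr fun y hy => (hΦ y hy).fderiv
    induction m with
    | zero =>
      refine hstep 0 hm ?_
      simp only [Nat.cast_zero, contDiffOn_zero]
      exact fun y hy => (hΦ y hy).continuousAt.continuousWithinAt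
    | succ m ih =>
      exact hstep (m + 1) hm (ih (le_trans (by exact_mod_cast Nat.le_succ m) hm))
  rw [show ((k : ℕ∞ω) + 1) = ((k + 1 : ℕ∞) : ℕ∞ω) by push_cast; rfl,
    contDiffOn_iff_forall_nat_le]
  intro m hm
  cases m with
  | zero => exact (key 0 zero_le).of_le (by simp)
  | succ m =>
    refine key m ?_
    push_cast at hm
    exact (ENat.add_le_add_iff_right ENat.one_ne_top).1 hm

/-- Total differential equations `dΦ = - a Φ` which satisfy the integrability condition are locally
solvable. -/
lemma exists_pfaff_solution {k : ℕ∞} (hk : 1 ≤ k) {a : E → E →L[ℝ] 𝔸} {y₀ : E} {ε : ℝ}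
    (hε : 0 < ε) (ha : ContDiffOn ℝ k a (Metric.ball y₀ ε))
    (hflat : ∀ y ∈ Metric.ball y₀ ε, ∀ u v, fderiv ℝ a y u v + a y u * a y v =
      fderiv ℝ a y v u + a y v * a y u) :
    ∃ δ > 0, δ ≤ ε ∧ ∃ Φ : E → 𝔸, ContDiffOn ℝ (k + 1) Φ (Metric.ball y₀ δ) ∧
      ∀ y ∈ Metric.ball y₀ δ, IsUnit (Φ y) ∧
        HasFDerivAt Φ (-((ContinuousLinearMap.mul ℝ 𝔸).flip (Φ y)).comp (a y)) y := by
  have hk' : ((1 : ℕ∞) : ℕ∞ω) ≤ (k : ℕ∞ω) := by exact_mod_cast hk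
  -- The iteration uses a globally `C^1` form and the centre 0, hence the cut-off and the
  -- translation.
  obtain ⟨a', ha', haa'⟩ := exists_contDiff_eqOn_ball hε (ha.of_le hk')
  have hb : ∀ y ∈ Metric.ball (0 : E) (ε / 2), y₀ + y ∈ Metric.ball y₀ (ε / 2) := fun y hy => by
    simpa using hy
  have hsub : Metric.ball y₀ (ε / 2) ⊆ Metric.ball y₀ ε := Metric.ball_subset_ball (by linarith)
  have hfa : ∀ y ∈ Metric.ball (0 : E) (ε / 2),
      fderiv ℝ (fun y => a' (y₀ + y)) y = fderiv ℝ a (y₀ + y) := by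
    intro y hy
    rw [fderiv_comp_add_left]
    exact (haa'.eventuallyEq_of_mem (Metric.isOpen_ball.mem_nhds (hb y hy))).fderiv_eq
  obtain ⟨δ, hδ, hδε, Φ, hΦ0, hΦ⟩ := exists_pfaff_solution_aux (a := fun y => a' (y₀ + y))
    (ha'.comp (by fun_prop)) (half_pos hε) (fun y hy u v => by
      simp only [hfa y hy, haa' (hb y hy)]
      exact hflat _ (hsub (hb y hy)) u v)
  have hΦ' : ∀ y ∈ Metric.ball y₀ δ, HasFDerivAt (fun y => Φ (y - y₀))
      (-((ContinuousLinearMap.mul ℝ 𝔸).flip (Φ (y - y₀))).comp (a y)) y := by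
    intro y hy
    have h1 := hΦ (y - y₀) (by rwa [mem_ball_zero_iff, ← mem_ball_iff_norm])
    have h2 := HasFDerivAt.comp (f := fun y => y - y₀) y h1 ((hasFDerivAt_id y).sub_const y₀)
    have h3 : a' y = a y := haa' (Metric.ball_subset_ball hδε hy)
    simpa [Function.comp_def, h3] using h2
  -- `Φ` equals 1 at the centre, and units form an open set.
  have hunit : ∀ᶠ y in 𝓝 y₀, IsUnit (Φ (y - y₀)) := by
    have hc : ContinuousAt (fun y => Φ (y - y₀)) y₀ :=
      (hΦ' y₀ (Metric.mem_ball_self hδ)).continuousAt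
    refine hc.eventually (?_ : ∀ᶠ z in 𝓝 (Φ (y₀ - y₀)), IsUnit z)
    rw [sub_self, hΦ0]
    exact Units.isOpen.mem_nhds isUnit_one
  obtain ⟨η, hη, hη'⟩ := Metric.eventually_nhds_iff_ball.1 hunit
  refine ⟨min δ η, lt_min hδ hη, (min_le_left _ _).trans (hδε.trans (by linarith)),
    fun y => Φ (y - y₀), ?_, fun y hy => ⟨hη' y (Metric.ball_subset_ball (min_le_right _ _) hy),
      hΦ' y (Metric.ball_subset_ball (min_le_left _ _) hy)⟩⟩
  refine contDiffOn_pfaff_solution Metric.isOpen_ball (ha.mono ?_)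
    fun y hy => hΦ' y (Metric.ball_subset_ball (min_le_left _ _) hy)
  exact Metric.ball_subset_ball ((min_le_left _ _).trans (hδε.trans (by linarith)))

end Pfaff

open IsManifold

/-! ### Differentials of charts and regularity of vector fields in charts -/

section Charts

variable {φ : OpenPartialHomeomorph M (EuclideanSpace ℝ (Fin n))} {p q : M}

lemma mem_maximalAtlas_one {r : ℕ∞ω} (hφ : φ ∈ maximalAtlas (𝓡 n) (r + 1) M) :
    φ ∈ maximalAtlas (𝓡 n) 1 M :=
  maximalAtlas_subset_of_le (by simp) hφ

lemma mdifferentiable_of_mem_maximalAtlas [IsManifold (𝓡 n) 1 M]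
    (hφ : φ ∈ maximalAtlas (𝓡 n) 1 M) : φ.MDifferentiable (𝓡 n) (𝓡 n) :=
  ⟨(contMDiffOn_of_mem_maximalAtlas hφ).mdifferentiableOn one_ne_zero,
    (contMDiffOn_symm_of_mem_maximalAtlas hφ).mdifferentiableOn one_ne_zero⟩

/-- The differential of a chart, as an equivalence. -/
def differentialEquiv [IsManifold (𝓡 n) 1 M] (hφ : φ ∈ maximalAtlas (𝓡 n) 1 M)
    (hq : q ∈ φ.source) : TangentSpace (𝓡 n) q ≃L[ℝ] EuclideanSpace ℝ (Fin n) :=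
  ((mdifferentiable_of_mem_maximalAtlas hφ).mfderiv hq).trans
    (NormedSpace.fromTangentSpace (𝕜 := ℝ) (φ q))

@[simp] lemma differentialEquiv_apply [IsManifold (𝓡 n) 1 M] (hφ : φ ∈ maximalAtlas (𝓡 n) 1 M)
    (hq : q ∈ φ.source) (v : TangentSpace (𝓡 n) q) :
    differentialEquiv hφ hq v = differential φ q v := rfl

lemma differential_injective [IsManifold (𝓡 n) 1 M] (hφ : φ ∈ maximalAtlas (𝓡 n) 1 M)
    (hq : q ∈ φ.source) : Function.Injective (differential φ q) :=
  (differentialEquiv hφ hq).injective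

lemma differential_coordFrame [IsManifold (𝓡 n) 1 M] (hφ : φ ∈ maximalAtlas (𝓡 n) 1 M)
    (hq : q ∈ φ.source) (i : Fin n) :
    differential φ q (coordFrame φ i q) = EuclideanSpace.single i 1 := by
  have h : mfderiv (𝓡 n) (𝓡 n) φ q =
      (((mdifferentiable_of_mem_maximalAtlas hφ).mfderiv hq :
        TangentSpace (𝓡 n) q ≃L[ℝ] TangentSpace (𝓡 n) (φ q)) :
        TangentSpace (𝓡 n) q →L[ℝ] TangentSpace (𝓡 n) (φ q)) := rfl
  rw [coordFrame, h, ContinuousLinearMap.inverse_equiv, differential, h]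
  simp

lemma coordFrame_eq [IsManifold (𝓡 n) 1 M] (hφ : φ ∈ maximalAtlas (𝓡 n) 1 M)
    (hq : q ∈ φ.source) (i : Fin n) :
    coordFrame φ i q = (differentialEquiv hφ hq).symm (EuclideanSpace.single i 1) := by
  rw [ContinuousLinearEquiv.eq_symm_apply, differentialEquiv_apply, differential_coordFrame hφ hq]

variable {r : ℕ∞ω} [IsManifold (𝓡 n) 1 M]

lemma contMDiffOn_tangentMap_chart (hφ : φ ∈ maximalAtlas (𝓡 n) (r + 1) M) :
    ContMDiffOn (𝓡 n).tangent (𝓡 n).tangent r (tangentMapWithin (𝓡 n) (𝓡 n) φ φ.source)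
      (Bundle.TotalSpace.proj ⁻¹' φ.source) :=
  (contMDiffOn_of_mem_maximalAtlas hφ).contMDiffOn_tangentMapWithin le_rfl
    φ.open_source.uniqueMDiffOn

lemma contMDiffOn_tangentMap_chart_symm (hφ : φ ∈ maximalAtlas (𝓡 n) (r + 1) M) :
    ContMDiffOn (𝓡 n).tangent (𝓡 n).tangent r (tangentMapWithin (𝓡 n) (𝓡 n) φ.symm φ.target)
      (Bundle.TotalSpace.proj ⁻¹' φ.target) :=
  (contMDiffOn_symm_of_mem_maximalAtlas hφ).contMDiffOn_tangentMapWithin le_rfl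
    φ.open_target.uniqueMDiffOn

lemma tangentMapWithin_snd_eq_differential (hq : q ∈ φ.source) (v : TangentSpace (𝓡 n) q) :
    (tangentMapWithin (𝓡 n) (𝓡 n) φ φ.source ⟨q, v⟩).2 = differential φ q v := by
  simp only [tangentMapWithin, mfderivWithin_of_isOpen φ.open_source hq]
  rfl

lemma tangentMapWithin_symm_comp (hφ : φ ∈ maximalAtlas (𝓡 n) 1 M) (hq : q ∈ φ.source)
    (v : TangentSpace (𝓡 n) q) :
    tangentMapWithin (𝓡 n) (𝓡 n) φ.symm φ.target
      (⟨φ q, differential φ q v⟩ : TangentBundle (𝓡 n) (EuclideanSpace ℝ (Fin n))) = ⟨q, v⟩ := by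
  have hd := mdifferentiable_of_mem_maximalAtlas hφ
  have h1 := tangentMapWithin_comp_at (I := 𝓡 n) (I' := 𝓡 n) (I'' := 𝓡 n) (f := φ) (g := φ.symm)
    (s := φ.source) (u := φ.target) (⟨q, v⟩ : TangentBundle (𝓡 n) M)
    (hd.2 _ (φ.map_source hq)) (hd.1 _ hq) φ.mapsTo (φ.open_source.uniqueMDiffWithinAt hq)
  have h2 : tangentMapWithin (𝓡 n) (𝓡 n) (φ.symm ∘ φ) φ.source (⟨q, v⟩ : TangentBundle (𝓡 n) M) =
      tangentMapWithin (𝓡 n) (𝓡 n) id φ.source (⟨q, v⟩ : TangentBundle (𝓡 n) M) :=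
    tangentMapWithin_congr (fun x hx => φ.left_inv hx) (⟨q, v⟩ : TangentBundle (𝓡 n) M) hq
  rw [tangentMapWithin_id (φ.open_source.uniqueMDiffWithinAt hq)] at h2
  rw [← h2, h1]
  congr 1
  exact Bundle.TotalSpace.ext rfl (heq_of_eq (tangentMapWithin_snd_eq_differential hq v).symm)

/-- The tangent map of the chart and that of its inverse transfer the section to the tangent bundle
of the model space, which is trivial, and back. These maps lose one derivative, hence charts of
class `r + 1` for sections of class `r`. -/
lemma contMDiffWithinAt_section_iff (hφ : φ ∈ maximalAtlas (𝓡 n) (r + 1) M) (hq : q ∈ φ.source)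
    {X : (p : M) → TangentSpace (𝓡 n) p} {S : Set M} :
    ContMDiffWithinAt (𝓡 n) ((𝓡 n).prod (𝓡 n)) r
      (fun p => (⟨p, X p⟩ : TangentBundle (𝓡 n) M)) S q ↔
    ContMDiffWithinAt (𝓡 n) (𝓡 n) r (fun p => differential φ p (X p)) S q := by
  have hev : ∀ᶠ x in 𝓝[S] q, x ∈ φ.source :=
    mem_nhdsWithin_of_mem_nhds (φ.open_source.mem_nhds hq)
  constructor
  · intro h
    have h1 := (((contMDiffOn_tangentMap_chart hφ) ⟨q, X q⟩ hq).contMDiffAt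
      ((φ.open_source.preimage (FiberBundle.continuous_proj _ _)).mem_nhds hq)).comp_contMDiffWithinAt
        q h
    have h2 := ((contMDiff_snd_tangentBundle_modelSpace (EuclideanSpace ℝ (Fin n)) (𝓡 n)).contMDiffAt
      (n := r)).comp_contMDiffWithinAt q h1
    refine h2.congr_of_eventuallyEq ?_ (tangentMapWithin_snd_eq_differential hq _).symm
    filter_upwards [hev] with x hx
    exact (tangentMapWithin_snd_eq_differential hx _).symm
  · intro h
    have h1 : ContMDiffWithinAt (𝓡 n) ((𝓡 n).prod (𝓡 n)) r
        (fun p => (⟨φ p, differential φ p (X p)⟩ :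
          TangentBundle (𝓡 n) (EuclideanSpace ℝ (Fin n)))) S q := by
      apply Bundle.contMDiffWithinAt_totalSpace.2
      refine ⟨((contMDiffAt_of_mem_maximalAtlas hφ hq).of_le le_self_add).contMDiffWithinAt, ?_⟩
      convert! h with y
      simp
    have h2 := (((contMDiffOn_tangentMap_chart_symm hφ) ⟨φ q, differential φ q (X q)⟩
      (φ.map_source hq)).contMDiffAt ((φ.open_target.preimage
        (FiberBundle.continuous_proj _ _)).mem_nhds (φ.map_source hq))).comp_contMDiffWithinAt q h1
    refine h2.congr_of_eventuallyEq ?_ (tangentMapWithin_symm_comp (mem_maximalAtlas_one hφ) hq _).symm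
    filter_upwards [hev] with x hx
    exact (tangentMapWithin_symm_comp (mem_maximalAtlas_one hφ) hx _).symm

lemma mdifferentiableAt_section_iff (hr : 1 ≤ r) (hφ : φ ∈ maximalAtlas (𝓡 n) (r + 1) M)
    (hq : q ∈ φ.source) {X : (p : M) → TangentSpace (𝓡 n) p} :
    MDifferentiableAt (𝓡 n) ((𝓡 n).prod (𝓡 n))
      (fun p => (⟨p, X p⟩ : TangentBundle (𝓡 n) M)) q ↔
    MDifferentiableAt (𝓡 n) (𝓡 n) (fun p => differential φ p (X p)) q := by
  have hev : ∀ᶠ x in 𝓝 q, x ∈ φ.source := φ.open_source.mem_nhds hq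
  have hr0 : r ≠ 0 := (lt_of_lt_of_le one_pos hr).ne'
  constructor
  · intro h
    have h1 := ((((contMDiffOn_tangentMap_chart hφ) ⟨q, X q⟩ hq).contMDiffAt
      ((φ.open_source.preimage (FiberBundle.continuous_proj _ _)).mem_nhds
        hq)).mdifferentiableAt hr0).comp q h
    have h2 := (((contMDiff_snd_tangentBundle_modelSpace (EuclideanSpace ℝ (Fin n))
      (𝓡 n)).contMDiffAt (n := r)).mdifferentiableAt hr0).comp q h1
    refine h2.congr_of_eventuallyEq ?_
    filter_upwards [hev] with x hx
    exact (tangentMapWithin_snd_eq_differential hx _).symm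
  · intro h
    have h1 : MDifferentiableAt (𝓡 n) ((𝓡 n).prod (𝓡 n))
        (fun p => (⟨φ p, differential φ p (X p)⟩ :
          TangentBundle (𝓡 n) (EuclideanSpace ℝ (Fin n)))) q := by
      apply (mdifferentiableAt_totalSpace _ _).2
      refine ⟨(contMDiffAt_of_mem_maximalAtlas hφ hq).mdifferentiableAt (by simp), ?_⟩
      convert! h with y
      simp
    have h2 := ((((contMDiffOn_tangentMap_chart_symm hφ) ⟨φ q, differential φ q (X q)⟩
      (φ.map_source hq)).contMDiffAt ((φ.open_target.preimage
        (FiberBundle.continuous_proj _ _)).mem_nhds (φ.map_source hq))).mdifferentiableAt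
          hr0).comp q h1
    refine h2.congr_of_eventuallyEq ?_
    filter_upwards [hev] with x hx
    exact (tangentMapWithin_symm_comp (mem_maximalAtlas_one hφ) hx _).symm

end Charts

/-! ### Velocities in charts, and new charts from old ones -/

section Paths

lemma Path.uniqueDiffOn (γ : Path n M) : UniqueDiffOn ℝ γ.dom :=
  uniqueDiffOn_convex γ.ordConnected.convex <| by
    obtain ⟨a, ha, b, hb, hab⟩ := γ.nontrivial.exists_lt
    exact ⟨(a + b) / 2, interior_mono (γ.ordConnected.out ha hb)
      (by rw [interior_Icc]; constructor <;> linarith)⟩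

lemma Path.hasDerivWithinAt_comp (γ : Path n M) {t : ℝ} (ht : t ∈ γ.dom) {F : Type*}
    [NormedAddCommGroup F] [NormedSpace ℝ F] {f : M → F}
    (hf : MDifferentiableAt (𝓡 n) 𝓘(ℝ, F) f (γ t)) :
    HasDerivWithinAt (fun u => f (γ u)) (mvfderiv (𝓡 n) f (γ t) (γ.velocity t)) γ.dom t := by
  have h1 := ((γ.contMDiffOn t ht).mdifferentiableWithinAt one_ne_zero).hasMFDerivWithinAt
  have h2 := (hf.hasMFDerivAt.comp_hasMFDerivWithinAt t h1).hasFDerivWithinAt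
  exact hasDerivWithinAt_iff_hasFDerivWithinAt.2 (h2.congr_fderiv (by
    ext
    change _ = (1 : ℝ) • mvfderiv (𝓡 n) f (γ t) (γ.velocity t)
    rw [one_smul]
    rfl))

variable {φ : OpenPartialHomeomorph M (EuclideanSpace ℝ (Fin n))} {p q : M}
  [IsManifold (𝓡 n) 1 M]

lemma Path.hasDerivWithinAt_chart (γ : Path n M) {t : ℝ} (ht : t ∈ γ.dom)
    (hφ : φ ∈ maximalAtlas (𝓡 n) 1 M) (hq : γ t ∈ φ.source) :
    HasDerivWithinAt (fun u => φ (γ u)) (differential φ (γ t) (γ.velocity t)) γ.dom t :=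
  γ.hasDerivWithinAt_comp ht ((mdifferentiable_of_mem_maximalAtlas hφ).1.mdifferentiableAt
    (φ.open_source.mem_nhds hq))

lemma differential_congr {f g : M → EuclideanSpace ℝ (Fin n)} (h : f =ᶠ[𝓝 p] g) :
    differential f p = differential g p := by
  have := h.mfderiv_eq (I := 𝓡 n) (I' := 𝓡 n)
  ext1 v
  exact DFunLike.congr_fun this v

lemma differential_comp_chart (hφ : φ ∈ maximalAtlas (𝓡 n) 1 M) (hq : q ∈ φ.source)
    {h : EuclideanSpace ℝ (Fin n) → EuclideanSpace ℝ (Fin n)}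
    {h' : EuclideanSpace ℝ (Fin n) →L[ℝ] EuclideanSpace ℝ (Fin n)}
    (hh : HasFDerivAt h h' (φ q)) :
    differential (fun p => h (φ p)) q = h'.comp (differential φ q) := by
  have h1 := ((mdifferentiable_of_mem_maximalAtlas hφ).1.mdifferentiableAt
    (φ.open_source.mem_nhds hq)).hasMFDerivAt
  have h2 := (hh.hasMFDerivAt.comp q h1).mfderiv
  ext1 v
  exact DFunLike.congr_fun h2 v

/-- The inverse function theorem makes `h` a local homeomorphism at `φ p`. Its composition with `φ`
is a chart of the maximal atlas once the inverse is of class `C^r` everywhere on the target. -/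
lemma exists_chart_comp {r : ℕ∞ω} (hr : 1 ≤ r) [IsManifold (𝓡 n) r M]
    (hφ : φ ∈ maximalAtlas (𝓡 n) r M) (hp : p ∈ φ.source)
    {h : EuclideanSpace ℝ (Fin n) → EuclideanSpace ℝ (Fin n)}
    {O : Set (EuclideanSpace ℝ (Fin n))} (hO : IsOpen O) (hpO : φ p ∈ O)
    (hh : ContDiffOn ℝ r h O)
    {A : EuclideanSpace ℝ (Fin n) ≃L[ℝ] EuclideanSpace ℝ (Fin n)}
    (hA : HasFDerivAt h (A : EuclideanSpace ℝ (Fin n) →L[ℝ] EuclideanSpace ℝ (Fin n)) (φ p))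
    {V : Set M} (hV : IsOpen V) (hpV : p ∈ V) :
    ∃ ψ ∈ maximalAtlas (𝓡 n) r M, p ∈ ψ.source ∧ ψ.source ⊆ φ.source ∩ V ∩ φ ⁻¹' O ∧
      ∀ q ∈ ψ.source, ψ q = h (φ q) := by
  have hr0 : r ≠ 0 := (lt_of_lt_of_le one_pos hr).ne'
  have hat : ∀ y ∈ O, ContDiffAt ℝ r h y := fun y hy => hh.contDiffAt (hO.mem_nhds hy)
  set H := (hat _ hpO).toOpenPartialHomeomorph h hA hr0 with hH
  have hHc : ∀ y, H y = h y := fun _ => rfl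
  -- Restricting to the open set where `dh` stays invertible makes the inverse `C^r` at all points,
  -- and not only at the image of `φ p`.
  set O' := O ∩ fderiv ℝ h ⁻¹' range ((↑) : (EuclideanSpace ℝ (Fin n) ≃L[ℝ]
    EuclideanSpace ℝ (Fin n)) → EuclideanSpace ℝ (Fin n) →L[ℝ] EuclideanSpace ℝ (Fin n)) with hO'
  have hO'o : IsOpen O' := (hh.continuousOn_fderiv_of_isOpen hO hr).isOpen_inter_preimage hO
    ContinuousLinearEquiv.isOpen
  have hpO' : φ p ∈ O' := ⟨hpO, A, hA.fderiv.symm⟩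
  set ψ := (φ.restrOpen V hV).trans (H.restrOpen O' hO'o) with hψ
  have hsrc : ∀ q, q ∈ ψ.source ↔ (q ∈ φ.source ∧ q ∈ V) ∧ φ q ∈ H.source ∧ φ q ∈ O' := by
    intro q
    simp [hψ]
  have htgt : ∀ y, y ∈ ψ.target → (y ∈ H.target ∧ H.symm y ∈ O') ∧ H.symm y ∈ φ.target := by
    intro y hy
    simp only [hψ, mfld_simps] at hy
    tauto
  have hψc : ∀ q, ψ q = h (φ q) := fun q => rfl
  have hψs : ∀ y, ψ.symm y = φ.symm (H.symm y) := fun q => rfl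
  refine ⟨ψ, (mem_maximalAtlas_iff_contMDiffOn ψ).2 ⟨?_, ?_⟩, (hsrc p).2 ⟨⟨hp, hpV⟩,
    (hat _ hpO).mem_toOpenPartialHomeomorph_source hA hr0, hpO'⟩, fun q hq => ?_, fun q _ => hψc q⟩
  · intro q hq
    obtain ⟨⟨h1, h2⟩, h3, h4⟩ := (hsrc q).1 hq
    exact (ContMDiffAt.comp q (hat _ h4.1).contMDiffAt
      (contMDiffAt_of_mem_maximalAtlas hφ h1)).contMDiffWithinAt
  · intro y hy
    obtain ⟨⟨h1, h2, ⟨A', hA'⟩⟩, h3⟩ := htgt y hy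
    have h4 : ContDiffAt ℝ r H.symm y := by
      refine H.contDiffAt_symm h1 (f₀' := A') ?_ (hat _ h2)
      rw [hA']
      exact ((hat _ h2).differentiableAt hr0).hasFDerivAt
    exact (ContMDiffAt.comp y (contMDiffAt_symm_of_mem_maximalAtlas hφ h3)
      h4.contMDiffAt).contMDiffWithinAt
  · obtain ⟨⟨h1, h2⟩, h3, h4⟩ := (hsrc q).1 hq
    exact ⟨⟨h1, h2⟩, h4.1⟩

end Paths

/-! ### The transport and its derivation in a normal frame -/

section Transport

variable {L : LinearTransport n M} {S V : Set M} {e : Fin n → (p : M) → TangentSpace (𝓡 n) p}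
  [IsManifold (𝓡 n) 1 M] {r : ℕ∞ω}

/-- If `Λ` has constant components in a normal frame then it intertwines the transport. -/
lemma LinearTransport.IsNormalFrame.apply_tr (he : L.IsNormalFrame r e S)
    {Λ : (q : M) → TangentSpace (𝓡 n) q →L[ℝ] EuclideanSpace ℝ (Fin n)}
    {B : Fin n → EuclideanSpace ℝ (Fin n)} {γ : Path n M} (hγ : γ.LiesIn S) {s t : γ.dom}
    (hs : ∀ j, Λ (γ s) (e j (γ s)) = B j) (ht : ∀ j, Λ (γ t) (e j (γ t)) = B j)
    (v : TangentSpace (𝓡 n) (γ s)) : Λ (γ t) (L.tr γ s t v) = Λ (γ s) v := by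
  have hb := (he.frame.toBasisAt (hγ s.2)).sum_repr v
  simp only [IsLocalFrameOn.toBasisAt_coe] at hb
  rw [← hb]
  simp only [map_sum, map_smul, he.transport γ hγ s t, hs, ht]

/-- The isomorphism `Λ` of the tangent space at `γ s` turns the difference quotient defining `D^γ_s`
into the slope of `g`. -/
lemma hasDerivationAt_iff_slope {γ : Path n M} {s : γ.dom}
    {X : (t : γ.dom) → TangentSpace (𝓡 n) (γ t)} {v : TangentSpace (𝓡 n) (γ s)}
    {Λ : TangentSpace (𝓡 n) (γ s) ≃L[ℝ] EuclideanSpace ℝ (Fin n)}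
    {g : ℝ → EuclideanSpace ℝ (Fin n)}
    (hg : ∀ᶠ τ : γ.dom in 𝓝 s, Λ (L.tr γ τ s (X τ)) = g τ) (hgs : Λ (X s) = g s) :
    L.HasDerivationAt γ X s v ↔ HasDerivWithinAt g (Λ v) γ.dom s := by
  rw [hasDerivWithinAt_iff_tendsto_slope]
  have hmap : 𝓝[γ.dom \ {(s : ℝ)}] (s : ℝ) = map ((↑) : γ.dom → ℝ) (𝓝[≠] s) := by
    rw [IsInducing.subtypeVal.map_nhdsWithin_eq]
    congr 1
    ext x
    simp only [Set.mem_sdiff, mem_singleton_iff, mem_image, mem_compl_iff, Subtype.exists,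
      exists_and_right, exists_eq_right, Subtype.ext_iff]
    tauto
  rw [hmap, tendsto_map'_iff, LinearTransport.HasDerivationAt,
    Λ.toHomeomorph.isInducing.tendsto_nhds_iff]
  refine tendsto_congr' ?_
  filter_upwards [nhdsWithin_le_nhds hg] with τ hτ
  simp [slope, hτ, hgs]

/-- As `Λ` intertwines the transport, transporting `X τ` back to `γ s` does not change its
components. So the derivation is the ordinary derivative of the components. The constancy of `Λ` on
the frame is needed only near `γ s`. -/
lemma LinearTransport.IsNormalFrame.hasDerivationAt_iff (he : L.IsNormalFrame r e S)
    {Λ : (q : M) → TangentSpace (𝓡 n) q →L[ℝ] EuclideanSpace ℝ (Fin n)}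
    {B : Fin n → EuclideanSpace ℝ (Fin n)} (hV : IsOpen V)
    (hB : ∀ q ∈ S ∩ V, ∀ j, Λ q (e j q) = B j)
    {γ : Path n M} (hγ : γ.LiesIn S) {s : γ.dom} (hs : γ s ∈ V)
    {Λs : TangentSpace (𝓡 n) (γ s) ≃L[ℝ] EuclideanSpace ℝ (Fin n)}
    (hΛs : ∀ v, Λs v = Λ (γ s) v)
    {X : (t : γ.dom) → TangentSpace (𝓡 n) (γ t)} {v : TangentSpace (𝓡 n) (γ s)}
    {g : ℝ → EuclideanSpace ℝ (Fin n)}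
    (hg : ∀ τ : γ.dom, γ τ ∈ V → Λ (γ τ) (X τ) = g τ) :
    L.HasDerivationAt γ X s v ↔ HasDerivWithinAt g (Λ (γ s) v) γ.dom s := by
  rw [← hΛs]
  have hev : ∀ᶠ τ : γ.dom in 𝓝 s, γ τ ∈ V :=
    (γ.contMDiffOn.continuousOn.domRestrict.continuousAt (x := s)) (hV.mem_nhds hs)
  refine hasDerivationAt_iff_slope ?_ (by rw [hΛs, hg s hs])
  filter_upwards [hev] with τ hτ
  rw [hΛs, he.apply_tr hγ (hB _ ⟨hγ τ.2, hτ⟩) (hB _ ⟨hγ s.2, hs⟩), hg τ hτ]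

end Transport

/-! ### Paths in a submanifold and local constancy -/

section Submanifolds

variable {φ : OpenPartialHomeomorph M (EuclideanSpace ℝ (Fin n))} {p q : M} {N O : Set M}
  {r : ℕ∞ω}

/-- The path given by a curve in the target of a chart. -/
def chartPath [IsManifold (𝓡 n) 1 M] (hφ : φ ∈ maximalAtlas (𝓡 n) 1 M)
    (c : ℝ → EuclideanSpace ℝ (Fin n)) (J : Set ℝ) (hJ : J.OrdConnected) (hJ' : J.Nontrivial)
    (hc : ContDiffOn ℝ 1 c J) (hmaps : MapsTo c J φ.target) : Path n M where
  dom := J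
  ordConnected := hJ
  nontrivial := hJ'
  toFun := fun t => φ.symm (c t)
  contMDiffOn := (contMDiffOn_symm_of_mem_maximalAtlas hφ).comp hc.contMDiffOn hmaps

lemma IsSubmanifold.exists_ball (hN : IsSubmanifold n r N) (hp : p ∈ N) (hO : IsOpen O)
    (hpO : p ∈ O) :
    ∃ ψ ∈ maximalAtlas (𝓡 n) r M, p ∈ ψ.source ∧
      ∃ (W : Submodule ℝ (EuclideanSpace ℝ (Fin n))) (ε : ℝ), 0 < ε ∧
        Metric.ball (ψ p) ε ⊆ ψ.target ∧ (∀ y ∈ Metric.ball (ψ p) ε, ψ.symm y ∈ O) ∧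
        ∀ y ∈ Metric.ball (ψ p) ε, ψ.symm y ∈ N ↔ y ∈ W := by
  obtain ⟨W, hW⟩ := hN
  obtain ⟨ψ, hψ, hps, hψW⟩ := hW p hp
  have h1 : ψ.target ∩ ψ.symm ⁻¹' O ∈ 𝓝 (ψ p) :=
    (ψ.symm.isOpen_inter_preimage hO).mem_nhds ⟨ψ.map_source hps, by simpa [ψ.left_inv hps]⟩
  obtain ⟨ε, hε, hball⟩ := Metric.mem_nhds_iff.1 h1
  refine ⟨ψ, hψ, hps, W, ε, hε, fun y hy => (hball hy).1, fun y hy => (hball hy).2,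
    fun y hy => ?_⟩
  rw [hψW _ (ψ.map_target (hball hy).1), ψ.right_inv (hball hy).1]

/-- A function on a submanifold which is constant along paths is locally constant. -/
lemma IsSubmanifold.exists_eqOn_of_const_along_paths [IsManifold (𝓡 n) 1 M]
    (hN : IsSubmanifold n (r + 1) N) {X : Type*}
    {F : M → X} (hF : ∀ γ : Path n M, γ.LiesIn (N ∩ O) → ∀ s t : γ.dom, F (γ s) = F (γ t))
    (hp : p ∈ N) (hO : IsOpen O) (hpO : p ∈ O) :
    ∃ V, IsOpen V ∧ p ∈ V ∧ V ⊆ O ∧ ∀ q ∈ N ∩ V, F q = F p := by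
  obtain ⟨ψ, hψ, hps, W, ε, hε, hball, hballO, hW⟩ := hN.exists_ball hp hO hpO
  refine ⟨ψ.source ∩ ψ ⁻¹' Metric.ball (ψ p) ε, ψ.isOpen_inter_preimage Metric.isOpen_ball,
    ⟨hps, Metric.mem_ball_self hε⟩, fun q hq => ?_, fun q hq => ?_⟩
  · simpa [ψ.left_inv hq.1] using hballO _ hq.2
  · obtain ⟨hqN, hqs, hqb⟩ := hq
    -- In the flattening chart the points near `p` of the submanifold are joined to it by straight
    -- segments, which stay in the ball by convexity and in `W` by linearity.
    have hline : ∀ t ∈ Icc (0 : ℝ) 1, AffineMap.lineMap (ψ p) (ψ q) t ∈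
        Metric.ball (ψ p) ε := fun t ht =>
      (convex_ball (ψ p) ε).lineMap_mem (Metric.mem_ball_self hε) hqb ht
    have hpW : ψ p ∈ W := (hW _ (Metric.mem_ball_self hε)).1 (by rwa [ψ.left_inv hps])
    have hqW : ψ q ∈ W := (hW _ hqb).1 (by rwa [ψ.left_inv hqs])
    have hlineW : ∀ t : ℝ, AffineMap.lineMap (ψ p) (ψ q) t ∈ W := by
      intro t
      rw [AffineMap.lineMap_apply]
      exact W.add_mem (W.smul_mem _ (W.sub_mem hqW hpW)) hpW
    let γ : Path n M := chartPath (mem_maximalAtlas_one hψ) (AffineMap.lineMap (ψ p) (ψ q))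
      (Icc 0 1) ordConnected_Icc ⟨0, by simp, 1, by simp, by simp⟩
      (by
        have : (AffineMap.lineMap (ψ p) (ψ q) : ℝ → EuclideanSpace ℝ (Fin n)) =
            fun t => t • (ψ q - ψ p) + ψ p := by
          ext1 t; simp [AffineMap.lineMap_apply]
        rw [this]
        exact ContDiff.contDiffOn (by fun_prop))
      (fun t ht => hball (hline t ht))
    have h := hF γ (fun t ht => ⟨(hW _ (hline t ht)).2 (hlineW t), hballO _ (hline t ht)⟩)
      ⟨1, by simp [γ, chartPath]⟩ ⟨0, by simp [γ, chartPath]⟩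
    simpa [γ, chartPath, ψ.left_inv hps, ψ.left_inv hqs] using h

lemma IsSubmanifold.eq_of_const_along_paths [IsManifold (𝓡 n) 1 M]
    (hN : IsSubmanifold n (r + 1) N) {X : Type*}
    {F : M → X} (hF : ∀ γ : Path n M, γ.LiesIn (N ∩ O) → ∀ s t : γ.dom, F (γ s) = F (γ t))
    (hO : IsOpen O) (hconn : IsPreconnected (N ∩ O)) (hp : p ∈ N ∩ O) (hq : q ∈ N ∩ O) :
    F q = F p := by
  have := isPreconnected_iff_preconnectedSpace.1 hconn
  have hloc : IsLocallyConstant fun x : (N ∩ O : Set M) => F x := by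
    rw [IsLocallyConstant.iff_exists_open]
    intro x
    obtain ⟨V, hV, hxV, -, h⟩ := hN.exists_eqOn_of_const_along_paths hF x.2.1 hO x.2.2
    exact ⟨_, hV.preimage continuous_subtype_val, hxV, fun y hy => h _ ⟨y.2.1, hy⟩⟩
  exact hloc.apply_eq_of_preconnectedSpace ⟨q, hq⟩ ⟨p, hp⟩

end Submanifolds

/-! ### Normal charts in terms of a normal frame -/

section NormalCoordinates

variable {L : LinearTransport n M} {S V N : Set M} {e : Fin n → (p : M) → TangentSpace (𝓡 n) p}
  [IsManifold (𝓡 n) 1 M] {r : ℕ∞ω} {φ : OpenPartialHomeomorph M (EuclideanSpace ℝ (Fin n))}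
  {p q : M}

lemma isLocalFrameOn_of_differential (hφ : φ ∈ maximalAtlas (𝓡 n) (r + 1) M) (hS : S ⊆ φ.source)
    (hli : ∀ q ∈ S, LinearIndependent ℝ fun i => differential φ q (e i q))
    (hsm : ∀ i, ContMDiffOn (𝓡 n) (𝓡 n) r (fun q => differential φ q (e i q)) S) :
    IsLocalFrameOn (𝓡 n) (EuclideanSpace ℝ (Fin n)) r e S where
  linearIndependent {q} hq := LinearIndependent.of_comp (differential φ q).toLinearMap (hli q hq)
  generating {q} hq := by
    have h := LinearIndependent.of_comp (differential φ q).toLinearMap (hli q hq)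
    have : FiniteDimensional ℝ (TangentSpace (𝓡 n) q) :=
      inferInstanceAs (FiniteDimensional ℝ (EuclideanSpace ℝ (Fin n)))
    refine (h.span_eq_top_of_card_eq_finrank' ?_).ge
    rw [Fintype.card_fin]
    exact (finrank_euclideanSpace_fin (𝕜 := ℝ)).symm
  contMDiffOn i q hq := (contMDiffWithinAt_section_iff hφ (hS hq)).2 (hsm i q hq)

lemma linearIndependent_single :
    LinearIndependent ℝ fun i : Fin n => (EuclideanSpace.single i 1 : EuclideanSpace ℝ (Fin n)) := by
  have h := (EuclideanSpace.basisFun (Fin n) ℝ).toBasis.linearIndependent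
  rw [OrthonormalBasis.coe_toBasis] at h
  have h' : (fun i : Fin n => (EuclideanSpace.single i 1 : EuclideanSpace ℝ (Fin n))) =
      EuclideanSpace.basisFun (Fin n) ℝ := by
    ext1 i
    simp
  rw [h']
  exact h

lemma isLocalFrameOn_coordFrame (hφ : φ ∈ maximalAtlas (𝓡 n) (r + 1) M) (hS : S ⊆ φ.source) :
    IsLocalFrameOn (𝓡 n) (EuclideanSpace ℝ (Fin n)) r (coordFrame φ) S := by
  refine isLocalFrameOn_of_differential hφ hS (fun q hq => ?_) fun i => ?_
  · simp only [differential_coordFrame (mem_maximalAtlas_one hφ) (hS hq)]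
    exact linearIndependent_single
  · exact contMDiffOn_const.congr fun q hq =>
      differential_coordFrame (mem_maximalAtlas_one hφ) (hS hq) i

lemma isNormalFrame_coordFrame (hφ : φ ∈ maximalAtlas (𝓡 n) (r + 1) M) (hS : S ⊆ φ.source)
    (h : ∀ γ : Path n M, γ.LiesIn S → ∀ (s t : γ.dom) (v : TangentSpace (𝓡 n) (γ s)),
      differential φ (γ t) (L.tr γ s t v) = differential φ (γ s) v) :
    L.IsNormalFrame r (coordFrame φ) S where
  frame := isLocalFrameOn_coordFrame hφ hS
  transport γ hγ s t i := by
    apply differential_injective (mem_maximalAtlas_one hφ) (hS (hγ t.2))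
    rw [h γ hγ, differential_coordFrame (mem_maximalAtlas_one hφ) (hS (hγ s.2)),
      differential_coordFrame (mem_maximalAtlas_one hφ) (hS (hγ t.2))]

lemma LinearTransport.IsNormalCoord.differential_tr (h : L.IsNormalCoord r φ N) {γ : Path n M}
    (hγ : γ.LiesIn (N ∩ φ.source)) (s t : γ.dom) (v : TangentSpace (𝓡 n) (γ s)) :
    differential φ (γ t) (L.tr γ s t v) = differential φ (γ s) v :=
  h.2.apply_tr hγ (fun j => differential_coordFrame (mem_maximalAtlas_one h.1) (hγ s.2).2 j)
    (fun j => differential_coordFrame (mem_maximalAtlas_one h.1) (hγ t.2).2 j) v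

lemma LinearTransport.IsNormalFrame.isNormalCoord (he : L.IsNormalFrame r e S)
    (hφ : φ ∈ maximalAtlas (𝓡 n) (r + 1) M) (hS : N ∩ φ.source ⊆ S)
    {B : Fin n → EuclideanSpace ℝ (Fin n)}
    (hB : ∀ p ∈ N ∩ φ.source, ∀ j, differential φ p (e j p) = B j) : L.IsNormalCoord r φ N :=
  ⟨hφ, isNormalFrame_coordFrame hφ inter_subset_right fun _ hγ s t v =>
    he.apply_tr (fun _ hu => hS (hγ hu)) (hB _ (hγ s.2)) (hB _ (hγ t.2)) v⟩

/-- The transport preserves both the components in the normal chart and the vectors of the normal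
frame, so the components of the latter cannot vary along a path. -/
lemma LinearTransport.IsNormalCoord.differential_frame_eq (h : L.IsNormalCoord r φ N)
    (he : L.IsNormalFrame r e S) {γ : Path n M}
    (hγ : γ.LiesIn (N ∩ φ.source)) (hγS : γ.LiesIn S) (s t : γ.dom) (j : Fin n) :
    differential φ (γ s) (e j (γ s)) = differential φ (γ t) (e j (γ t)) := by
  rw [← h.differential_tr hγ s t, he.transport γ hγS]

lemma isNormalCoord_iff_exists_const (hN : IsSubmanifold n (r + 1) N) (he : L.IsNormalFrame r e N)
    (hφ : φ ∈ maximalAtlas (𝓡 n) (r + 1) M) (hconn : IsPreconnected (N ∩ φ.source)) :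
    L.IsNormalCoord r φ N ↔ ∃ B : Fin n → EuclideanSpace ℝ (Fin n),
      ∀ p ∈ N ∩ φ.source, ∀ j, differential φ p (e j p) = B j := by
  refine ⟨fun h => ?_, fun ⟨B, hB⟩ => he.isNormalCoord hφ inter_subset_left hB⟩
  rcases (N ∩ φ.source).eq_empty_or_nonempty with h0 | ⟨p, hp⟩
  · exact ⟨0, by simp [h0]⟩
  · refine ⟨fun j => differential φ p (e j p), fun q hq j => ?_⟩
    exact hN.eq_of_const_along_paths (F := fun q => differential φ q (e j q))
      (fun γ hγ s t => h.differential_frame_eq he hγ (fun u hu => (hγ hu).1) s t j)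
      φ.open_source hconn hp hq

lemma exists_nhds_differential_frame_eq (hN : IsSubmanifold n (r + 1) N)
    (he : L.IsNormalFrame r e N) (h : L.IsNormalCoord r φ N) (hp : p ∈ N) (hps : p ∈ φ.source) :
    ∃ V, IsOpen V ∧ p ∈ V ∧ V ⊆ φ.source ∧
      ∀ q ∈ N ∩ V, ∀ j, differential φ q (e j q) = differential φ p (e j p) := by
  obtain ⟨V, hV, hpV, hVs, hq⟩ := hN.exists_eqOn_of_const_along_paths
    (F := fun q j => differential φ q (e j q))
    (fun γ hγ s t => funext fun j =>
      h.differential_frame_eq he hγ (fun u hu => (hγ hu).1) s t j) hp φ.open_source hps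
  exact ⟨V, hV, hpV, hVs, fun q hqV j => congrFun (hq q hqV) j⟩

end NormalCoordinates

/-! ### Torsion as a commutator of mixed derivatives -/

section Torsion

variable {L : LinearTransport n M} {S V N : Set M} {e : Fin n → (p : M) → TangentSpace (𝓡 n) p}
  [IsManifold (𝓡 n) 1 M] {r : ℕ∞ω} {φ : OpenPartialHomeomorph M (EuclideanSpace ℝ (Fin n))}
  {p q : M}

lemma hasDerivWithinAt_apply_const {F G : Type*} [NormedAddCommGroup F] [NormedSpace ℝ F]
    [NormedAddCommGroup G] [NormedSpace ℝ G] {c : ℝ → F →L[ℝ] G} {c' : F →L[ℝ] G} {J : Set ℝ}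
    {s : ℝ} (hc : HasDerivWithinAt c c' J s) (v : F) :
    HasDerivWithinAt (fun σ => c σ v) (c' v) J s :=
  (hc.clm_apply (hasDerivWithinAt_const s J v)).congr_deriv (by simp)

/-- Symmetry of the second derivative, which also holds at boundary points since a product of
non-degenerate intervals lies in the closure of its interior. The common value `a` makes the two
terms of the torsion cancel. -/
lemma exists_mixed_derivative {F : Type*} [NormedAddCommGroup F] [NormedSpace ℝ F]
    {h : ℝ × ℝ → F} {J J' : Set ℝ} {s t : ℝ} (hs : s ∈ J) (ht : t ∈ J')
    (hu : UniqueDiffOn ℝ (J ×ˢ J')) (hcl : (s, t) ∈ closure (interior (J ×ˢ J')))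
    (hh : ContDiffWithinAt ℝ 2 h (J ×ˢ J') (s, t)) :
    ∃ a, HasDerivWithinAt (fun σ => fderivWithin ℝ h (J ×ˢ J') (σ, t) (0, 1)) a J s ∧
      HasDerivWithinAt (fun τ => fderivWithin ℝ h (J ×ˢ J') (s, τ) (1, 0)) a J' t := by
  have hsymm := (hh.isSymmSndFDerivWithinAt (by simp) hu hcl ⟨hs, ht⟩).eq (1, 0) (0, 1)
  have hf2 : HasFDerivWithinAt (fderivWithin ℝ h (J ×ˢ J'))
      (fderivWithin ℝ (fderivWithin ℝ h (J ×ˢ J')) (J ×ˢ J') (s, t)) (J ×ˢ J') (s, t) :=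
    ((hh.fderivWithin_right hu (m := 1) (by norm_num)
      ⟨hs, ht⟩).differentiableWithinAt one_ne_zero).hasFDerivWithinAt
  generalize fderivWithin ℝ (fderivWithin ℝ h (J ×ˢ J')) (J ×ˢ J') (s, t) = k' at *
  generalize fderivWithin ℝ h (J ×ˢ J') = k at *
  have hm : MapsTo (fun u : ℝ => (u, t)) J (J ×ˢ J') := fun u hu => ⟨hu, ht⟩
  have hm' : MapsTo (fun u : ℝ => (s, u)) J' (J ×ˢ J') := fun u hu => ⟨hs, hu⟩
  refine ⟨k' (1, 0) (0, 1), hasDerivWithinAt_apply_const (c' := k' (1, 0))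
    (hf2.comp_hasDerivWithinAt s
    ((hasDerivAt_id s).prodMk (hasDerivAt_const s t)).hasDerivWithinAt hm) (0, 1), ?_⟩
  rw [hsymm]
  exact hasDerivWithinAt_apply_const (c' := k' (0, 1)) (hf2.comp_hasDerivWithinAt t
    ((hasDerivAt_const t s).prodMk (hasDerivAt_id t)).hasDerivWithinAt hm') (1, 0)

lemma Surface.uniqueDiffOn (χ : Surface n M) : UniqueDiffOn ℝ (χ.dom₁ ×ˢ χ.dom₂) := by
  rcases χ.dom₁.eq_empty_or_nonempty with h1 | ⟨s, hs⟩
  · simp [h1, uniqueDiffOn_empty]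
  rcases χ.dom₂.eq_empty_or_nonempty with h2 | ⟨t, ht⟩
  · simp [h2, uniqueDiffOn_empty]
  exact (χ.path₁ ⟨t, ht⟩).uniqueDiffOn.prod (χ.path₂ ⟨s, hs⟩).uniqueDiffOn

lemma Surface.mem_closure_interior (χ : Surface n M) {x : ℝ × ℝ} (hx : x ∈ χ.dom₁ ×ˢ χ.dom₂) :
    x ∈ closure (interior (χ.dom₁ ×ˢ χ.dom₂)) := by
  have key : ∀ J : Set ℝ, J.OrdConnected → J.Nontrivial → J ⊆ closure (interior J) := by
    intro J hJ hJ'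
    obtain ⟨a, ha, b, hb, hab⟩ := hJ'.exists_lt
    rw [(hJ.convex (𝕜 := ℝ)).closure_interior_eq_closure_of_nonempty_interior
      ⟨(a + b) / 2, interior_mono (hJ.out ha hb)
        (by rw [interior_Icc]; constructor <;> linarith)⟩]
    exact subset_closure
  rw [interior_prod_eq, closure_prod_eq]
  exact ⟨key _ χ.ordConnected₁ χ.nontrivial₁ hx.1, key _ χ.ordConnected₂ χ.nontrivial₂ hx.2⟩

/-- In the components given by `φ` the frame is constant near the point, so both derivations are
ordinary derivatives of the partial derivatives of `φ ∘ χ`. They exist and agree because this map is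
`C^2`. Only one point of `χ` has to lie in `V`; elsewhere the normal frame carries the transport. -/
lemma LinearTransport.IsNormalFrame.hasTorsionAt_zero [IsManifold (𝓡 n) 2 M]
    (he : L.IsNormalFrame r e S)
    (hφ : φ ∈ maximalAtlas (𝓡 n) 2 M) (hV : IsOpen V) (hVs : V ⊆ φ.source)
    {B : Fin n → EuclideanSpace ℝ (Fin n)}
    (hB : ∀ q ∈ S ∩ V, ∀ j, differential φ q (e j q) = B j) {χ : Surface n M}
    (hχ : MapsTo χ.toFun (χ.dom₁ ×ˢ χ.dom₂) S) (s : χ.dom₁) (t : χ.dom₂)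
    (hst : χ.toFun (s, t) ∈ V) : L.HasTorsionAt χ s t 0 := by
  have hφ1 : φ ∈ maximalAtlas (𝓡 n) 1 M := maximalAtlas_subset_of_le one_le_two hφ
  set D := χ.dom₁ ×ˢ χ.dom₂ with hD
  set h : ℝ × ℝ → EuclideanSpace ℝ (Fin n) := fun x => φ (χ.toFun x) with hh
  have hcd : ∀ x ∈ D, χ.toFun x ∈ V → ContDiffWithinAt ℝ 2 h D x := fun x hx hxV =>
    ((contMDiffAt_of_mem_maximalAtlas hφ (hVs hxV)).comp_contMDiffWithinAt x
      (χ.contMDiffOn x hx)).contDiffWithinAt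
  have hf1 : ∀ x ∈ D, χ.toFun x ∈ V → HasFDerivWithinAt h (fderivWithin ℝ h D x) D x :=
    fun x hx hxV => ((hcd x hx hxV).differentiableWithinAt two_ne_zero).hasFDerivWithinAt
  have hx0 : ((s : ℝ), (t : ℝ)) ∈ D := ⟨s.2, t.2⟩
  obtain ⟨a, ha1, ha2⟩ := exists_mixed_derivative s.2 t.2 χ.uniqueDiffOn
    (χ.mem_closure_interior hx0) (hcd _ hx0 hst)
  have hd1 : ∀ (τ : ℝ) (hτ : τ ∈ χ.dom₂) (σ : ℝ) (_ : σ ∈ χ.dom₁),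
      HasDerivWithinAt (fun u : ℝ => (u, τ)) (1, 0) χ.dom₁ σ ∧
        MapsTo (fun u : ℝ => (u, τ)) χ.dom₁ D := fun τ hτ σ _ =>
    ⟨((hasDerivAt_id σ).prodMk (hasDerivAt_const σ τ)).hasDerivWithinAt, fun u hu => ⟨hu, hτ⟩⟩
  have hd2 : ∀ (σ : ℝ) (hσ : σ ∈ χ.dom₁) (τ : ℝ) (_ : τ ∈ χ.dom₂),
      HasDerivWithinAt (fun u : ℝ => (σ, u)) (0, 1) χ.dom₂ τ ∧
        MapsTo (fun u : ℝ => (σ, u)) χ.dom₂ D := fun σ hσ τ _ =>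
    ⟨((hasDerivAt_const τ σ).prodMk (hasDerivAt_id τ)).hasDerivWithinAt, fun u hu => ⟨hσ, hu⟩⟩
  have hv1 : ∀ (σ : χ.dom₁) (τ : χ.dom₂), χ.toFun (σ, τ) ∈ V →
      differential φ _ ((χ.path₁ τ).velocity σ) = fderivWithin ℝ h D (σ, τ) (1, 0) := by
    intro σ τ hV'
    refine ((χ.path₁ τ).uniqueDiffOn σ σ.2).eq_deriv _
      ((χ.path₁ τ).hasDerivWithinAt_chart σ.2 hφ1 (hVs hV')) ?_
    exact (hf1 (σ, τ) ⟨σ.2, τ.2⟩ hV').comp_hasDerivWithinAt (σ : ℝ) (hd1 τ τ.2 σ σ.2).1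
      (hd1 τ τ.2 σ σ.2).2
  have hv2 : ∀ (σ : χ.dom₁) (τ : χ.dom₂), χ.toFun (σ, τ) ∈ V →
      differential φ _ ((χ.path₂ σ).velocity τ) = fderivWithin ℝ h D (σ, τ) (0, 1) := by
    intro σ τ hV'
    refine ((χ.path₂ σ).uniqueDiffOn τ τ.2).eq_deriv _
      ((χ.path₂ σ).hasDerivWithinAt_chart τ.2 hφ1 (hVs hV')) ?_
    exact (hf1 (σ, τ) ⟨σ.2, τ.2⟩ hV').comp_hasDerivWithinAt (τ : ℝ) (hd2 σ σ.2 τ τ.2).1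
      (hd2 σ σ.2 τ τ.2).2
  set Λ := differentialEquiv hφ1 (hVs hst)
  have hΛ : differential φ (χ.toFun (s, t)) (Λ.symm a) = a := Λ.apply_symm_apply a
  refine ⟨Λ.symm a, Λ.symm a, ?_, ?_, (sub_self _).symm⟩
  · refine (he.hasDerivationAt_iff (Λ := fun q => differential φ q) hV hB
      (γ := χ.path₁ t) (fun u hu => hχ ⟨hu, t.2⟩) (s := s) hst
      (Λs := Λ) (fun _ => rfl) (g := fun σ => fderivWithin ℝ h D (σ, t) (0, 1))
      (fun τ hτ => hv2 τ t hτ)).2 ?_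
    rw [show differential φ ((χ.path₁ t) s) (Λ.symm a) = a from hΛ]
    exact ha1
  · refine (he.hasDerivationAt_iff (Λ := fun q => differential φ q) hV hB
      (γ := χ.path₂ s) (fun u hu => hχ ⟨s.2, hu⟩) (s := t) hst
      (Λs := Λ) (fun _ => rfl) (g := fun τ => fderivWithin ℝ h D (s, τ) (1, 0))
      (fun τ hτ => hv1 s τ hτ)).2 ?_
    rw [show differential φ ((χ.path₂ s) t) (Λ.symm a) = a from hΛ]
    exact ha2

end Torsion

/-! ### Linear maps with prescribed columns -/

section Linear

lemma exists_equiv_of_linearIndependent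
    {Λ : EuclideanSpace ℝ (Fin n) →L[ℝ] EuclideanSpace ℝ (Fin n)}
    {v : Fin n → EuclideanSpace ℝ (Fin n)} (h : LinearIndependent ℝ fun i => Λ (v i)) :
    ∃ Λs : EuclideanSpace ℝ (Fin n) ≃L[ℝ] EuclideanSpace ℝ (Fin n),
      (Λs : EuclideanSpace ℝ (Fin n) →L[ℝ] EuclideanSpace ℝ (Fin n)) = Λ := by
  have hspan := h.span_eq_top_of_card_eq_finrank' (by simp)
  have hsurj : Function.Surjective Λ.toLinearMap := by
    rw [← LinearMap.range_eq_top, eq_top_iff, ← hspan, Submodule.span_le]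
    rintro _ ⟨i, rfl⟩
    exact ⟨v i, rfl⟩
  have hinj := LinearMap.injective_iff_surjective.2 hsurj
  exact ⟨(LinearEquiv.ofBijective Λ.toLinearMap ⟨hinj, hsurj⟩).toContinuousLinearEquiv, rfl⟩

/-- The linear map with the given columns. -/
def ofColumns (v : Fin n → EuclideanSpace ℝ (Fin n)) :
    EuclideanSpace ℝ (Fin n) →L[ℝ] EuclideanSpace ℝ (Fin n) :=
  ∑ j, (EuclideanSpace.proj j : EuclideanSpace ℝ (Fin n) →L[ℝ] ℝ).smulRight (v j)

lemma ofColumns_apply (v : Fin n → EuclideanSpace ℝ (Fin n)) (x : EuclideanSpace ℝ (Fin n)) :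
    ofColumns v x = ∑ j, x j • v j := by
  simp [ofColumns, _root_.sum_apply]

@[simp] lemma ofColumns_single (v : Fin n → EuclideanSpace ℝ (Fin n)) (i : Fin n) :
    ofColumns v (EuclideanSpace.single i 1) = v i := by
  rw [ofColumns_apply, Finset.sum_eq_single i] <;> simp +contextual

lemma exists_equiv_ofColumns {v : Fin n → EuclideanSpace ℝ (Fin n)} (h : LinearIndependent ℝ v) :
    ∃ Λ : EuclideanSpace ℝ (Fin n) ≃L[ℝ] EuclideanSpace ℝ (Fin n),
      (Λ : EuclideanSpace ℝ (Fin n) →L[ℝ] EuclideanSpace ℝ (Fin n)) = ofColumns v :=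
  exists_equiv_of_linearIndependent (v := fun i => EuclideanSpace.single i 1)
    (by simpa only [ofColumns_single] using h)

lemma contDiff_ofColumns {r : ℕ∞ω} :
    ContDiff ℝ r (ofColumns : (Fin n → EuclideanSpace ℝ (Fin n)) → _) := by
  unfold ofColumns
  refine ContDiff.sum fun j _ => ?_
  exact ((ContinuousLinearMap.smulRightL ℝ (EuclideanSpace ℝ (Fin n)) (EuclideanSpace ℝ (Fin n))
    (EuclideanSpace.proj j)).contDiff).comp (contDiff_apply ℝ _ j)

end Linear

/-! ### Derivatives of functions read in a chart -/

section Charts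

variable {φ : OpenPartialHomeomorph M (EuclideanSpace ℝ (Fin n))} {p q : M}
  [IsManifold (𝓡 n) 1 M]

lemma hasFDerivAt_comp_symm (hφ : φ ∈ maximalAtlas (𝓡 n) 1 M) (hq : q ∈ φ.source) {F : Type*}
    [NormedAddCommGroup F] [NormedSpace ℝ F] {f : M → F}
    (hf : MDifferentiableAt (𝓡 n) 𝓘(ℝ, F) f q) :
    HasFDerivAt (fun y => f (φ.symm y)) ((mvfderiv (𝓡 n) f q).comp
      ((differentialEquiv hφ hq).symm : EuclideanSpace ℝ (Fin n) →L[ℝ] TangentSpace (𝓡 n) q))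
      (φ q) := by
  have hd := mdifferentiable_of_mem_maximalAtlas hφ
  have h1 := (hd.2.mdifferentiableAt (φ.open_target.mem_nhds (φ.map_source hq))).hasMFDerivAt
  have hf' : HasMFDerivAt (𝓡 n) 𝓘(ℝ, F) f (φ.symm (φ q)) (mfderiv (𝓡 n) 𝓘(ℝ, F) f q) := by
    rw [φ.left_inv hq]; exact hf.hasMFDerivAt
  have h2 := (HasMFDerivAt.comp (φ q) hf' h1).hasFDerivAt
  exact h2

end Charts

/-! ### Normal coordinates along a path by integration -/

section FundamentalTheorem

variable {φ : OpenPartialHomeomorph M (EuclideanSpace ℝ (Fin n))} {N : Set M}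
  [IsManifold (𝓡 n) 1 M] {e : Fin n → (p : M) → TangentSpace (𝓡 n) p}

/-- The velocity of `φ ∘ γ` is `∑ c u j • B j`, and the fundamental theorem of calculus applies. -/
lemma chart_eq_add_integral (hφ : φ ∈ maximalAtlas (𝓡 n) 1 M)
    {B : Fin n → EuclideanSpace ℝ (Fin n)} {γ : Path n M} (hγ : γ.LiesIn φ.source)
    (hB : ∀ u ∈ γ.dom, ∀ j, differential φ (γ u) (e j (γ u)) = B j)
    (hBi : LinearIndependent ℝ B) {c : ℝ → Fin n → ℝ}
    (hc : ∀ u ∈ γ.dom, γ.velocity u = ∑ j, c u j • e j (γ u)) {s t : ℝ} (hs : s ∈ γ.dom)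
    (ht : t ∈ γ.dom) :
    φ (γ t) = φ (γ s) + ∑ j, (∫ u in s..t, c u j) • B j := by
  have hsub : uIcc s t ⊆ γ.dom := γ.ordConnected.uIcc_subset hs ht
  have hder : ∀ u ∈ γ.dom, HasDerivWithinAt (fun u => φ (γ u)) (∑ j, c u j • B j) γ.dom u := by
    intro u hu
    have h := γ.hasDerivWithinAt_chart hu hφ (hγ hu)
    simpa only [hc u hu, map_sum, map_smul, hB u hu] using h
  have hcd : ContDiffOn ℝ 1 (fun u => φ (γ u)) γ.dom :=
    ((contMDiffOn_of_mem_maximalAtlas hφ).comp γ.contMDiffOn hγ).contDiffOn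
  have hcont : ContinuousOn (fun u => ∑ j, c u j • B j) γ.dom :=
    (hcd.continuousOn_derivWithin γ.uniqueDiffOn le_rfl).congr fun u hu =>
      ((hder u hu).derivWithin (γ.uniqueDiffOn u hu)).symm
  -- No continuity of `c` is assumed. It follows from that of the velocity of `φ ∘ γ`, because `c u
  -- j` is its coordinate in the basis `B`; this allows the integral to be split.
  let b := Module.Basis.mk hBi (hBi.span_eq_top_of_card_eq_finrank' (by simp)).ge
  have hcj : ∀ j, ContinuousOn (fun u => c u j) γ.dom := by
    intro j
    have h1 := (LinearMap.continuous_of_finiteDimensional (b.coord j)).comp_continuousOn hcont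
    refine h1.congr fun u _ => ?_
    have : (∑ j, c u j • B j) = ∑ j, c u j • b j := by simp [b]
    simp [this, Finsupp.single_apply]
  have hint : ∀ j, IntervalIntegrable (fun u => c u j • B j) MeasureTheory.volume s t := fun j =>
    (((hcj j).mono hsub).smul continuousOn_const).intervalIntegrable
  have hmain := intervalIntegral.integral_eq_sub_of_hasDeriv_right
    (hcd.continuousOn.mono hsub) (f' := fun u => ∑ j, c u j • B j) (fun x hx => ?_)
    (hcont.mono hsub).intervalIntegrable
  · rw [intervalIntegral.integral_finsetSum fun j _ => hint j] at hmain
    simp only [intervalIntegral.integral_smul_const] at hmain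
    rw [hmain]
    simp
  · have hx' : γ.dom ∈ 𝓝 x := mem_of_superset (Ioo_mem_nhds hx.1 hx.2)
      (Ioo_subset_Icc_self.trans hsub)
    exact ((hder x (mem_of_mem_nhds hx')).hasDerivAt hx').hasDerivWithinAt

end FundamentalTheorem

/-! ### What vanishing torsion says in a flattening chart -/

section TorsionFree

variable {L : LinearTransport n M} {S : Set M} {e : Fin n → (p : M) → TangentSpace (𝓡 n) p}
  [IsManifold (𝓡 n) 1 M] {r : ℕ∞ω} {ψ : OpenPartialHomeomorph M (EuclideanSpace ℝ (Fin n))}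
  {y₀ : EuclideanSpace ℝ (Fin n)} {ε : ℝ} {W : Submodule ℝ (EuclideanSpace ℝ (Fin n))}

lemma hasDerivAt_apply_line
    {A : EuclideanSpace ℝ (Fin n) → EuclideanSpace ℝ (Fin n) →L[ℝ] EuclideanSpace ℝ (Fin n)}
    {y : EuclideanSpace ℝ (Fin n)} (hA : DifferentiableAt ℝ A y) (w v : EuclideanSpace ℝ (Fin n)) :
    HasDerivAt (fun σ : ℝ => A (y + σ • w) v) (fderiv ℝ A y w v) 0 := by
  have h1 : HasDerivAt (fun σ : ℝ => y + σ • w) w 0 := by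
    simpa using ((hasDerivAt_id (0 : ℝ)).smul_const w).const_add y
  have h2 : HasFDerivAt A (fderiv ℝ A y) (y + (0 : ℝ) • w) := by
    simpa using hA.hasFDerivAt
  have h3 : HasDerivAt (fun σ : ℝ => A (y + σ • w)) (fderiv ℝ A y w) 0 :=
    h2.comp_hasDerivAt (0 : ℝ) h1
  simpa using h3.clm_apply (hasDerivAt_const (0 : ℝ) v)

/-- The surface which is an affine parallelogram in a chart. -/
def affineSurface [IsManifold (𝓡 n) 2 M] (hψ : ψ ∈ maximalAtlas (𝓡 n) 2 M)
    (y w₁ w₂ : EuclideanSpace ℝ (Fin n)) {δ : ℝ} (hδ : 0 < δ)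
    (h : ∀ σ ∈ Metric.ball (0 : ℝ) δ, ∀ τ ∈ Metric.ball (0 : ℝ) δ,
      y + σ • w₁ + τ • w₂ ∈ ψ.target) : Surface n M where
  dom₁ := Metric.ball 0 δ
  dom₂ := Metric.ball 0 δ
  ordConnected₁ := (convex_ball _ _).ordConnected
  ordConnected₂ := (convex_ball _ _).ordConnected
  nontrivial₁ := ⟨0, by simp [hδ], δ / 2, by simp [abs_of_pos, hδ], (half_pos hδ).ne⟩
  nontrivial₂ := ⟨0, by simp [hδ], δ / 2, by simp [abs_of_pos, hδ], (half_pos hδ).ne⟩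
  toFun := fun x => ψ.symm (y + x.1 • w₁ + x.2 • w₂)
  contMDiffOn := (contMDiffOn_symm_of_mem_maximalAtlas hψ).comp
    (ContDiff.contMDiff (by fun_prop)).contMDiffOn fun x hx => h _ hx.1 _ hx.2

/-- On the affine parallelogram through `y` spanned by `w₁, w₂` the partial derivatives have the
constant components `w₂` and `w₁` in `ψ`. Relative to the normal frame they become `A w₂` and `A
w₁`, so the two derivations have components `∂_{w₁}A w₂` and `∂_{w₂}A w₁`. -/
lemma fderiv_symm_of_torsionFree [IsManifold (𝓡 n) 2 M] (he : L.IsNormalFrame r e S)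
    (hT : L.TorsionFreeOn S) (hψ : ψ ∈ maximalAtlas (𝓡 n) 2 M)
    (hball : Metric.ball y₀ ε ⊆ ψ.target)
    (hW : ∀ y ∈ Metric.ball y₀ ε, y ∈ W → ψ.symm y ∈ S)
    {A : EuclideanSpace ℝ (Fin n) → EuclideanSpace ℝ (Fin n) →L[ℝ] EuclideanSpace ℝ (Fin n)}
    (hA : ∀ y ∈ Metric.ball y₀ ε, DifferentiableAt ℝ A y)
    {B : Fin n → EuclideanSpace ℝ (Fin n)} (hBi : LinearIndependent ℝ B)
    (hB : ∀ q ∈ S, q ∈ ψ.source → ψ q ∈ Metric.ball y₀ ε → ∀ j,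
      A (ψ q) (differential ψ q (e j q)) = B j)
    {y : EuclideanSpace ℝ (Fin n)} (hy : y ∈ Metric.ball y₀ ε) (hyW : y ∈ W)
    {w₁ w₂ : EuclideanSpace ℝ (Fin n)} (hw₁ : w₁ ∈ W) (hw₂ : w₂ ∈ W) :
    fderiv ℝ A y w₁ w₂ = fderiv ℝ A y w₂ w₁ := by
  have hψ1 : ψ ∈ maximalAtlas (𝓡 n) 1 M := maximalAtlas_subset_of_le one_le_two hψ
  have hO : {x : ℝ × ℝ | y + x.1 • w₁ + x.2 • w₂ ∈ Metric.ball y₀ ε} ∈ 𝓝 ((0 : ℝ), (0 : ℝ)) := by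
    refine (Metric.isOpen_ball.preimage (f := fun x : ℝ × ℝ => y + x.1 • w₁ + x.2 • w₂)
      (by fun_prop)).mem_nhds ?_
    simpa using hy
  obtain ⟨δ, hδ, hδb⟩ := Metric.mem_nhds_iff.1 hO
  have hin : ∀ σ ∈ Metric.ball (0 : ℝ) δ, ∀ τ ∈ Metric.ball (0 : ℝ) δ,
      y + σ • w₁ + τ • w₂ ∈ Metric.ball y₀ ε := by
    intro σ hσ τ hτ
    have h : (σ, τ) ∈ Metric.ball ((0 : ℝ), (0 : ℝ)) δ := by
      rw [← ball_prod_same]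
      exact Set.mk_mem_prod hσ hτ
    simpa only [Set.mem_ofPred_eq] using hδb h
  have hinW : ∀ σ τ : ℝ, y + σ • w₁ + τ • w₂ ∈ W := fun σ τ =>
    W.add_mem (W.add_mem hyW (W.smul_mem _ hw₁)) (W.smul_mem _ hw₂)
  set χ := affineSurface hψ y w₁ w₂ hδ fun σ hσ τ hτ => hball (hin σ hσ τ hτ) with hχ
  have hχS : MapsTo χ.toFun (χ.dom₁ ×ˢ χ.dom₂) S := fun x hx =>
    hW _ (hin _ hx.1 _ hx.2) (hinW _ _)
  have h0 : (0 : ℝ) ∈ Metric.ball (0 : ℝ) δ := Metric.mem_ball_self hδ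
  obtain ⟨a, b, ha, hb, hab⟩ := hT χ hχS ⟨0, h0⟩ ⟨0, h0⟩
  have hab' : a = b := (sub_eq_zero.1 hab.symm)
  have hψχ : ∀ σ ∈ Metric.ball (0 : ℝ) δ, ∀ τ ∈ Metric.ball (0 : ℝ) δ,
      ψ (χ.toFun (σ, τ)) = y + σ • w₁ + τ • w₂ := fun σ hσ τ hτ =>
    ψ.right_inv (hball (hin σ hσ τ hτ))
  have hsrc : ∀ σ ∈ Metric.ball (0 : ℝ) δ, ∀ τ ∈ Metric.ball (0 : ℝ) δ,
      χ.toFun (σ, τ) ∈ ψ.source := fun σ hσ τ hτ => ψ.map_target (hball (hin σ hσ τ hτ))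
  have hv1 : ∀ (σ : χ.dom₁) (τ : χ.dom₂), differential ψ _ ((χ.path₁ τ).velocity σ) = w₁ := by
    intro σ τ
    refine ((χ.path₁ τ).uniqueDiffOn σ σ.2).eq_deriv _
      ((χ.path₁ τ).hasDerivWithinAt_chart σ.2 hψ1 (hsrc σ σ.2 τ τ.2)) ?_
    have h : HasDerivWithinAt (fun u : ℝ => y + u • w₁ + (τ : ℝ) • w₂) w₁ χ.dom₁ σ := by
      simpa using ((((hasDerivAt_id (σ : ℝ)).smul_const w₁).const_add y).add_const
        ((τ : ℝ) • w₂)).hasDerivWithinAt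
    exact h.congr (fun u hu => hψχ u hu τ τ.2) (hψχ σ σ.2 τ τ.2)
  have hv2 : ∀ (σ : χ.dom₁) (τ : χ.dom₂), differential ψ _ ((χ.path₂ σ).velocity τ) = w₂ := by
    intro σ τ
    refine ((χ.path₂ σ).uniqueDiffOn τ τ.2).eq_deriv _
      ((χ.path₂ σ).hasDerivWithinAt_chart τ.2 hψ1 (hsrc σ σ.2 τ τ.2)) ?_
    have h : HasDerivWithinAt (fun u : ℝ => y + (σ : ℝ) • w₁ + u • w₂) w₂ χ.dom₂ τ := by
      simpa using (((hasDerivAt_id (τ : ℝ)).smul_const w₂).const_add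
        (y + (σ : ℝ) • w₁)).hasDerivWithinAt
    exact h.congr (fun u hu => hψχ σ σ.2 u hu) (hψχ σ σ.2 τ τ.2)
  set V := ψ.source ∩ ψ ⁻¹' Metric.ball y₀ ε with hV
  have hVo : IsOpen V := ψ.isOpen_inter_preimage Metric.isOpen_ball
  -- `A` is the change from chart components to components in which the frame is the constant `B`;
  -- so `A ∘ dψ` intertwines the transport.
  let Λ : (q : M) → TangentSpace (𝓡 n) q →L[ℝ] EuclideanSpace ℝ (Fin n) :=
    fun q => (A (ψ q)).comp (differential ψ q)
  have hΛB : ∀ q ∈ S ∩ V, ∀ j, Λ q (e j q) = B j := fun q hq j => hB q hq.1 hq.2.1 hq.2.2 j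
  set p := χ.toFun (0, 0) with hp
  have hψp : ψ p = y := by simpa using hψχ 0 h0 0 h0
  have hpV : p ∈ V := ⟨hsrc 0 h0 0 h0, by simpa [hψp] using hy⟩
  have hpS : p ∈ S := hχS (x := (0, 0)) ⟨h0, h0⟩
  obtain ⟨Λs, hΛs⟩ : ∃ Λs : TangentSpace (𝓡 n) p ≃L[ℝ] EuclideanSpace ℝ (Fin n),
      (Λs : TangentSpace (𝓡 n) p →L[ℝ] EuclideanSpace ℝ (Fin n)) = Λ p :=
    exists_equiv_of_linearIndependent (Λ := Λ p) (v := fun j => e j p)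
      (by
        have h : (fun i => Λ p (e i p)) = B := funext fun j => hΛB p ⟨hpS, hpV⟩ j
        exact h ▸ hBi)
  have hΛs' : ∀ v, Λs v = Λ p v := fun v => DFunLike.congr_fun hΛs v
  have hd1 := (he.hasDerivationAt_iff (Λ := Λ) hVo hΛB (γ := χ.path₁ ⟨0, h0⟩)
    (fun u hu => hχS ⟨hu, h0⟩) (s := ⟨0, h0⟩) hpV (Λs := Λs) hΛs'
    (g := fun σ => A (y + σ • w₁) w₂) (fun τ hτ => by
      have e1 := congrArg (A (ψ (χ.toFun (τ, 0)))) (hv2 τ ⟨0, h0⟩)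
      have e2 : ψ (χ.toFun (τ, 0)) = y + (τ : ℝ) • w₁ := by simpa using hψχ τ τ.2 0 h0
      exact e1.trans (by rw [e2]))).1 ha
  have hd2 := (he.hasDerivationAt_iff (Λ := Λ) hVo hΛB (γ := χ.path₂ ⟨0, h0⟩)
    (fun u hu => hχS ⟨h0, hu⟩) (s := ⟨0, h0⟩) hpV (Λs := Λs) hΛs'
    (g := fun τ => A (y + τ • w₂) w₁) (fun τ hτ => by
      have e1 := congrArg (A (ψ (χ.toFun (0, τ)))) (hv1 ⟨0, h0⟩ τ)
      have e2 : ψ (χ.toFun (0, τ)) = y + (τ : ℝ) • w₂ := by simpa using hψχ 0 h0 τ τ.2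
      exact e1.trans (by rw [e2]))).1 hb
  have hu : UniqueDiffWithinAt ℝ (Metric.ball (0 : ℝ) δ) 0 :=
    Metric.isOpen_ball.uniqueDiffWithinAt h0
  have e1 := hu.eq_deriv _ hd1 (hasDerivAt_apply_line (hA y hy) w₁ w₂).hasDerivWithinAt
  have e2 := hu.eq_deriv _ hd2 (hasDerivAt_apply_line (hA y hy) w₂ w₁).hasDerivWithinAt
  rw [← e1, ← e2, hab']
  rfl

end TorsionFree

/-! ### Construction of normal charts from vanishing torsion -/

section Existence

variable {L : LinearTransport n M} {S N V : Set M} {e : Fin n → (p : M) → TangentSpace (𝓡 n) p}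
  [IsManifold (𝓡 n) 1 M] {ψ : OpenPartialHomeomorph M (EuclideanSpace ℝ (Fin n))}
  {p : M}

lemma two_le_add (k : ℕ∞ω) : 2 ≤ k + 1 + 1 := by
  rw [add_assoc, one_add_one_eq_two]
  exact le_add_self

lemma linearIndependent_differential {r : ℕ∞ω}
    (he : IsLocalFrameOn (𝓡 n) (EuclideanSpace ℝ (Fin n)) r e S)
    (hψ : ψ ∈ maximalAtlas (𝓡 n) 1 M) {q : M} (hq : q ∈ S) (hqs : q ∈ ψ.source) :
    LinearIndependent ℝ fun j => differential ψ q (e j q) :=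
  (he.linearIndependent hq).map' (differential ψ q).toLinearMap
    (LinearMap.ker_eq_bot.2 (differential_injective hψ hqs))

lemma contDiffOn_add_one_of_hasFDerivAt {F G : Type*} [NormedAddCommGroup F] [NormedSpace ℝ F]
    [NormedAddCommGroup G] [NormedSpace ℝ G] {O : Set F} (hO : IsOpen O) {r : ℕ∞} {g : F → G}
    {g' : F → F →L[ℝ] G} (hg : ∀ y ∈ O, HasFDerivAt g (g' y) y) (hg' : ContDiffOn ℝ r g' O) :
    ContDiffOn ℝ ((r : ℕ∞ω) + 1) g O := by
  rw [contDiffOn_succ_iff_fderiv_of_isOpen hO]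
  refine ⟨fun y hy => (hg y hy).differentiableAt.differentiableWithinAt, by simp, ?_⟩
  exact hg'.congr fun y hy => (hg y hy).fderiv

lemma starProjection_mem_ball {W : Submodule ℝ (EuclideanSpace ℝ (Fin n))}
    {y₀ y : EuclideanSpace ℝ (Fin n)} {ε : ℝ} (hy₀ : y₀ ∈ W) (hy : y ∈ Metric.ball y₀ ε) :
    W.starProjection y ∈ Metric.ball y₀ ε := by
  rw [mem_ball_iff_norm] at hy ⊢
  have : W.starProjection y - y₀ = W.starProjection (y - y₀) := by
    rw [map_sub, Submodule.starProjection_eq_self_iff.2 hy₀]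
  rw [this]
  exact (W.norm_starProjection_apply_le (y - y₀)).trans_lt hy

/-- A `C^(r+1)` function with prescribed symmetric differential at the points of a subspace. -/
lemma exists_contDiffOn_hasFDerivAt_subspace {W : Submodule ℝ (EuclideanSpace ℝ (Fin n))}
    {r : ℕ∞} (hr : 1 ≤ r) {y₀ : EuclideanSpace ℝ (Fin n)} {ε : ℝ} (hε : 0 < ε)
    {A : EuclideanSpace ℝ (Fin n) → EuclideanSpace ℝ (Fin n) →L[ℝ] EuclideanSpace ℝ (Fin n)}
    (hA : ContDiffOn ℝ r A (Metric.ball y₀ ε))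
    (hAP : ∀ y, A (W.starProjection y) = A y) (hy₀ : y₀ ∈ W)
    (hsymm : ∀ y ∈ Metric.ball y₀ ε, y ∈ W → ∀ w₁ ∈ W, ∀ w₂ ∈ W,
      fderiv ℝ A y w₁ w₂ = fderiv ℝ A y w₂ w₁) :
    ∃ h : EuclideanSpace ℝ (Fin n) → EuclideanSpace ℝ (Fin n),
      ContDiffOn ℝ ((r : ℕ∞ω) + 1) h (Metric.ball y₀ (ε / 2)) ∧
      ∀ y ∈ Metric.ball y₀ (ε / 2), y ∈ W → HasFDerivAt h (A y) y := by
  set P := W.starProjection with hP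
  have hPW : ∀ y ∈ W, P y = y := fun y hy => Submodule.starProjection_eq_self_iff.2 hy
  have hPm : ∀ y, P y ∈ W := fun y => Submodule.starProjection_apply_mem W y
  have hPball : ∀ y ∈ Metric.ball y₀ ε, P y ∈ Metric.ball y₀ ε := fun _ =>
    starProjection_mem_ball hy₀
  have hr0 : (r : ℕ∞ω) ≠ 0 := by
    have : (1 : ℕ∞ω) ≤ r := by exact_mod_cast hr
    exact (lt_of_lt_of_le one_pos this).ne'
  have hAd : ∀ y ∈ Metric.ball y₀ ε, DifferentiableAt ℝ A y := fun y hy =>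
    (hA.contDiffAt (Metric.isOpen_ball.mem_nhds hy)).differentiableAt hr0
  -- `A` is constant along the fibres of `P`, so its derivative at any point of the ball is its
  -- derivative at a point of `W` in a direction of `W`. This carries the symmetry along `W` to the
  -- whole ball.
  have hAf : ∀ y ∈ Metric.ball y₀ ε, ∀ u, fderiv ℝ A y u = fderiv ℝ A (P y) (P u) := by
    intro y hy u
    have h1 : HasFDerivAt (fun z => A (P z)) ((fderiv ℝ A (P y)).comp P) y :=
      (hAd _ (hPball y hy)).hasFDerivAt.comp y P.hasFDerivAt
    have h2 : (fun z => A (P z)) = A := funext hAP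
    rw [h2] at h1
    rw [h1.fderiv]
    rfl
  let η : EuclideanSpace ℝ (Fin n) → EuclideanSpace ℝ (Fin n) →L[ℝ] EuclideanSpace ℝ (Fin n) :=
    fun y => (A y).comp P
  let K := (ContinuousLinearMap.compL ℝ (EuclideanSpace ℝ (Fin n)) (EuclideanSpace ℝ (Fin n))
    (EuclideanSpace ℝ (Fin n))).flip P
  have hηd : ∀ y ∈ Metric.ball y₀ ε, HasFDerivAt η (K.comp (fderiv ℝ A y)) y := fun y hy =>
    K.hasFDerivAt.comp y (hAd y hy).hasFDerivAt
  have hηc : ContDiffOn ℝ r η (Metric.ball y₀ ε) := K.contDiff.comp_contDiffOn hA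
  -- Poincaré lemma for the tangential part `A ∘ P`, closed on the ball.
  obtain ⟨g, hg⟩ := (convex_ball y₀ ε).exists_forall_hasFDerivAt_of_fderiv_symmetric
    Metric.isOpen_ball (fun y hy => (hηd y hy).differentiableAt.differentiableWithinAt)
    (fun y hy u v => by
      rw [(hηd y hy).fderiv]
      change fderiv ℝ A y u (P v) = fderiv ℝ A y v (P u)
      rw [hAf y hy, hAf y hy v]
      exact hsymm _ (hPball y hy) (hPm y) _ (hPm u) _ (hPm v))
  -- The transverse part `A ∘ (1 - P)` need not be closed and is prescribed only on `W`, the kernel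
  -- of `1 - P`. The averaged construction realizes it in class `C^(r+1)`.
  obtain ⟨H, hH, -, hH'⟩ := exists_contDiff_hasFDerivAt_comp hr
    (ContinuousLinearMap.id ℝ _ - P) hε hA
  have hsub : Metric.ball y₀ (ε / 2) ⊆ Metric.ball y₀ ε := Metric.ball_subset_ball (by linarith)
  refine ⟨fun y => g y + H y, ?_, fun y hy hyW => ?_⟩
  · exact ((contDiffOn_add_one_of_hasFDerivAt Metric.isOpen_ball hg hηc).mono hsub).add
      hH.contDiffOn
  · refine ((hg y (hsub hy)).add (hH' y hy (by simp [hPW y hyW]))).congr_fderiv ?_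
    ext1 v
    simp only [η, _root_.add_apply, ContinuousLinearMap.comp_apply, _root_.sub_apply,
      ContinuousLinearMap.id_apply, ← map_add, add_sub_cancel]

/-- The required chart is `h ∘ ψ` with `dh = A` on `W`, where `A` takes the `ψ`-components of the
frame to `B`. Torsion supplies the symmetry needed for `h`, and the inverse function theorem makes
the composition a chart. -/
lemma exists_chart_of_torsionFree {k : ℕ∞} [IsManifold (𝓡 n) ((k : ℕ∞ω) + 1 + 1) M]
    (hN : IsSubmanifold n ((k : ℕ∞ω) + 1 + 1) N) (hV : IsOpen V)
    (he : L.IsNormalFrame ((k : ℕ∞ω) + 1) e (N ∩ V)) (hT : L.TorsionFreeOn (N ∩ V))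
    (hp : p ∈ N ∩ V) {B : Fin n → EuclideanSpace ℝ (Fin n)} (hB : LinearIndependent ℝ B)
    (b : EuclideanSpace ℝ (Fin n)) :
    ∃ φ ∈ maximalAtlas (𝓡 n) ((k : ℕ∞ω) + 1 + 1) M, p ∈ φ.source ∧ φ.source ⊆ V ∧ φ p = b ∧
      ∀ q ∈ N ∩ φ.source, ∀ j, differential φ q (e j q) = B j := by
  have : IsManifold (𝓡 n) 2 M := IsManifold.of_le (two_le_add (k : ℕ∞ω))
  obtain ⟨ψ, hψ, hps, W, ε, hε, hball, hballV, hW⟩ := hN.exists_ball hp.1 hV hp.2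
  have hψ1 := mem_maximalAtlas_one hψ
  have hψ2 : ψ ∈ maximalAtlas (𝓡 n) 2 M := maximalAtlas_subset_of_le (two_le_add _) hψ
  set y₀ := ψ p with hy₀
  have hy₀b : y₀ ∈ Metric.ball y₀ ε := Metric.mem_ball_self hε
  have hy₀W : y₀ ∈ W := (hW _ hy₀b).1 (by rw [hy₀, ψ.left_inv hps]; exact hp.1)
  set P := W.starProjection with hP
  have hPW : ∀ y ∈ W, P y = y := fun y hy => Submodule.starProjection_eq_self_iff.2 hy
  have hPm : ∀ y, P y ∈ W := fun y => Submodule.starProjection_apply_mem W y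
  have hPball : ∀ y ∈ Metric.ball y₀ ε, P y ∈ Metric.ball y₀ ε := fun _ =>
    starProjection_mem_ball hy₀W
  have hmem : ∀ y ∈ Metric.ball y₀ ε, ψ.symm (P y) ∈ N ∩ V := fun y hy =>
    ⟨(hW _ (hPball y hy)).2 (hPm y), hballV _ (hPball y hy)⟩
  have hmems : ∀ y ∈ Metric.ball y₀ ε, ψ.symm (P y) ∈ ψ.source := fun y hy =>
    ψ.map_target (hball (hPball y hy))
  let G : M → Fin n → EuclideanSpace ℝ (Fin n) := fun q j => differential ψ q (e j q)
  -- The frame is controlled only on `N ∩ V`. Evaluating it over `P y` extends its matrix to the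
  -- ball, constantly along the fibres of `P` and with the same regularity.
  set C : EuclideanSpace ℝ (Fin n) → Fin n → EuclideanSpace ℝ (Fin n) := fun y =>
    G (ψ.symm (P y)) with hC
  have hCsm : ContDiffOn ℝ ((k : ℕ∞ω) + 1) C (Metric.ball y₀ ε) := by
    refine contDiffOn_pi.2 fun j y hy => ?_
    have h1 := (contMDiffWithinAt_section_iff hψ (hmems y hy)).1
      (he.frame.contMDiffOn j _ (hmem y hy))
    have h2 : ContMDiffWithinAt (𝓡 n) (𝓡 n) ((k : ℕ∞ω) + 1) (fun z => ψ.symm (P z))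
        (Metric.ball y₀ ε) y :=
      (((contMDiffAt_symm_of_mem_maximalAtlas hψ (hball (hPball y hy))).of_le
        le_self_add).comp y P.contDiff.contMDiff.contMDiffAt).contMDiffWithinAt
    exact (h1.comp y h2 hmem).contDiffWithinAt
  have hCli : ∀ y ∈ Metric.ball y₀ ε, LinearIndependent ℝ (C y) := fun y hy =>
    linearIndependent_differential he.frame hψ1 (hmem y hy) (hmems y hy)
  set A : EuclideanSpace ℝ (Fin n) → EuclideanSpace ℝ (Fin n) →L[ℝ] EuclideanSpace ℝ (Fin n) :=
    fun y => (ofColumns B).comp (ofColumns (C y)).inverse with hAdef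
  have hAsm : ContDiffOn ℝ ((k + 1 : ℕ∞) : ℕ∞ω) A (Metric.ball y₀ ε) := by
    intro y hy
    obtain ⟨Λ, hΛ⟩ := exists_equiv_ofColumns (hCli y hy)
    have h1 : ContDiffWithinAt ℝ ((k + 1 : ℕ∞) : ℕ∞ω) (fun y => ofColumns (C y))
        (Metric.ball y₀ ε) y :=
      contDiff_ofColumns.contDiffAt.comp_contDiffWithinAt y (by simpa using hCsm y hy)
    have h2 : ContDiffAt ℝ ((k + 1 : ℕ∞) : ℕ∞ω) ContinuousLinearMap.inverse (ofColumns (C y)) :=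
      hΛ ▸ contDiffAt_map_inverse Λ
    have h3 : ContDiffWithinAt ℝ ((k + 1 : ℕ∞) : ℕ∞ω) (fun y => (ofColumns (C y)).inverse)
      (Metric.ball y₀ ε) y :=
      ContDiffAt.comp_contDiffWithinAt (g := ContinuousLinearMap.inverse)
        (f := fun y => ofColumns (C y)) y h2 h1
    exact contDiffWithinAt_const.clm_comp h3
  have hAC : ∀ y ∈ Metric.ball y₀ ε, ∀ j, A y (C y j) = B j := by
    intro y hy j
    obtain ⟨Λ, hΛ⟩ := exists_equiv_ofColumns (hCli y hy)
    have h1 : Λ (EuclideanSpace.single j 1) = C y j := by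
      rw [← ofColumns_single (C y) j, ← hΛ]; rfl
    simp only [hAdef, ContinuousLinearMap.comp_apply]
    rw [← h1, ← hΛ, ContinuousLinearMap.inverse_equiv]
    simp
  have hAB : ∀ q ∈ N, q ∈ ψ.source → ψ q ∈ Metric.ball y₀ ε → ∀ j,
      A (ψ q) (differential ψ q (e j q)) = B j := by
    intro q hq hqs hqb j
    have h1 : ψ q ∈ W := (hW _ hqb).1 (by rwa [ψ.left_inv hqs])
    have h2 := hAC _ hqb j
    simp only [hC, hPW _ h1, ψ.left_inv hqs] at h2
    exact h2
  have hPP : ∀ y, P (P y) = P y := fun y => hPW _ (hPm y)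
  have h1k : 1 ≤ k + 1 := le_add_self
  have hAd : ∀ y ∈ Metric.ball y₀ ε, DifferentiableAt ℝ A y := fun y hy =>
    (hAsm.contDiffAt (Metric.isOpen_ball.mem_nhds hy)).differentiableAt (by simp)
  obtain ⟨h, hh, hh'⟩ := exists_contDiffOn_hasFDerivAt_subspace h1k hε hAsm
    (fun y => by simp only [hAdef, hC, ← hP, hPP]) hy₀W
    (fun y hy hyW w₁ hw₁ w₂ hw₂ => fderiv_symm_of_torsionFree he hT hψ2 hball
      (fun z hz hzW => ⟨(hW z hz).2 hzW, hballV z hz⟩) hAd hB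
      (fun q hq => hAB q hq.1) hy hyW hw₁ hw₂)
  have hy₀b' : y₀ ∈ Metric.ball y₀ (ε / 2) := Metric.mem_ball_self (by linarith)
  have hsub : Metric.ball y₀ (ε / 2) ⊆ Metric.ball y₀ ε := Metric.ball_subset_ball (by linarith)
  -- `A y₀` carries one basis to another, so it is invertible.
  obtain ⟨A₀, hA₀⟩ := exists_equiv_of_linearIndependent (Λ := A y₀) (v := C y₀)
    (by simpa only [hAC y₀ hy₀b] using hB)
  have hder : ∀ y ∈ Metric.ball y₀ (ε / 2), y ∈ W →
      HasFDerivAt (fun y => h y + (b - h y₀)) (A y) y := fun y hy hyW =>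
    (hh' y hy hyW).add_const _
  obtain ⟨φ, hφ, hpφ, hφs, hφc⟩ := exists_chart_comp (le_add_self : 1 ≤ (k : ℕ∞ω) + 1 + 1) hψ hps
    Metric.isOpen_ball hy₀b' (h := fun y => h y + (b - h y₀))
    ((by simpa using hh : ContDiffOn ℝ ((k : ℕ∞ω) + 1 + 1) h _).add contDiffOn_const)
    (A := A₀) (hA₀ ▸ hder y₀ hy₀b' hy₀W) hV hp.2
  refine ⟨φ, hφ, hpφ, fun q hq => (hφs hq).1.2, ?_, fun q hq j => ?_⟩
  · rw [hφc p hpφ]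
    simp [hy₀]
  · obtain ⟨⟨hqs, hqV⟩, hqb⟩ := hφs hq.2
    have hqW : ψ q ∈ W := (hW _ (hsub hqb)).1 (by rw [ψ.left_inv hqs]; exact hq.1)
    have h1 : differential φ q = differential (fun p => h (ψ p) + (b - h y₀)) q :=
      differential_congr (by filter_upwards [φ.open_source.mem_nhds hq.2] with x hx using hφc x hx)
    rw [h1, differential_comp_chart (h := fun y => h y + (b - h y₀)) hψ1 hqs (hder _ hqb hqW)]
    exact hAB q hq.1 hqs (hsub hqb) j

end Existence

/-! ### Normal coordinates exist exactly when the torsion vanishes -/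

section NormalCoordinatesAndTorsion

variable {L : LinearTransport n M} {S N V : Set M} {e : Fin n → (p : M) → TangentSpace (𝓡 n) p}
  [IsManifold (𝓡 n) 1 M] {φ ψ : OpenPartialHomeomorph M (EuclideanSpace ℝ (Fin n))}
  {p : M} {k : ℕ∞} [IsManifold (𝓡 n) ((k : ℕ∞ω) + 1 + 1) M]

/-- The paths of a surface in `N` may leave the domain of any one normal chart, so the transport
along them is computed in the frame `e`, available on all of `N`. The chart only shows that `e` has
constant components near the point considered. -/
lemma torsionFreeOn_of_admitsNormalCoords
    (hN : IsSubmanifold n ((k : ℕ∞ω) + 1 + 1) N) (he : L.IsNormalFrame ((k : ℕ∞ω) + 1) e N)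
    (h : L.AdmitsNormalCoords ((k : ℕ∞ω) + 1) N) : L.TorsionFreeOn N := by
  intro χ hχ s t
  have : IsManifold (𝓡 n) 2 M := IsManifold.of_le (two_le_add (k : ℕ∞ω))
  have hmem : χ.toFun (s, t) ∈ N := hχ (x := (s, t)) ⟨s.2, t.2⟩
  obtain ⟨φ, hp, hφ⟩ := h _ hmem
  obtain ⟨V, hV, hpV, hVs, hB⟩ := exists_nhds_differential_frame_eq hN he hφ hmem hp
  exact he.hasTorsionAt_zero (maximalAtlas_subset_of_le (two_le_add _) hφ.1) hV hVs hB hχ s t hpV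

lemma LinearTransport.IsNormalCoord.torsionFreeOn (h : L.IsNormalCoord ((k : ℕ∞ω) + 1) φ N) :
    L.TorsionFreeOn (N ∩ φ.source) := by
  intro χ hχ s t
  have : IsManifold (𝓡 n) 2 M := IsManifold.of_le (two_le_add (k : ℕ∞ω))
  have hmem : χ.toFun (s, t) ∈ N ∩ φ.source := hχ (x := (s, t)) ⟨s.2, t.2⟩
  exact h.2.hasTorsionAt_zero (maximalAtlas_subset_of_le (two_le_add _) h.1) φ.open_source
    subset_rfl (fun q hq j => differential_coordFrame (mem_maximalAtlas_one h.1) hq.2 j) hχ s t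
    hmem.2

lemma exists_isNormalCoord_of_torsionFree
    (hN : IsSubmanifold n ((k : ℕ∞ω) + 1 + 1) N) (hV : IsOpen V)
    (he : L.IsNormalFrame ((k : ℕ∞ω) + 1) e (N ∩ V)) (hT : L.TorsionFreeOn (N ∩ V))
    (hp : p ∈ N ∩ V) {B : Fin n → EuclideanSpace ℝ (Fin n)} (hB : LinearIndependent ℝ B)
    (b : EuclideanSpace ℝ (Fin n)) :
    ∃ φ : OpenPartialHomeomorph M (EuclideanSpace ℝ (Fin n)),
      p ∈ φ.source ∧ L.IsNormalCoord ((k : ℕ∞ω) + 1) φ N ∧ φ p = b ∧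
      ∀ q ∈ N ∩ φ.source, ∀ j, differential φ q (e j q) = B j := by
  obtain ⟨φ, hφ, hpφ, hφV, hb, hφB⟩ := exists_chart_of_torsionFree hN hV he hT hp hB b
  exact ⟨φ, hpφ, he.isNormalCoord hφ (inter_subset_inter_right N hφV) hφB, hb, hφB⟩

lemma admitsNormalCoords_iff (hN : IsSubmanifold n ((k : ℕ∞ω) + 1 + 1) N) :
    L.AdmitsNormalCoords ((k : ℕ∞ω) + 1) N ↔
      ∀ p ∈ N, ∃ V : Set M, IsOpen V ∧ p ∈ V ∧
        (∃ e, L.IsNormalFrame ((k : ℕ∞ω) + 1) e (N ∩ V)) ∧ L.TorsionFreeOn (N ∩ V) := by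
  constructor
  · intro h p hp
    obtain ⟨φ, hpφ, hφ⟩ := h p hp
    exact ⟨φ.source, φ.open_source, hpφ, ⟨_, hφ.2⟩, hφ.torsionFreeOn⟩
  · intro h p hp
    obtain ⟨V, hV, hpV, ⟨e, he⟩, hT⟩ := h p hp
    obtain ⟨φ, hpφ, hφ, -⟩ := exists_isNormalCoord_of_torsionFree hN hV he hT ⟨hp, hpV⟩
      linearIndependent_single 0
    exact ⟨φ, hpφ, hφ⟩

lemma admitsNormalCoords_iff_torsionFreeOn (hN : IsSubmanifold n ((k : ℕ∞ω) + 1 + 1) N)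
    (he : L.IsNormalFrame ((k : ℕ∞ω) + 1) e N) :
    L.AdmitsNormalCoords ((k : ℕ∞ω) + 1) N ↔ L.TorsionFreeOn N := by
  refine ⟨torsionFreeOn_of_admitsNormalCoords hN he, fun hT => ?_⟩
  rw [admitsNormalCoords_iff hN]
  exact fun p _ => ⟨univ, isOpen_univ, mem_univ p, ⟨e, by simpa using he⟩, by simpa using hT⟩

end NormalCoordinatesAndTorsion

/-! ### The freedom in the choice of normal coordinates -/

section ChangeOfCoordinates

variable {L : LinearTransport n M} {N V : Set M} [IsManifold (𝓡 n) 1 M]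
  {φ ψ : OpenPartialHomeomorph M (EuclideanSpace ℝ (Fin n))}
  {p q : M} {k : ℕ∞} [IsManifold (𝓡 n) ((k : ℕ∞ω) + 1 + 1) M]

lemma ext_differential (hφ : φ ∈ maximalAtlas (𝓡 n) 1 M) (hq : q ∈ φ.source)
    {T T' : TangentSpace (𝓡 n) q →L[ℝ] EuclideanSpace ℝ (Fin n)}
    (h : ∀ j, T (coordFrame φ j q) = T' (coordFrame φ j q)) : T = T' := by
  have h1 : T.comp ((differentialEquiv hφ hq).symm : EuclideanSpace ℝ (Fin n) →L[ℝ] _) =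
      T'.comp ((differentialEquiv hφ hq).symm : EuclideanSpace ℝ (Fin n) →L[ℝ] _) := by
    apply ContinuousLinearMap.coe_injective
    refine (EuclideanSpace.basisFun (Fin n) ℝ).toBasis.ext fun j => ?_
    simpa [coordFrame_eq hφ hq] using h j
  ext1 v
  have h2 := DFunLike.congr_fun h1 (differentialEquiv hφ hq v)
  simpa only [ContinuousLinearMap.comp_apply, ContinuousLinearEquiv.coe_coe,
    ContinuousLinearEquiv.symm_apply_apply] using h2

/-- A function whose differential vanishes on `N` is constant along paths in `N`. -/
lemma eq_of_differential_eq_zero {f : M → EuclideanSpace ℝ (Fin n)} {S : Set M}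
    (hf : ∀ q ∈ S, MDifferentiableAt (𝓡 n) (𝓡 n) f q ∧ differential f q = 0) {γ : Path n M}
    (hγ : γ.LiesIn S) {s t : ℝ} (hs : s ∈ γ.dom) (ht : t ∈ γ.dom) : f (γ s) = f (γ t) := by
  have hd : ∀ u ∈ γ.dom, HasDerivWithinAt (fun u => f (γ u)) 0 γ.dom u := fun u hu => by
    have h := γ.hasDerivWithinAt_comp hu (hf _ (hγ hu)).1
    have h0 : mvfderiv (𝓡 n) f (γ u) (γ.velocity u) = 0 :=
      DFunLike.congr_fun (hf _ (hγ hu)).2 _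
    rwa [h0] at h
  refine γ.ordConnected.convex.is_const_of_fderivWithin_eq_zero (𝕜 := ℝ)
    (fun u hu => (hd u hu).differentiableWithinAt) (fun u hu => ?_) hs ht
  ext1
  exact (hd u hu).derivWithin (γ.uniqueDiffOn u hu)

lemma differential_affine_add (hφ : φ ∈ maximalAtlas (𝓡 n) 1 M) (hq : q ∈ φ.source)
    {f : M → EuclideanSpace ℝ (Fin n)} (hf : MDifferentiableAt (𝓡 n) (𝓡 n) f q)
    (A : EuclideanSpace ℝ (Fin n) →L[ℝ] EuclideanSpace ℝ (Fin n))
    (b : EuclideanSpace ℝ (Fin n)) :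
    differential (fun x => A (φ x) + b + f x) q =
      A.comp (differential φ q) + differential f q := by
  have h1 := hasFDerivAt_comp_symm hφ hq hf
  have h2 := differential_comp_chart hφ hq ((A.hasFDerivAt.add_const b).add h1)
  have h3 : (fun x => A (φ x) + b + f x) =ᶠ[𝓝 q]
      fun x => A (φ x) + b + f (φ.symm (φ x)) := by
    filter_upwards [φ.open_source.mem_nhds hq] with x hx
    rw [φ.left_inv hx]
  rw [differential_congr h3]
  refine h2.trans ?_
  ext1 v
  simp only [ContinuousLinearMap.comp_apply, _root_.add_apply]
  congr 1
  change mvfderiv (𝓡 n) f q ((differentialEquiv hφ hq).symm (differentialEquiv hφ hq v)) = _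
  rw [ContinuousLinearEquiv.symm_apply_apply]
  rfl

/-- The coordinate frame of `φ` is normal, so near `p` its components in `ψ` are constant on `N`.
Hence `dψ = A dφ` there with one matrix `A`. The difference of `ψ` and the affine function of `φ`
then has zero differential on `N`, so it is constant along paths in `N` and vanishes on `N` near
`p`. -/
lemma exists_affine_of_isNormalCoord (hN : IsSubmanifold n ((k : ℕ∞ω) + 1 + 1) N) (hp : p ∈ N)
    (hpφ : p ∈ φ.source) (hφ : L.IsNormalCoord ((k : ℕ∞ω) + 1) φ N) (hpψ : p ∈ ψ.source)
    (hψ : L.IsNormalCoord ((k : ℕ∞ω) + 1) ψ N) :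
    ∃ (A : EuclideanSpace ℝ (Fin n) ≃L[ℝ] EuclideanSpace ℝ (Fin n))
      (b : EuclideanSpace ℝ (Fin n)) (f : M → EuclideanSpace ℝ (Fin n)) (V : Set M),
      IsOpen V ∧ p ∈ V ∧ V ⊆ φ.source ∩ ψ.source ∧
      ContMDiffOn (𝓡 n) (𝓡 n) ((k : ℕ∞ω) + 1 + 1) f V ∧
      (∀ q ∈ N ∩ V, f q = 0 ∧ differential f q = 0) ∧
      ∀ q ∈ V, ψ q = A (φ q) + b + f q := by
  have hφ1 := mem_maximalAtlas_one hφ.1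
  have hψ1 := mem_maximalAtlas_one hψ.1
  obtain ⟨V, hV, hpV, hVs, hconst⟩ := hN.exists_eqOn_of_const_along_paths
    (O := φ.source ∩ ψ.source) (F := fun q j => differential ψ q (coordFrame φ j q))
    (fun γ hγ s t => funext fun j => hψ.differential_frame_eq hφ.2
      (fun u hu => ⟨(hγ hu).1, (hγ hu).2.2⟩) (fun u hu => ⟨(hγ hu).1, (hγ hu).2.1⟩) s t j)
    hp (φ.open_source.inter ψ.open_source) ⟨hpφ, hpψ⟩
  set A := (differentialEquiv hφ1 hpφ).symm.trans (differentialEquiv hψ1 hpψ) with hA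
  have hAd : ∀ q ∈ N ∩ V, differential ψ q =
      (A : EuclideanSpace ℝ (Fin n) →L[ℝ] EuclideanSpace ℝ (Fin n)).comp (differential φ q) := by
    intro q hq
    refine ext_differential hφ1 (hVs hq.2).1 fun j => ?_
    rw [ContinuousLinearMap.comp_apply, differential_coordFrame hφ1 (hVs hq.2).1]
    refine (congrFun (hconst q hq) j).trans ?_
    rw [coordFrame_eq hφ1 hpφ]
    rfl
  -- The constant is chosen so that `f p = 0`.
  set f : M → EuclideanSpace ℝ (Fin n) := fun q =>
    (-(A : EuclideanSpace ℝ (Fin n) →L[ℝ] EuclideanSpace ℝ (Fin n))) (φ q) +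
      (A (φ p) - ψ p) + ψ q with hf
  have hψd : ∀ q ∈ V, MDifferentiableAt (𝓡 n) (𝓡 n) ψ q := fun q hq =>
    (contMDiffAt_of_mem_maximalAtlas hψ1 (hVs hq).2).mdifferentiableAt one_ne_zero
  have hfs : ContMDiffOn (𝓡 n) (𝓡 n) ((k : ℕ∞ω) + 1 + 1) f V := by
    intro q hq
    refine ContMDiffAt.contMDiffWithinAt ?_
    have h1 := contMDiffAt_of_mem_maximalAtlas hφ.1 (hVs hq).1
    have h2 := contMDiffAt_of_mem_maximalAtlas hψ.1 (hVs hq).2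
    exact ((((-(A : EuclideanSpace ℝ (Fin n) →L[ℝ] EuclideanSpace ℝ (Fin n))).contDiff.contMDiff
      _).comp q h1).add contMDiffAt_const).add h2
  have hfd : ∀ q ∈ N ∩ V, differential f q = 0 := by
    intro q hq
    rw [hf, differential_affine_add hφ1 (hVs hq.2).1 (hψd q hq.2), hAd q hq]
    ext1 v
    simp
  -- A second shrinking: first the matrix of `dψ` relative to `dφ` was made constant on `N ∩ V`, now
  -- `f` itself is.
  obtain ⟨V', hV', hpV', hVV', hf0⟩ := hN.exists_eqOn_of_const_along_paths (O := V) (F := f)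
    (fun γ hγ s t => eq_of_differential_eq_zero (fun q hq =>
      ⟨(hfs.contMDiffAt (hV.mem_nhds hq.2)).mdifferentiableAt (by simp), hfd q hq⟩) hγ s.2 t.2)
    hp hV hpV
  refine ⟨A, ψ p - A (φ p), f, V', hV', hpV', hVV'.trans hVs, hfs.mono hVV', fun q hq =>
    ⟨(hf0 q hq).trans ?_, hfd q ⟨hq.1, hVV' hq.2⟩⟩, fun q _ => ?_⟩
  all_goals
    simp only [hf, _root_.neg_apply, ContinuousLinearEquiv.coe_coe]
    abel

/-- On `N` the differential of the new function is `A` times that of `φ`. It is therefore invertible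
at `p`, and it intertwines the transport since `dφ` does. -/
lemma exists_isNormalCoord_affine (hp : p ∈ N)
    (hpφ : p ∈ φ.source) (hφ : L.IsNormalCoord ((k : ℕ∞ω) + 1) φ N)
    (A : EuclideanSpace ℝ (Fin n) ≃L[ℝ] EuclideanSpace ℝ (Fin n))
    (b : EuclideanSpace ℝ (Fin n)) {f : M → EuclideanSpace ℝ (Fin n)} (hV : IsOpen V)
    (hpV : p ∈ V) (hf : ContMDiffOn (𝓡 n) (𝓡 n) ((k : ℕ∞ω) + 1 + 1) f V)
    (hf0 : ∀ q ∈ N ∩ V, differential f q = 0) :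
    ∃ ψ : OpenPartialHomeomorph M (EuclideanSpace ℝ (Fin n)),
      p ∈ ψ.source ∧ ψ.source ⊆ φ.source ∩ V ∧ L.IsNormalCoord ((k : ℕ∞ω) + 1) ψ N ∧
      ∀ q ∈ ψ.source, ψ q = A (φ q) + b + f q := by
  have hφ1 := mem_maximalAtlas_one hφ.1
  have hfd : ∀ q ∈ V, MDifferentiableAt (𝓡 n) (𝓡 n) f q := fun q hq =>
    (hf.contMDiffAt (hV.mem_nhds hq)).mdifferentiableAt (by simp)
  have h1 := hasFDerivAt_comp_symm hφ1 hpφ (hfd p hpV)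
  have h0 : mvfderiv (𝓡 n) f p = 0 := hf0 p ⟨hp, hpV⟩
  rw [h0, ContinuousLinearMap.zero_comp] at h1
  obtain ⟨ψ, hψ, hpψ, hψs, hψc⟩ := exists_chart_comp (le_add_self : 1 ≤ (k : ℕ∞ω) + 1 + 1) hφ.1 hpφ
    (h := fun y => A y + b + f (φ.symm y)) (φ.symm.isOpen_inter_preimage hV)
    ⟨φ.map_source hpφ, by simpa [φ.left_inv hpφ] using hpV⟩
    ((A.contDiff.contDiffOn.add contDiffOn_const).add
      ((hf.comp ((contMDiffOn_symm_of_mem_maximalAtlas hφ.1).mono inter_subset_left)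
        inter_subset_right).contDiffOn)) (A := A)
    (((A.hasFDerivAt.add_const b).add h1).congr_fderiv (by simp)) hV hpV
  have hψc' : ∀ q ∈ ψ.source, ψ q = A (φ q) + b + f q := fun q hq => by
    rw [hψc q hq, φ.left_inv (hψs hq).1.1]
  refine ⟨ψ, hpψ, fun q hq => (hψs hq).1, ⟨hψ, isNormalFrame_coordFrame hψ inter_subset_right
    fun γ hγ s t v => ?_⟩, hψc'⟩
  have hd : ∀ q ∈ N ∩ ψ.source, differential ψ q =
      (A : EuclideanSpace ℝ (Fin n) →L[ℝ] EuclideanSpace ℝ (Fin n)).comp (differential φ q) := by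
    intro q hq
    have hqs := (hψs hq.2).1
    rw [differential_congr (show ψ =ᶠ[𝓝 q] fun q =>
      (A : EuclideanSpace ℝ (Fin n) →L[ℝ] EuclideanSpace ℝ (Fin n)) (φ q) + b + f q by
        filter_upwards [ψ.open_source.mem_nhds hq.2] with x hx using hψc' x hx),
      differential_affine_add hφ1 hqs.1 (hfd q hqs.2), hf0 q ⟨hq.1, hqs.2⟩, add_zero]
  rw [hd _ (hγ s.2), hd _ (hγ t.2), ContinuousLinearMap.comp_apply, ContinuousLinearMap.comp_apply,
    hφ.differential_tr (fun u hu => ⟨(hγ hu).1, (hψs (hγ hu).2).1.1⟩)]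

end ChangeOfCoordinates

/-! ### Coefficients of vector fields in a frame -/

section FrameCoefficients

variable {S V U : Set M} {e : Fin n → (p : M) → TangentSpace (𝓡 n) p}
  [IsManifold (𝓡 n) 1 M] {φ : OpenPartialHomeomorph M (EuclideanSpace ℝ (Fin n))}
  {q : M} {r m : ℕ∞ω} {X : (p : M) → TangentSpace (𝓡 n) p}

/-- The matrix of components of a frame in a chart. -/
def frameMatrix (φ : OpenPartialHomeomorph M (EuclideanSpace ℝ (Fin n)))
    (e : Fin n → (p : M) → TangentSpace (𝓡 n) p) (q : M) :
    EuclideanSpace ℝ (Fin n) →L[ℝ] EuclideanSpace ℝ (Fin n) :=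
  ofColumns fun j => differential φ q (e j q)

lemma exists_equiv_frameMatrix (he : IsLocalFrameOn (𝓡 n) (EuclideanSpace ℝ (Fin n)) r e S)
    (hφ : φ ∈ maximalAtlas (𝓡 n) 1 M) (hq : q ∈ S) (hqs : q ∈ φ.source) :
    ∃ Λ : EuclideanSpace ℝ (Fin n) ≃L[ℝ] EuclideanSpace ℝ (Fin n),
      (Λ : EuclideanSpace ℝ (Fin n) →L[ℝ] EuclideanSpace ℝ (Fin n)) = frameMatrix φ e q :=
  exists_equiv_ofColumns (linearIndependent_differential he hφ hq hqs)

/-- Cramer-type formula for the coefficients; smoothness of matrix inversion then gives their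
regularity. -/
lemma coeff_eq_inverse_frameMatrix
    (he : IsLocalFrameOn (𝓡 n) (EuclideanSpace ℝ (Fin n)) r e S)
    (hφ : φ ∈ maximalAtlas (𝓡 n) 1 M) (hq : q ∈ S) (hqs : q ∈ φ.source) (i : Fin n)
    (v : TangentSpace (𝓡 n) q) :
    he.coeff i q v = (frameMatrix φ e q).inverse (differential φ q v) i := by
  obtain ⟨Λ, hΛ⟩ := exists_equiv_frameMatrix he hφ hq hqs
  have h1 : differential φ q v = frameMatrix φ e q (WithLp.toLp 2 fun i => he.coeff i q v) := by
    have h2 := (he.toBasisAt hq).sum_repr v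
    simp only [IsLocalFrameOn.toBasisAt_coe] at h2
    rw [frameMatrix, ofColumns_apply]
    conv_lhs => rw [← h2]
    simp [IsLocalFrameOn.coeff, hq]
  rw [h1, ← hΛ, ContinuousLinearMap.inverse_equiv]
  simp

lemma contMDiffWithinAt_frameMatrix
    (he : IsLocalFrameOn (𝓡 n) (EuclideanSpace ℝ (Fin n)) r e S)
    (hφ : φ ∈ maximalAtlas (𝓡 n) (r + 1) M) (hq : q ∈ S) (hqs : q ∈ φ.source) :
    ContMDiffWithinAt (𝓡 n) 𝓘(ℝ, EuclideanSpace ℝ (Fin n) →L[ℝ] EuclideanSpace ℝ (Fin n)) r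
      (frameMatrix φ e) S q :=
  (contDiff_ofColumns.contMDiff.contMDiffAt).comp_contMDiffWithinAt q
    (contMDiffWithinAt_pi_space.2 fun j =>
      (contMDiffWithinAt_section_iff hφ hqs).1 (he.contMDiffOn j q hq))

lemma contMDiffWithinAt_inverse_frameMatrix
    (he : IsLocalFrameOn (𝓡 n) (EuclideanSpace ℝ (Fin n)) r e S)
    (hφ : φ ∈ maximalAtlas (𝓡 n) (r + 1) M) (hq : q ∈ S) (hqs : q ∈ φ.source) :
    ContMDiffWithinAt (𝓡 n) 𝓘(ℝ, EuclideanSpace ℝ (Fin n) →L[ℝ] EuclideanSpace ℝ (Fin n)) r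
      (fun x => (frameMatrix φ e x).inverse) S q := by
  obtain ⟨Λ, hΛ⟩ := exists_equiv_frameMatrix he (mem_maximalAtlas_one hφ) hq hqs
  have h : ContDiffAt ℝ r ContinuousLinearMap.inverse (frameMatrix φ e q) :=
    hΛ ▸ contDiffAt_map_inverse Λ
  exact h.contMDiffAt.comp_contMDiffWithinAt q (contMDiffWithinAt_frameMatrix he hφ hq hqs)

lemma contMDiffWithinAt_coeff (hmr : m ≤ r)
    (he : IsLocalFrameOn (𝓡 n) (EuclideanSpace ℝ (Fin n)) r e S)
    (hφ : φ ∈ maximalAtlas (𝓡 n) (r + 1) M) (hq : q ∈ S) (hqs : q ∈ φ.source)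
    (hX : ContMDiffWithinAt (𝓡 n) ((𝓡 n).prod (𝓡 n)) m
      (fun p => (⟨p, X p⟩ : TangentBundle (𝓡 n) M)) S q) (i : Fin n) :
    ContMDiffWithinAt (𝓡 n) 𝓘(ℝ, ℝ) m (fun p => he.coeff i p (X p)) S q := by
  have h1 := (contMDiffWithinAt_inverse_frameMatrix he hφ hq hqs).of_le hmr
  have h2 := (contMDiffWithinAt_section_iff
    (maximalAtlas_subset_of_le (add_le_add_left hmr 1) hφ) hqs).1 hX
  have h3 := ((EuclideanSpace.proj i : EuclideanSpace ℝ (Fin n) →L[ℝ] ℝ).contDiff (n := m)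
    ).contMDiff.contMDiffAt.comp_contMDiffWithinAt q (h1.clm_apply h2)
  refine h3.congr_of_eventuallyEq ?_ (coeff_eq_inverse_frameMatrix he
    (mem_maximalAtlas_one hφ) hq hqs i _)
  filter_upwards [self_mem_nhdsWithin, mem_nhdsWithin_of_mem_nhds (φ.open_source.mem_nhds hqs)]
    with x hx hxs using coeff_eq_inverse_frameMatrix he (mem_maximalAtlas_one hφ) hx hxs i _

variable [IsManifold (𝓡 n) 2 M]

lemma chartAt_mem_maximalAtlas_two (q : M) :
    chartAt (EuclideanSpace ℝ (Fin n)) q ∈ maximalAtlas (𝓡 n) (1 + 1) M := by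
  rw [one_add_one_eq_two]
  exact chart_mem_maximalAtlas q

lemma mdifferentiableAt_coeff (he : IsLocalFrameOn (𝓡 n) (EuclideanSpace ℝ (Fin n)) 1 e V)
    (hV : IsOpen V) (hq : q ∈ V)
    (hX : MDifferentiableAt (𝓡 n) ((𝓡 n).prod (𝓡 n))
      (fun p => (⟨p, X p⟩ : TangentBundle (𝓡 n) M)) q) (i : Fin n) :
    MDifferentiableAt (𝓡 n) 𝓘(ℝ, ℝ) (fun p => he.coeff i p (X p)) q := by
  have hφ := chartAt_mem_maximalAtlas_two (n := n) q
  have hqs := mem_chart_source (EuclideanSpace ℝ (Fin n)) q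
  have h1 := ((contMDiffWithinAt_inverse_frameMatrix he hφ hq hqs).contMDiffAt
    (hV.mem_nhds hq)).mdifferentiableAt one_ne_zero
  have h2 := (mdifferentiableAt_section_iff le_rfl hφ hqs).1 hX
  have h3 := ((EuclideanSpace.proj i : EuclideanSpace ℝ (Fin n) →L[ℝ] ℝ).differentiableAt
    ).mdifferentiableAt.comp q (h1.clm_apply h2)
  refine h3.congr_of_eventuallyEq ?_
  filter_upwards [hV.mem_nhds hq, (OpenPartialHomeomorph.open_source _).mem_nhds hqs]
    with x hx hxs using coeff_eq_inverse_frameMatrix he (mem_maximalAtlas_one hφ) hx hxs i _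

end FrameCoefficients

/-! ### Local expressions of a linear connection -/

section Connections

variable {V U : Set M} {e : Fin n → (p : M) → TangentSpace (𝓡 n) p}
  [IsManifold (𝓡 n) 1 M] {q : M} {X : (p : M) → TangentSpace (𝓡 n) p} {cov : Cov n M}

lemma mdifferentiableAt_frame {r : ℕ∞ω} (hr : r ≠ 0)
    (he : IsLocalFrameOn (𝓡 n) (EuclideanSpace ℝ (Fin n)) r e V)
    (hV : IsOpen V) (hq : q ∈ V) (i : Fin n) :
    MDifferentiableAt (𝓡 n) ((𝓡 n).prod (𝓡 n))
      (fun p => (⟨p, e i p⟩ : TangentBundle (𝓡 n) M)) q :=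
  ((he.contMDiffOn i q hq).contMDiffAt (hV.mem_nhds hq)).mdifferentiableAt hr

lemma cov_sum {ι : Type*} (hcov : IsLinearConnectionOn cov U) (hq : q ∈ U) (t : Finset ι)
    (σ : ι → (p : M) → TangentSpace (𝓡 n) p)
    (hσ : ∀ i, MDifferentiableAt (𝓡 n) ((𝓡 n).prod (𝓡 n))
      (fun p => (⟨p, σ i p⟩ : TangentBundle (𝓡 n) M)) q) :
    MDifferentiableAt (𝓡 n) ((𝓡 n).prod (𝓡 n))
      (fun p => (⟨p, (∑ i ∈ t, σ i) p⟩ : TangentBundle (𝓡 n) M)) q ∧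
    cov (∑ i ∈ t, σ i) q = ∑ i ∈ t, cov (σ i) q := by
  classical
  induction t using Finset.induction_on with
  | empty =>
    simp only [Finset.sum_empty]
    exact ⟨Bundle.mdifferentiableAt_zeroSection .., hcov.zero hq⟩
  | insert a t ha ih =>
    rw [Finset.sum_insert ha, Finset.sum_insert ha, hcov.add (hσ a) ih.1 hq, ih.2]
    exact ⟨mdifferentiableAt_add_section (hσ a) ih.1, rfl⟩

/-- A connection on an open set sees only germs of differentiable sections, so the Leibniz rule may
be applied to a local expansion. The `e i` need not form a frame. -/
lemma cov_eq_sum_of_eventuallyEq (hcov : IsLinearConnectionOn cov U) (hU : IsOpen U) (hq : q ∈ U)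
    (he : ∀ i, MDifferentiableAt (𝓡 n) ((𝓡 n).prod (𝓡 n))
      (fun p => (⟨p, e i p⟩ : TangentBundle (𝓡 n) M)) q)
    {a : Fin n → M → ℝ} (ha : ∀ i, MDifferentiableAt (𝓡 n) 𝓘(ℝ, ℝ) (a i) q)
    (hX : ∀ᶠ p in 𝓝 q, X p = ∑ i, a i p • e i p) :
    cov X q = ∑ i, (a i q • cov (e i) q + (mvfderiv (𝓡 n) (a i) q).smulRight (e i q)) := by
  have h1 : ∀ i, MDifferentiableAt (𝓡 n) ((𝓡 n).prod (𝓡 n))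
      (fun p => (⟨p, (a i • e i) p⟩ : TangentBundle (𝓡 n) M)) q := fun i =>
    (ha i).smul_section (he i)
  obtain ⟨h2, h3⟩ := cov_sum hcov hq Finset.univ (fun i => a i • e i) h1
  have hX' : ∀ᶠ p in 𝓝 q, X p = (∑ i, a i • e i) p := by
    filter_upwards [hX] with p hp
    simpa using hp
  have h4 : MDifferentiableAt (𝓡 n) ((𝓡 n).prod (𝓡 n))
      (fun p => (⟨p, X p⟩ : TangentBundle (𝓡 n) M)) q := by
    refine h2.congr_of_eventuallyEq ?_
    filter_upwards [hX'] with p hp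
    rw [hp]
  rw [hcov.congr_of_eventuallyEq h4 h2 (hU.mem_nhds hq) hX', h3]
  exact Finset.sum_congr rfl fun i _ => hcov.leibniz (he i) (ha i) hq

end Connections

/-! ### Parallel liftings, uniqueness, and autoparallels -/

section ParallelLiftings

variable {V U : Set M} {e : Fin n → (p : M) → TangentSpace (𝓡 n) p}
  [IsManifold (𝓡 n) 1 M] [IsManifold (𝓡 n) 2 M] {cov : Cov n M} {γ : Path n M} {s : γ.dom}
  {X : (t : γ.dom) → TangentSpace (𝓡 n) (γ t)} {v : TangentSpace (𝓡 n) (γ s)}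
  {L : LinearTransport n M}

/-- The covariant derivative along a path can be computed in any `C^1` frame. -/
lemma HasCovDerivAlong.exists_components (h : HasCovDerivAlong cov γ X s v)
    (hcov : IsLinearConnectionOn cov U) (hU : IsOpen U) (hsU : γ s ∈ U)
    (he : IsLocalFrameOn (𝓡 n) (EuclideanSpace ℝ (Fin n)) 1 e V) (hV : IsOpen V)
    (hsV : γ s ∈ V) :
    ∃ (f : Fin n → ℝ → ℝ) (f' : Fin n → ℝ),
      (∀ᶠ τ : γ.dom in 𝓝 s, X τ = ∑ i, f i τ • e i (γ τ)) ∧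
      (∀ i, HasDerivWithinAt (f i) (f' i) γ.dom s) ∧
      v = ∑ i, (f' i • e i (γ s) + f i s • cov (e i) (γ s) (γ.velocity s)) := by
  obtain ⟨V₀, e₀, g, g', hV₀, hsV₀, he₀, hX, hg, hv⟩ := h
  -- Transition matrix from `e₀` to `e`. By the Leibniz rule its derivative enters both the new
  -- components and `cov (e₀ j)`, and the two contributions balance.
  let a : Fin n → Fin n → M → ℝ := fun j i p => he.coeff i p (e₀ j p)
  have ha : ∀ j i, MDifferentiableAt (𝓡 n) 𝓘(ℝ, ℝ) (a j i) (γ s) := fun j i =>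
    mdifferentiableAt_coeff he hV hsV (mdifferentiableAt_frame one_ne_zero he₀ hV₀ hsV₀ j) i
  have hsum : ∀ j, ∀ p ∈ V, e₀ j p = ∑ i, a j i p • e i p := fun j p hp =>
    he.coeff_sum_eq (e₀ j) hp
  have had : ∀ j i, HasDerivWithinAt (fun τ => a j i (γ τ))
      (mvfderiv (𝓡 n) (a j i) (γ s) (γ.velocity s)) γ.dom s := fun j i =>
    γ.hasDerivWithinAt_comp s.2 (ha j i)
  have hcd : ∀ j, cov (e₀ j) (γ s) = ∑ i, (a j i (γ s) • cov (e i) (γ s) +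
      (mvfderiv (𝓡 n) (a j i) (γ s)).smulRight (e i (γ s))) := fun j =>
    cov_eq_sum_of_eventuallyEq hcov hU hsU
      (fun i => mdifferentiableAt_frame one_ne_zero he hV hsV i) (ha j)
      (by filter_upwards [hV.mem_nhds hsV] with p hp using hsum j p hp)
  have hev : ∀ᶠ τ : γ.dom in 𝓝 s, γ τ ∈ V :=
    (γ.contMDiffOn.continuousOn.domRestrict.continuousAt (x := s)) (hV.mem_nhds hsV)
  refine ⟨fun i τ => ∑ j, g j τ * a j i (γ τ), fun i => ∑ j, (g' j * a j i (γ s) + g j s *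
    mvfderiv (𝓡 n) (a j i) (γ s) (γ.velocity s)), ?_, fun i => ?_, ?_⟩
  · filter_upwards [hev, hX] with τ hτ hXτ
    rw [hXτ]
    simp only [hsum _ _ hτ, Finset.smul_sum, Finset.sum_smul, smul_smul]
    exact Finset.sum_comm
  · exact HasDerivWithinAt.fun_sum fun j _ => (hg j).mul (had j i)
  · rw [hv]
    simp only [hcd, hsum _ _ hsV, _root_.sum_apply, _root_.add_apply, _root_.smul_apply,
      ContinuousLinearMap.smulRight_apply, Finset.smul_sum, Finset.sum_smul, smul_smul, smul_add,
      add_smul, Finset.sum_add_distrib]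
    rw [Finset.sum_comm, add_assoc]
    congr 1
    rw [add_comm]
    congr 1 <;> exact Finset.sum_comm

/-- Two liftings with the same value and the same covariant derivative at a point agree to first
order there. -/
lemma HasCovDerivAlong.components_sub {Y : (t : γ.dom) → TangentSpace (𝓡 n) (γ t)}
    (hsV : γ s ∈ V) (he : IsLocalFrameOn (𝓡 n) (EuclideanSpace ℝ (Fin n)) 1 e V)
    {f g : Fin n → ℝ → ℝ} {f' g' : Fin n → ℝ} (hXY : X s = Y s)
    (hf : ∀ᶠ τ : γ.dom in 𝓝 s, X τ = ∑ i, f i τ • e i (γ τ))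
    (hg : ∀ᶠ τ : γ.dom in 𝓝 s, Y τ = ∑ i, g i τ • e i (γ τ))
    (hv : (0 : TangentSpace (𝓡 n) (γ s)) =
      ∑ i, (f' i • e i (γ s) + f i s • cov (e i) (γ s) (γ.velocity s)))
    (hv' : (0 : TangentSpace (𝓡 n) (γ s)) =
      ∑ i, (g' i • e i (γ s) + g i s • cov (e i) (γ s) (γ.velocity s))) :
    (∀ i, f i s = g i s) ∧ ∀ i, f' i = g' i := by
  have hli := Fintype.linearIndependent_iff.1 (he.linearIndependent hsV)
  have h1 : ∀ i, f i s = g i s := by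
    have h := (hf.self_of_nhds.symm.trans hXY).trans hg.self_of_nhds
    rw [← sub_eq_zero, ← Finset.sum_sub_distrib] at h
    simp only [← sub_smul] at h
    exact fun i => sub_eq_zero.1 (hli _ h i)
  refine ⟨h1, ?_⟩
  have h := hv.symm.trans hv'
  simp only [h1, Finset.sum_add_distrib, add_left_inj] at h
  rw [← sub_eq_zero, ← Finset.sum_sub_distrib] at h
  simp only [← sub_smul] at h
  exact fun i => sub_eq_zero.1 (hli _ h i)

/-- Quantitative invertibility of a matrix close to the identity: the deviation from it absorbs at
most half of `‖w‖`. -/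
lemma norm_le_two_mul_of_sum_mul {w h : Fin n → ℝ} {a : Fin n → Fin n → ℝ}
    (hw : ∀ j, h j = ∑ i, w i * a i j)
    (ha : ∀ j, ∑ i, |a i j - if i = j then 1 else 0| ≤ 1 / 2) : ‖w‖ ≤ 2 * ‖h‖ := by
  have key : ‖w‖ ≤ ‖h‖ + ‖w‖ / 2 := by
    refine (pi_norm_le_iff_of_nonneg (by positivity)).2 fun j => ?_
    have h1 : w j = h j - ∑ i, w i * (a i j - if i = j then 1 else 0) := by
      simp [hw j, mul_sub, Finset.sum_sub_distrib]
    rw [h1]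
    refine (norm_sub_le _ _).trans (add_le_add (norm_le_pi_norm h j) ?_)
    calc ‖∑ i, w i * (a i j - if i = j then 1 else 0)‖
        ≤ ∑ i, ‖w i * (a i j - if i = j then 1 else 0)‖ := norm_sum_le _ _
      _ ≤ ∑ i, ‖w‖ * |a i j - if i = j then 1 else 0| := by
          refine Finset.sum_le_sum fun i _ => ?_
          rw [norm_mul, Real.norm_eq_abs (a i j - _)]
          exact mul_le_mul_of_nonneg_right (norm_le_pi_norm w i) (abs_nonneg _)
      _ = ‖w‖ * ∑ i, |a i j - if i = j then 1 else 0| := by rw [Finset.mul_sum]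
      _ ≤ ‖w‖ * (1 / 2) := mul_le_mul_of_nonneg_left (ha j) (norm_nonneg _)
      _ = ‖w‖ / 2 := by ring
  linarith

lemma LinearTransport.tr_tr (L : LinearTransport n M) (γ : Path n M) (r s t : γ.dom)
    (v : TangentSpace (𝓡 n) (γ r)) : L.tr γ s t (L.tr γ r s v) = L.tr γ r t v :=
  LinearMap.congr_fun (L.tr_comp γ r s t) v

lemma LinearTransport.tr_self_apply (L : LinearTransport n M) (γ : Path n M) (s : γ.dom)
    (v : TangentSpace (𝓡 n) (γ s)) : L.tr γ s s v = v :=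
  LinearMap.congr_fun (L.tr_self γ s) v

/-- A parallel lifting, transported to a fixed tangent space, is locally constant to first
order. -/
lemma eventually_norm_tr_sub_le (hcov : IsLinearConnectionOn cov U) (hU : IsOpen U)
    (hL : L.IsParallelTransportOn cov U) (hγ : γ.LiesIn U)
    (hX : HasCovDerivAlong cov γ X s 0)
    (N : TangentSpace (𝓡 n) (γ s) →ₗ[ℝ] EuclideanSpace ℝ (Fin n)) :
    ∃ (h : ℝ → Fin n → ℝ) (K : ℝ), HasDerivWithinAt h 0 γ.dom s ∧ h s = 0 ∧
      ∀ᶠ τ : γ.dom in 𝓝 s, ‖N (L.tr γ τ s (X τ)) - N (X s)‖ ≤ K * ‖h τ‖ := by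
  have hφ := chartAt_mem_maximalAtlas_two (n := n) (γ s)
  set φ := chartAt (EuclideanSpace ℝ (Fin n)) (γ s)
  have hsV : γ s ∈ φ.source := mem_chart_source (EuclideanSpace ℝ (Fin n)) (γ s)
  have hV := φ.open_source
  set e := coordFrame φ
  have he : IsLocalFrameOn (𝓡 n) (EuclideanSpace ℝ (Fin n)) 1 e φ.source :=
    isLocalFrameOn_coordFrame hφ subset_rfl
  obtain ⟨f, f', hf, hfd, hf0⟩ := hX.exists_components hcov hU (hγ s.2) he hV hsV
  obtain ⟨g, g', hg, hgd, hg0⟩ := (hL γ hγ s (X s) s).exists_components hcov hU (hγ s.2) he hV hsV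
  obtain ⟨hfg, hfg'⟩ := HasCovDerivAlong.components_sub hsV he (L.tr_self_apply γ s (X s)).symm
    hf hg hf0 hg0
  -- `a i j τ` is the matrix of the transport from `s` to `τ` in the frame. It is the identity at
  -- `s` and continuous there, because transported vectors are parallel and so have differentiable
  -- components.
  choose a a' ha had ha0 using fun i =>
    (hL γ hγ s (e i (γ s)) s).exists_components hcov hU (hγ s.2) he hV hsV
  have hli : ∀ τ : γ.dom, γ τ ∈ φ.source → ∀ c : Fin n → ℝ, ∑ i, c i • e i (γ τ) = 0 →
      ∀ i, c i = 0 := fun τ hτ => Fintype.linearIndependent_iff.1 (he.linearIndependent hτ)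
  have has : ∀ i j, a i j s = if i = j then 1 else 0 := by
    intro i j
    have h1 : (∑ j, a i j s • e j (γ s)) = e i (γ s) := by
      rw [← (ha i).self_of_nhds, L.tr_self_apply]
    have h2 : ∑ j, (a i j s - if i = j then 1 else 0) • e j (γ s) = 0 := by
      simp [sub_smul, Finset.sum_sub_distrib, h1]
    exact sub_eq_zero.1 (hli s hsV _ h2 j)
  have hac : ∀ᶠ τ : γ.dom in 𝓝 s, ∀ j, ∑ i, |a i j τ - if i = j then 1 else 0| ≤ 1 / 2 := by
    refine eventually_all.2 fun j => ?_
    have h1 : ContinuousWithinAt (fun τ => ∑ i, |a i j τ - if i = j then 1 else 0|) γ.dom s :=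
      tendsto_finsetSum _ fun i _ => ((had i j).continuousWithinAt.sub tendsto_const_nhds).abs
    have h2 : Tendsto (fun τ : γ.dom => ∑ i, |a i j τ - if i = j then 1 else 0|) (𝓝 s)
        (𝓝 (∑ i, |a i j s - if i = j then 1 else 0|)) := by
      have h3 := h1
      rw [ContinuousWithinAt, ← map_nhds_subtype_val, tendsto_map'_iff] at h3
      exact h3
    simp only [has, sub_self, abs_zero, Finset.sum_const_zero] at h2
    exact (h2.eventually (gt_mem_nhds (by norm_num : (0 : ℝ) < 1 / 2))).mono fun τ h => h.le
  have hev : ∀ᶠ τ : γ.dom in 𝓝 s, γ τ ∈ φ.source :=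
    (γ.contMDiffOn.continuousOn.domRestrict.continuousAt (x := s)) (hV.mem_nhds hsV)
  -- `h` compares the components of `X` with those of the lifting obtained by transporting `X s`.
  -- Both liftings are parallel at `s` with the same value there, so they agree to first order.
  refine ⟨fun τ i => f i τ - g i τ, (∑ i, ‖N (e i (γ s))‖) * 2, ?_, ?_, ?_⟩
  · rw [hasDerivWithinAt_pi]
    intro i
    simpa [hfg' i] using (hfd i).fun_sub (hgd i)
  · ext i
    simp [hfg i]
  filter_upwards [hev, hac, hf, hg, eventually_all.2 ha] with τ hτ hτa hτf hτg hτp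
  -- Transporting `w` to `τ` gives the vector with components `h τ`; since the matrix of the
  -- transport is near the identity, `w` is bounded by `h τ`.
  set w : TangentSpace (𝓡 n) (γ s) := L.tr γ τ s (X τ) - X s with hw
  set c : Fin n → ℝ := fun i => (he.toBasisAt hsV).repr w i with hc
  have hwc : w = ∑ i, c i • e i (γ s) := by
    have h2 := (he.toBasisAt hsV).sum_repr w
    simp only [IsLocalFrameOn.toBasisAt_coe] at h2
    exact h2.symm
  have hLw : L.tr γ s τ w = ∑ j, (f j τ - g j τ) • e j (γ τ) := by
    rw [hw, map_sub, L.tr_tr, L.tr_self_apply, hτf, hτg, ← Finset.sum_sub_distrib]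
    simp only [sub_smul]
  have hLw' : L.tr γ s τ w = ∑ j, (∑ i, c i * a i j τ) • e j (γ τ) := by
    rw [hwc, map_sum]
    simp only [map_smul, hτp, Finset.smul_sum, smul_smul, Finset.sum_smul]
    exact Finset.sum_comm
  have hcomp : ∀ j, f j τ - g j τ = ∑ i, c i * a i j τ := by
    have h := hLw.symm.trans hLw'
    rw [← sub_eq_zero, ← Finset.sum_sub_distrib] at h
    simp only [← sub_smul] at h
    exact fun j => sub_eq_zero.1 (hli τ hτ _ h j)
  have hbound := norm_le_two_mul_of_sum_mul (h := fun j => f j τ - g j τ) hcomp hτa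
  rw [← map_sub, ← hw, hwc, map_sum]
  calc ‖∑ i, N (c i • e i (γ s))‖ ≤ ∑ i, ‖N (c i • e i (γ s))‖ := norm_sum_le _ _
    _ ≤ ∑ i, ‖N (e i (γ s))‖ * ‖c‖ := by
        refine Finset.sum_le_sum fun i _ => ?_
        rw [map_smul, norm_smul, mul_comm]
        exact mul_le_mul_of_nonneg_left (norm_le_pi_norm c i) (norm_nonneg _)
    _ = (∑ i, ‖N (e i (γ s))‖) * ‖c‖ := by rw [Finset.sum_mul]
    _ ≤ (∑ i, ‖N (e i (γ s))‖) * (2 * ‖fun j => f j τ - g j τ‖) :=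
        mul_le_mul_of_nonneg_left hbound (Finset.sum_nonneg fun _ _ => norm_nonneg _)
    _ = _ := by ring

/-- A parallel lifting is transported by the parallel transport. -/
lemma tr_eq_of_parallel (hcov : IsLinearConnectionOn cov U) (hU : IsOpen U)
    (hL : L.IsParallelTransportOn cov U) (hγ : γ.LiesIn U)
    (hX : ∀ s, HasCovDerivAlong cov γ X s 0) (s t : γ.dom) : L.tr γ s t (X s) = X t := by
  classical
  let N : TangentSpace (𝓡 n) (γ t) →ₗ[ℝ] EuclideanSpace ℝ (Fin n) := LinearMap.id
  -- The lifting carried to the fixed tangent space at `γ t`. Its derivative vanishes at every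
  -- parameter by first-order comparison, so it is constant. The connection need not even be
  -- continuous, so no uniqueness theorem for differential equations is invoked.
  let C : ℝ → EuclideanSpace ℝ (Fin n) := fun τ =>
    if h : τ ∈ γ.dom then N (L.tr γ ⟨τ, h⟩ t (X ⟨τ, h⟩)) else 0
  have hC : ∀ τ : γ.dom, C τ = N (L.tr γ τ t (X τ)) := fun τ => by simp [C]
  have hd : ∀ u ∈ γ.dom, HasDerivWithinAt C 0 γ.dom u := by
    intro u hu
    obtain ⟨h, K, hh, hh0, hK⟩ := eventually_norm_tr_sub_le hcov hU hL hγ (hX ⟨u, hu⟩)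
      (N ∘ₗ L.tr γ ⟨u, hu⟩ t)
    have hO : (fun τ => C τ - C u) =O[𝓝[γ.dom] u] h := by
      refine Asymptotics.IsBigO.of_bound K ?_
      rw [← map_nhds_subtype_val ⟨u, hu⟩, eventually_map]
      filter_upwards [hK] with τ hτ
      rw [hC, hC ⟨u, hu⟩]
      simpa only [LinearMap.comp_apply, L.tr_tr] using hτ
    have ho : h =o[𝓝[γ.dom] u] fun τ => τ - u := by
      simpa [hh0] using hasDerivWithinAt_iff_isLittleO.1 hh
    rw [hasDerivWithinAt_iff_isLittleO]
    simpa using hO.trans_isLittleO ho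
  have h := γ.ordConnected.convex.is_const_of_fderivWithin_eq_zero (𝕜 := ℝ) (f := C)
    (fun u hu => (hd u hu).differentiableWithinAt) (fun u hu => by
      ext1
      exact (hd u hu).derivWithin (γ.uniqueDiffOn u hu)) s.2 t.2
  rw [hC, hC, L.tr_self_apply] at h
  exact h

/-- For an autoparallel the velocity is itself a transported vector, hence parallel. For a geodesic
it is a parallel lifting, and `tr_eq_of_parallel` says that the transport moves it. -/
lemma isAutoparallel_iff_isGeodesic (hcov : IsLinearConnectionOn cov U) (hU : IsOpen U)
    (hL : L.IsParallelTransportOn cov U) (hγ : γ.LiesIn U) :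
    L.IsAutoparallel γ ↔ IsGeodesic cov γ := by
  refine ⟨fun h s => ?_, fun h s t => tr_eq_of_parallel hcov hU hL hγ h s t⟩
  have h1 := hL γ hγ s (γ.velocity s) s
  rwa [show (fun τ : γ.dom => L.tr γ s τ (γ.velocity s)) = fun τ : γ.dom => γ.velocity τ from
    funext fun τ => h s τ] at h1

end ParallelLiftings

/-! ### The connection that makes a frame parallel -/

section FrameConnection

variable {V U : Set M} {e : Fin n → (p : M) → TangentSpace (𝓡 n) p}
  [IsManifold (𝓡 n) 1 M] {q : M} {r m k : ℕ∞ω} {X Y Z : (p : M) → TangentSpace (𝓡 n) p}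
  {φ : OpenPartialHomeomorph M (EuclideanSpace ℝ (Fin n))}

lemma isLocalFrameOn_of_le (he : IsLocalFrameOn (𝓡 n) (EuclideanSpace ℝ (Fin n)) r e V)
    (h : m ≤ r) : IsLocalFrameOn (𝓡 n) (EuclideanSpace ℝ (Fin n)) m e V :=
  ⟨he.linearIndependent, he.generating, fun i => (he.contMDiffOn i).of_le h⟩

lemma mvfderiv_congr {F : Type*} [NormedAddCommGroup F] [NormedSpace ℝ F] {f g : M → F}
    (h : f =ᶠ[𝓝 q] g) : mvfderiv (𝓡 n) f q = mvfderiv (𝓡 n) g q := by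
  ext v
  simp only [mvfderiv]
  exact congrArg (fun A : TangentSpace (𝓡 n) q →L[ℝ] F => A v) h.mfderiv_eq

/-- The connection for which a given frame is parallel. -/
def frameCov (he : IsLocalFrameOn (𝓡 n) (EuclideanSpace ℝ (Fin n)) r e V) : Cov n M := fun Z p =>
  ∑ i, (mvfderiv (𝓡 n) (fun q => he.coeff i q (Z q)) p).smulRight (e i p)

lemma coeff_sum (he : IsLocalFrameOn (𝓡 n) (EuclideanSpace ℝ (Fin n)) r e V) (hq : q ∈ V)
    (a : Fin n → ℝ) (i : Fin n) : he.coeff i q (∑ j, a j • e j q) = a i := by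
  have h1 : ∀ j, he.coeff i q (e j q) = if j = i then 1 else 0 := by
    intro j
    simp only [IsLocalFrameOn.coeff, hq, dite_true, Module.Basis.coord_apply]
    rw [← he.toBasisAt_coe hq j, Module.Basis.repr_self, Finsupp.single_apply]
  simp [map_sum, h1]

lemma coeff_frameCov (he : IsLocalFrameOn (𝓡 n) (EuclideanSpace ℝ (Fin n)) r e V) (hq : q ∈ V)
    (v : TangentSpace (𝓡 n) q) (i : Fin n) :
    he.coeff i q (frameCov he Z q v) = mvfderiv (𝓡 n) (fun p => he.coeff i p (Z p)) q v := by
  simp only [frameCov, _root_.sum_apply, ContinuousLinearMap.smulRight_apply]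
  exact coeff_sum he hq _ i

lemma frameCov_frame (he : IsLocalFrameOn (𝓡 n) (EuclideanSpace ℝ (Fin n)) r e V)
    (hV : IsOpen V) (hq : q ∈ V) (j : Fin n) : frameCov he (e j) q = 0 := by
  have h1 : ∀ i, mvfderiv (𝓡 n) (fun p => he.coeff i p (e j p)) q = 0 := by
    intro i
    have h2 : (fun p => he.coeff i p (e j p)) =ᶠ[𝓝 q] fun _ => if i = j then (1 : ℝ) else 0 := by
      filter_upwards [hV.mem_nhds hq] with p hp
      have h3 := coeff_sum he hp (Pi.single j 1) i
      simpa [Pi.single_apply, ite_smul] using h3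
    rw [mvfderiv_congr h2]
    exact mvfderiv_const (I := 𝓡 n) _
  simp [frameCov, h1]

variable [IsManifold (𝓡 n) 2 M]

lemma isLinearConnectionOn_frameCov (he : IsLocalFrameOn (𝓡 n) (EuclideanSpace ℝ (Fin n)) 1 e V)
    (hV : IsOpen V) : IsLinearConnectionOn (frameCov he) V where
  add {σ σ' x} hσ hσ' hx := by
    have h1 : ∀ i, mvfderiv (𝓡 n) (fun q => he.coeff i q ((σ + σ') q)) x =
        mvfderiv (𝓡 n) (fun q => he.coeff i q (σ q)) x +
        mvfderiv (𝓡 n) (fun q => he.coeff i q (σ' q)) x := by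
      intro i
      rw [← mvfderiv_fun_add (mdifferentiableAt_coeff he hV hx hσ i)
        (mdifferentiableAt_coeff he hV hx hσ' i)]
      simp only [Pi.add_apply, map_add]
    ext v
    simp only [frameCov, h1, _root_.sum_apply, _root_.add_apply,
      ContinuousLinearMap.smulRight_apply, add_smul, Finset.sum_add_distrib]
  leibniz {σ g x} hσ hg hx := by
    have h1 : ∀ i, mvfderiv (𝓡 n) (fun q => he.coeff i q ((g • σ) q)) x =
        g x • mvfderiv (𝓡 n) (fun q => he.coeff i q (σ q)) x +
        he.coeff i x (σ x) • mvfderiv (𝓡 n) g x := by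
      intro i
      rw [← mvfderiv_fun_mul hg (mdifferentiableAt_coeff he hV hx hσ i)]
      simp only [Pi.smul_apply', map_smul, smul_eq_mul]
    ext v
    have h2 := he.coeff_sum_eq σ hx
    simp only [frameCov, h1, _root_.sum_apply, _root_.add_apply, _root_.smul_apply,
      ContinuousLinearMap.smulRight_apply, add_smul, Finset.sum_add_distrib, Finset.smul_sum,
      smul_smul, smul_eq_mul]
    congr 1
    conv_rhs => rw [h2, Finset.smul_sum]
    simp only [smul_smul, mul_comm]

end FrameConnection

/-! ### Regularity class of the connection of a frame -/

section Smoothness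

variable {V U : Set M} {e : Fin n → (p : M) → TangentSpace (𝓡 n) p}
  [IsManifold (𝓡 n) 1 M] {q x₀ : M} {r m k : ℕ∞ω} {X Y Z : (p : M) → TangentSpace (𝓡 n) p}

/-- Values of `frameCov` are sums of such rank-one maps. Read in the bundle charts, each becomes an
ordinary derivative times chart components, where regularity can be checked. -/
lemma inCoordinates_smulRight (hq : q ∈ (chartAt (EuclideanSpace ℝ (Fin n)) x₀).source)
    {c : M → ℝ} (hc : MDifferentiableAt (𝓡 n) 𝓘(ℝ, ℝ) c q) (v : TangentSpace (𝓡 n) q) :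
    ContinuousLinearMap.inCoordinates (EuclideanSpace ℝ (Fin n)) (TangentSpace (𝓡 n))
      (EuclideanSpace ℝ (Fin n)) (TangentSpace (𝓡 n) : M → Type _) x₀ q x₀ q
      ((mvfderiv (𝓡 n) c q).smulRight v) =
    (fderiv ℝ (fun y => c ((chartAt (EuclideanSpace ℝ (Fin n)) x₀).symm y))
      (chartAt (EuclideanSpace ℝ (Fin n)) x₀ q)).smulRight
        (differential (chartAt (EuclideanSpace ℝ (Fin n)) x₀) q v) := by
  have hφ : chartAt (EuclideanSpace ℝ (Fin n)) x₀ ∈ maximalAtlas (𝓡 n) 1 M :=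
    chart_mem_maximalAtlas x₀
  have hA : ∀ w : TangentSpace (𝓡 n) q,
      (trivializationAt (EuclideanSpace ℝ (Fin n)) (TangentSpace (𝓡 n)) x₀).continuousLinearMapAt
        ℝ q w = differential (chartAt (EuclideanSpace ℝ (Fin n)) x₀) q w := by
    intro w
    rw [TangentBundle.continuousLinearMapAt_trivializationAt hq]
    rfl
  have hB : ∀ w, (trivializationAt (EuclideanSpace ℝ (Fin n)) (TangentSpace (𝓡 n)) x₀).symmL
        ℝ q w = (differentialEquiv hφ hq).symm w := by
    intro w
    obtain ⟨u, rfl⟩ := (differentialEquiv hφ hq).surjective w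
    rw [ContinuousLinearEquiv.symm_apply_apply, differentialEquiv_apply, ← hA]
    exact Bundle.Trivialization.symmL_continuousLinearMapAt _ (by simpa using hq) u
  rw [(hasFDerivAt_comp_symm hφ hq hc).fderiv]
  ext1 w
  simp only [ContinuousLinearMap.inCoordinates, ContinuousLinearMap.comp_apply,
    ContinuousLinearMap.smulRight_apply, map_smul, hA, hB]
  rfl

lemma isOfClassOn_frameCov [IsManifold (𝓡 n) (k + 1) M] [IsManifold (𝓡 n) (k + 1 + 1) M]
    (he : IsLocalFrameOn (𝓡 n) (EuclideanSpace ℝ (Fin n)) (k + 1) e V) (hV : IsOpen V) :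
    IsOfClassOn k (frameCov he) V where
  contMDiff {Z} hZ := by
    intro x₀ hx₀
    have hφ : chartAt (EuclideanSpace ℝ (Fin n)) x₀ ∈ maximalAtlas (𝓡 n) (k + 1 + 1) M :=
      chart_mem_maximalAtlas x₀
    have hφ' := maximalAtlas_subset_of_le (le_self_add : k + 1 ≤ k + 1 + 1) hφ
    set φ := chartAt (EuclideanSpace ℝ (Fin n)) x₀
    have hxs : x₀ ∈ φ.source := mem_chart_source _ x₀
    let c : Fin n → M → ℝ := fun i p => he.coeff i p (Z p)
    have hc : ∀ i, ContMDiffOn (𝓡 n) 𝓘(ℝ, ℝ) (k + 1) (c i) (V ∩ φ.source) := fun i p hp =>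
      (contMDiffWithinAt_coeff le_rfl he hφ hp.1 hp.2 (hZ p hp.1) i).mono inter_subset_left
    have hO : IsOpen (V ∩ φ.source) := hV.inter φ.open_source
    let O := φ.target ∩ φ.symm ⁻¹' V
    have hOo : IsOpen O := φ.isOpen_inter_preimage_symm hV
    have hcφ : ∀ i, ContDiffOn ℝ (k + 1) (fun y => c i (φ.symm y)) O := by
      intro i
      rw [← contMDiffOn_iff_contDiffOn]
      exact (hc i).comp ((contMDiffOn_symm_of_mem_maximalAtlas hφ').mono inter_subset_left)
        fun y hy => ⟨hy.2, φ.map_target hy.1⟩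
    have hcφ' : ∀ i, ContDiffOn ℝ k (fderiv ℝ fun y => c i (φ.symm y)) O := fun i =>
      (hcφ i).fderiv_of_isOpen hOo le_rfl
    refine ContMDiffAt.contMDiffWithinAt ?_
    rw [contMDiffAt_hom_bundle]
    refine ⟨contMDiffAt_id, ?_⟩
    have hev : ∀ᶠ x in 𝓝 x₀, x ∈ V ∩ φ.source := hO.mem_nhds ⟨hx₀, hxs⟩
    have h1 : ContMDiffAt (𝓡 n) 𝓘(ℝ, EuclideanSpace ℝ (Fin n) →L[ℝ] EuclideanSpace ℝ (Fin n)) k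
        (fun x => ∑ i, (fderiv ℝ (fun y => c i (φ.symm y)) (φ x)).smulRight
          (differential φ x (e i x))) x₀ := by
      refine ContMDiffAt.sum fun i _ => ?_
      have h2 : ContMDiffAt (𝓡 n) 𝓘(ℝ, EuclideanSpace ℝ (Fin n) →L[ℝ] ℝ) k
          (fun x => fderiv ℝ (fun y => c i (φ.symm y)) (φ x)) x₀ :=
        (((hcφ' i).contDiffAt (hOo.mem_nhds ⟨φ.map_source hxs, by simpa [φ.left_inv hxs] using hx₀⟩)
          ).contMDiffAt).comp x₀ ((contMDiffAt_of_mem_maximalAtlas hφ' hxs).of_le le_self_add)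
      have h3 : ContMDiffAt (𝓡 n) 𝓘(ℝ, EuclideanSpace ℝ (Fin n)) k
          (fun x => differential φ x (e i x)) x₀ :=
        ((contMDiffWithinAt_section_iff hφ' hxs).1 (((he.contMDiffOn i x₀ hx₀)).of_le
          le_self_add)).contMDiffAt (hV.mem_nhds hx₀)
      exact ((ContinuousLinearMap.smulRightL ℝ (EuclideanSpace ℝ (Fin n))
        (EuclideanSpace ℝ (Fin n))).isBoundedBilinearMap.contDiff (n := k)).contMDiff.contMDiffAt.comp
          x₀ (h2.prodMk_space h3)
    refine h1.congr_of_eventuallyEq ?_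
    filter_upwards [hev] with x hx
    have h4 : ∀ i, MDifferentiableAt (𝓡 n) 𝓘(ℝ, ℝ) (c i) x := fun i =>
      ((hc i).contMDiffAt (hO.mem_nhds hx)).mdifferentiableAt (by simp)
    rw [← Finset.sum_congr rfl fun i _ => inCoordinates_smulRight hx.2 (h4 i) (e i x)]
    simp only [frameCov, ContinuousLinearMap.inCoordinates]
    ext w : 1
    simp [c, map_sum]

end Smoothness

/-! ### The Lie bracket in a chart and its action on functions -/

section LieBracket

open VectorField

variable [IsManifold (𝓡 n) 1 M] {q x₀ : M} {X Y : (p : M) → TangentSpace (𝓡 n) p}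
  {φ : OpenPartialHomeomorph M (EuclideanSpace ℝ (Fin n))}

lemma differentialEquiv_symm_differential (hφ : φ ∈ maximalAtlas (𝓡 n) 1 M) (hq : q ∈ φ.source)
    (v : TangentSpace (𝓡 n) q) : (differentialEquiv hφ hq).symm (differential φ q v) = v := by
  rw [← differentialEquiv_apply hφ hq, ContinuousLinearEquiv.symm_apply_apply]

/-- The components of a vector field in a chart. -/
def chartField (φ : OpenPartialHomeomorph M (EuclideanSpace ℝ (Fin n)))
    (X : (p : M) → TangentSpace (𝓡 n) p) (y : EuclideanSpace ℝ (Fin n)) :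
    EuclideanSpace ℝ (Fin n) := differential φ (φ.symm y) (X (φ.symm y))

lemma mpullbackWithin_chartAt_symm {y : EuclideanSpace ℝ (Fin n)}
    (hy : y ∈ (chartAt (EuclideanSpace ℝ (Fin n)) x₀).target) :
    mpullbackWithin 𝓘(ℝ, EuclideanSpace ℝ (Fin n)) (𝓡 n) (extChartAt (𝓡 n) x₀).symm X
      (range (𝓡 n)) y = chartField (chartAt (EuclideanSpace ℝ (Fin n)) x₀) X y := by
  have hφ : chartAt (EuclideanSpace ℝ (Fin n)) x₀ ∈ maximalAtlas (𝓡 n) 1 M :=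
    chart_mem_maximalAtlas x₀
  set φ := chartAt (EuclideanSpace ℝ (Fin n)) x₀
  have hq := φ.map_target hy
  have h1 := TangentBundle.symmL_trivializationAt (I := 𝓡 n) hq
  have h2 : extChartAt (𝓡 n) x₀ (φ.symm y) = y := φ.right_inv hy
  rw [h2] at h1
  have hA : ∀ w : TangentSpace (𝓡 n) (φ.symm y),
      (trivializationAt (EuclideanSpace ℝ (Fin n)) (TangentSpace (𝓡 n)) x₀).continuousLinearMapAt
        ℝ (φ.symm y) w = differential φ (φ.symm y) w := by
    intro w
    rw [TangentBundle.continuousLinearMapAt_trivializationAt hq]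
    rfl
  have hB : (mfderivWithin 𝓘(ℝ, EuclideanSpace ℝ (Fin n)) (𝓡 n) (extChartAt (𝓡 n) x₀).symm
      (range (𝓡 n)) y : EuclideanSpace ℝ (Fin n) →L[ℝ] TangentSpace (𝓡 n) (φ.symm y)) =
      ((differentialEquiv hφ hq).symm :
        EuclideanSpace ℝ (Fin n) →L[ℝ] TangentSpace (𝓡 n) (φ.symm y)) := by
    refine h1.symm.trans ?_
    ext1 w
    obtain ⟨u, rfl⟩ := (differentialEquiv hφ hq).surjective w
    change _ = (differentialEquiv hφ hq).symm _
    rw [ContinuousLinearEquiv.symm_apply_apply, differentialEquiv_apply, ← hA]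
    exact Bundle.Trivialization.symmL_continuousLinearMapAt _ (by simpa using hq) u
  have hC := congrArg (fun A : EuclideanSpace ℝ (Fin n) →L[ℝ] TangentSpace (𝓡 n) (φ.symm y) =>
    A.inverse (X (φ.symm y))) hB
  simp only [ContinuousLinearMap.inverse_equiv] at hC
  exact hC

/-- The pullbacks in the definition of the bracket are the chart components of the fields near the
point, and the final inverse derivative is that of the chart. -/
lemma mlieBracket_eq (hφ : chartAt (EuclideanSpace ℝ (Fin n)) q ∈ maximalAtlas (𝓡 n) 1 M) :
    mlieBracket (𝓡 n) X Y q = (differentialEquiv hφ (mem_chart_source _ q)).symm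
      (lieBracket ℝ (chartField (chartAt (EuclideanSpace ℝ (Fin n)) q) X)
        (chartField (chartAt (EuclideanSpace ℝ (Fin n)) q) Y)
        (chartAt (EuclideanSpace ℝ (Fin n)) q q)) := by
  have hq := mem_chart_source (EuclideanSpace ℝ (Fin n)) q
  set φ := chartAt (EuclideanSpace ℝ (Fin n)) q
  have h1 : ∀ Z : (p : M) → TangentSpace (𝓡 n) p,
      (mpullbackWithin 𝓘(ℝ, EuclideanSpace ℝ (Fin n)) (𝓡 n) (extChartAt (𝓡 n) q).symm Z
        (range (𝓡 n)) : EuclideanSpace ℝ (Fin n) → EuclideanSpace ℝ (Fin n))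
        =ᶠ[𝓝 (φ q)] chartField φ Z := by
    intro Z
    filter_upwards [φ.open_target.mem_nhds (φ.map_source hq)] with y hy
    exact mpullbackWithin_chartAt_symm hy
  have h2 : ∀ {A B : EuclideanSpace ℝ (Fin n) → EuclideanSpace ℝ (Fin n)},
      A =ᶠ[𝓝 (φ q)] chartField φ X → B =ᶠ[𝓝 (φ q)] chartField φ Y →
      lieBracketWithin ℝ A B ((extChartAt (𝓡 n) q).symm ⁻¹' univ ∩ range (𝓡 n)) (φ q) =
        lieBracket ℝ (chartField φ X) (chartField φ Y) (φ q) := by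
    intro A B hA hB
    have h3 : ((extChartAt (𝓡 n) q).symm ⁻¹' univ ∩ range (𝓡 n)) = univ := by simp
    rw [h3, lieBracketWithin_univ]
    exact hA.lieBracket_vectorField_eq hB
  let A : TangentSpace (𝓡 n) q →L[ℝ] EuclideanSpace ℝ (Fin n) :=
    mfderiv (𝓡 n) (𝓡 n) (extChartAt (𝓡 n) q) q
  have h4 : A = differentialEquiv hφ hq := by
    ext1 v
    exact (differentialEquiv_apply hφ hq v).symm
  have h5 : A.inverse (lieBracket ℝ (chartField φ X) (chartField φ Y) (φ q)) =
      (differentialEquiv hφ hq).symm (lieBracket ℝ (chartField φ X) (chartField φ Y) (φ q)) := by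
    rw [h4, ContinuousLinearMap.inverse_equiv]
    rfl
  rw [← mlieBracketWithin_univ, mlieBracketWithin_apply]
  exact (congrArg (fun w : EuclideanSpace ℝ (Fin n) => A.inverse w) (h2 (h1 X) (h1 Y))).trans h5

variable [IsManifold (𝓡 n) 2 M]

/-- Differentiation of functions along the bracket of two vector fields. -/
lemma mvfderiv_mlieBracket {c : M → ℝ} (hc : ContMDiffAt (𝓡 n) 𝓘(ℝ, ℝ) 2 c q)
    (hX : MDifferentiableAt (𝓡 n) ((𝓡 n).prod (𝓡 n))
      (fun p => (⟨p, X p⟩ : TangentBundle (𝓡 n) M)) q)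
    (hY : MDifferentiableAt (𝓡 n) ((𝓡 n).prod (𝓡 n))
      (fun p => (⟨p, Y p⟩ : TangentBundle (𝓡 n) M)) q) :
    mvfderiv (𝓡 n) c q (mlieBracket (𝓡 n) X Y q) =
      mvfderiv (𝓡 n) (fun p => mvfderiv (𝓡 n) c p (Y p)) q (X q) -
      mvfderiv (𝓡 n) (fun p => mvfderiv (𝓡 n) c p (X p)) q (Y q) := by
  have hφ2 := chartAt_mem_maximalAtlas_two (n := n) q
  have hφ := mem_maximalAtlas_one hφ2
  have hq := mem_chart_source (EuclideanSpace ℝ (Fin n)) q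
  rw [mlieBracket_eq hφ]
  set φ := chartAt (EuclideanSpace ℝ (Fin n)) q
  let c' : EuclideanSpace ℝ (Fin n) → ℝ := fun y => c (φ.symm y)
  have hc' : ContDiffAt ℝ 2 c' (φ q) := by
    rw [← contMDiffAt_iff_contDiffAt]
    refine ContMDiffAt.comp (I' := 𝓡 n) (φ q) (by rwa [φ.left_inv hq]) ?_
    have hφ2' : φ ∈ maximalAtlas (𝓡 n) 2 M := chart_mem_maximalAtlas q
    exact contMDiffAt_symm_of_mem_maximalAtlas hφ2' (φ.map_source hq)
  have hf : ∀ {Z : (p : M) → TangentSpace (𝓡 n) p}, MDifferentiableAt (𝓡 n) ((𝓡 n).prod (𝓡 n))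
      (fun p => (⟨p, Z p⟩ : TangentBundle (𝓡 n) M)) q →
      DifferentiableAt ℝ (chartField φ Z) (φ q) := by
    intro Z hZ
    rw [← mdifferentiableAt_iff_differentiableAt]
    refine MDifferentiableAt.comp (I' := 𝓡 n) (g := fun p => differential φ p (Z p)) (φ q) ?_
      ((mdifferentiable_of_mem_maximalAtlas hφ).2.mdifferentiableAt
        (φ.open_target.mem_nhds (φ.map_source hq)))
    rw [φ.left_inv hq]
    exact (mdifferentiableAt_section_iff le_rfl hφ2 hq).1 hZ
  have hcev : ∀ᶠ p in 𝓝 q, p ∈ φ.source ∧ MDifferentiableAt (𝓡 n) 𝓘(ℝ, ℝ) c p := by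
    filter_upwards [φ.open_source.mem_nhds hq,
      (contMDiffAt_iff_contMDiffAt_nhds (by simp)).1 hc] with p hp hcp
    exact ⟨hp, hcp.mdifferentiableAt (by simp)⟩
  have hkey : ∀ Z : (p : M) → TangentSpace (𝓡 n) p, ∀ᶠ p in 𝓝 q,
      mvfderiv (𝓡 n) c p (Z p) = fderiv ℝ c' (φ p) (chartField φ Z (φ p)) := by
    intro Z
    filter_upwards [hcev] with p hp
    rw [(hasFDerivAt_comp_symm hφ hp.1 hp.2).fderiv, chartField, φ.left_inv hp.1]
    exact congrArg _ (differentialEquiv_symm_differential hφ hp.1 (Z p)).symm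
  have hd : ∀ {Z : (p : M) → TangentSpace (𝓡 n) p}, MDifferentiableAt (𝓡 n) ((𝓡 n).prod (𝓡 n))
      (fun p => (⟨p, Z p⟩ : TangentBundle (𝓡 n) M)) q → ∀ v : TangentSpace (𝓡 n) q,
      mvfderiv (𝓡 n) (fun p => mvfderiv (𝓡 n) c p (Z p)) q v =
        fderiv ℝ (fun y => fderiv ℝ c' y (chartField φ Z y)) (φ q) (differential φ q v) := by
    intro Z hZ v
    have h1 : DifferentiableAt ℝ (fun y => fderiv ℝ c' y (chartField φ Z y)) (φ q) :=
      ((hc'.fderiv_right (m := 1) (by norm_num)).differentiableAt one_ne_zero).clm_apply (hf hZ)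
    have h2 : MDifferentiableAt (𝓡 n) 𝓘(ℝ, ℝ)
        (fun p => fderiv ℝ c' (φ p) (chartField φ Z (φ p))) q :=
      h1.mdifferentiableAt.comp q ((mdifferentiable_of_mem_maximalAtlas hφ).1.mdifferentiableAt
        (φ.open_source.mem_nhds hq))
    rw [mvfderiv_congr (hkey Z)]
    have h3 := hasFDerivAt_comp_symm hφ hq h2
    have h4 : (fun y => fderiv ℝ c' (φ (φ.symm y)) (chartField φ Z (φ (φ.symm y)))) =ᶠ[𝓝 (φ q)]
        fun y => fderiv ℝ c' y (chartField φ Z y) := by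
      filter_upwards [φ.open_target.mem_nhds (φ.map_source hq)] with y hy
      rw [φ.right_inv hy]
    rw [← h4.fderiv_eq, h3.fderiv]
    exact congrArg _ (differentialEquiv_symm_differential hφ hq v).symm
  have hval : ∀ Z : (p : M) → TangentSpace (𝓡 n) p,
      differential φ q (Z q) = chartField φ Z (φ q) := by
    intro Z
    rw [chartField, φ.left_inv hq]
  have hcq := (hasFDerivAt_comp_symm hφ hq hcev.self_of_nhds.2).fderiv
  rw [hd hY, hd hX, hval, hval, ← fderiv_apply_lieBracket hc' (by simp) (hf hY) (hf hX), hcq]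
  rfl

end LieBracket

/-! ### Normal frames give flat parallel transports -/

section FlatConnection

open VectorField

variable {V U : Set M} {e : Fin n → (p : M) → TangentSpace (𝓡 n) p}
  [IsManifold (𝓡 n) 1 M] [IsManifold (𝓡 n) 2 M] {p q : M} {k : ℕ∞ω}
  [IsManifold (𝓡 n) (k + 1) M] [IsManifold (𝓡 n) (k + 1 + 1) M]
  {X Y Z : (p : M) → TangentSpace (𝓡 n) p} {L : LinearTransport n M} {cov : Cov n M}

lemma frameCov_congr {r : ℕ∞ω} (he : IsLocalFrameOn (𝓡 n) (EuclideanSpace ℝ (Fin n)) r e V)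
    (h : ∀ᶠ q in 𝓝 p, Y q = Z q) : frameCov he Y p = frameCov he Z p := by
  refine Finset.sum_congr rfl fun i _ => ?_
  rw [mvfderiv_congr (f := fun q => he.coeff i q (Y q)) (g := fun q => he.coeff i q (Z q))
    (h.mono fun q hq => by simp only [hq])]

/-- The connection defined by a frame is flat. -/
lemma frameCov_curvature (hk : 1 ≤ k)
    (he : IsLocalFrameOn (𝓡 n) (EuclideanSpace ℝ (Fin n)) (k + 1) e V)
    (hV : IsOpen V) (hp : p ∈ V)
    (hX : MDifferentiableAt (𝓡 n) ((𝓡 n).prod (𝓡 n))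
      (fun p => (⟨p, X p⟩ : TangentBundle (𝓡 n) M)) p)
    (hY : MDifferentiableAt (𝓡 n) ((𝓡 n).prod (𝓡 n))
      (fun p => (⟨p, Y p⟩ : TangentBundle (𝓡 n) M)) p)
    (hZ : ContMDiffAt (𝓡 n) ((𝓡 n).prod (𝓡 n)) 2
      (fun p => (⟨p, Z p⟩ : TangentBundle (𝓡 n) M)) p) :
    frameCov he (fun q => frameCov he Z q (Y q)) p (X p) -
      frameCov he (fun q => frameCov he Z q (X q)) p (Y p) -
      frameCov he Z p (mlieBracket (𝓡 n) X Y p) = 0 := by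
  have hk2 : (2 : ℕ∞ω) ≤ k + 1 := by
    rw [← one_add_one_eq_two]
    exact add_le_add_left hk 1
  have hφ : chartAt (EuclideanSpace ℝ (Fin n)) p ∈ maximalAtlas (𝓡 n) (k + 1 + 1) M :=
    chart_mem_maximalAtlas p
  have hc : ∀ i, ContMDiffAt (𝓡 n) 𝓘(ℝ, ℝ) 2 (fun q => he.coeff i q (Z q)) p := fun i =>
    (contMDiffWithinAt_coeff hk2 he hφ hp (mem_chart_source _ p) hZ.contMDiffWithinAt
      i).contMDiffAt (hV.mem_nhds hp)
  -- The components of `∇_v ∇_Y Z` are iterated directional derivatives `v(Y zⁱ)`, so each component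
  -- of the curvature is `X Y zⁱ - Y X zⁱ - [X, Y] zⁱ = 0`.
  have h1 : ∀ (Y : (p : M) → TangentSpace (𝓡 n) p) (v : TangentSpace (𝓡 n) p),
      frameCov he (fun q => frameCov he Z q (Y q)) p v = ∑ i, mvfderiv (𝓡 n)
        (fun q => mvfderiv (𝓡 n) (fun q => he.coeff i q (Z q)) q (Y q)) p v • e i p := by
    intro Y v
    have h2 : ∀ i, mvfderiv (𝓡 n) (fun q => he.coeff i q (frameCov he Z q (Y q))) p =
        mvfderiv (𝓡 n) (fun q => mvfderiv (𝓡 n) (fun q => he.coeff i q (Z q)) q (Y q)) p :=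
      fun i => mvfderiv_congr <| by
        filter_upwards [hV.mem_nhds hp] with q hq using coeff_frameCov he hq (Y q) i
    rw [frameCov, _root_.sum_apply]
    exact Finset.sum_congr rfl fun i _ => by rw [h2, ContinuousLinearMap.smulRight_apply]
  rw [h1, h1, frameCov, _root_.sum_apply, ← Finset.sum_sub_distrib, ← Finset.sum_sub_distrib]
  refine Finset.sum_eq_zero fun i _ => ?_
  rw [ContinuousLinearMap.smulRight_apply, mvfderiv_mlieBracket (hc i) hX hY]
  module

/-- All the conditions are local. It suffices that near each point `cov` acts on differentiable
sections as the connection of some frame, and that the transport along a path in `U` moves this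
frame for nearby parameters. This covers one global normal frame as well as a patchwork of local
ones. -/
lemma isFlatParallelTransportOn_of_frames (hk : 1 ≤ k) (hU : IsOpen U)
    (h : ∀ p ∈ U, ∃ (V : Set M) (e : Fin n → (p : M) → TangentSpace (𝓡 n) p)
      (he : IsLocalFrameOn (𝓡 n) (EuclideanSpace ℝ (Fin n)) (k + 1) e V),
      IsOpen V ∧ p ∈ V ∧ V ⊆ U ∧
      (∀ q ∈ V, ∀ Z : (p : M) → TangentSpace (𝓡 n) p,
        MDifferentiableAt (𝓡 n) ((𝓡 n).prod (𝓡 n))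
          (fun p => (⟨p, Z p⟩ : TangentBundle (𝓡 n) M)) q → cov Z q = frameCov he Z q) ∧
      ∀ γ : Path n M, γ.LiesIn U → ∀ t : γ.dom, γ t ∈ V →
        ∀ᶠ τ in 𝓝 t, ∀ i, L.tr γ t τ (e i (γ t)) = e i (γ τ)) :
    L.IsFlatParallelTransportOn k U := by
  have hk2 : (1 + 1 : ℕ∞ω) ≤ k + 1 := add_le_add_left hk 1
  have hk3 : (1 + 1 + 1 : ℕ∞ω) ≤ k + 1 + 1 := add_le_add_left hk2 1
  have hk1 : (1 : ℕ∞ω) ≤ k + 1 := le_add_self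
  have : IsManifold (𝓡 n) (1 + 1) M := IsManifold.of_le hk2
  have : IsManifold (𝓡 n) (1 + 1 + 1) M := IsManifold.of_le hk3
  refine ⟨cov, ⟨fun {σ σ' x} hσ hσ' hx => ?_, fun {σ g x} hσ hg hx => ?_⟩,
    ⟨fun {Z} hZ x hx => ?_⟩, fun X Y Z hX hY hZ p hp => ?_, fun γ hγ s u t => ?_⟩
  · obtain ⟨V, e, he, hV, hxV, -, hc, -⟩ := h x hx
    rw [hc x hxV _ hσ, hc x hxV _ hσ', hc x hxV _ (mdifferentiableAt_add_section hσ hσ')]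
    exact (isLinearConnectionOn_frameCov (isLocalFrameOn_of_le he hk1) hV).add hσ hσ' hxV
  · obtain ⟨V, e, he, hV, hxV, -, hc, -⟩ := h x hx
    rw [hc x hxV _ hσ, hc x hxV _ (hg.smul_section hσ)]
    exact (isLinearConnectionOn_frameCov (isLocalFrameOn_of_le he hk1) hV).leibniz hσ hg hxV
  · obtain ⟨V, e, he, hV, hxV, hVU, hc, -⟩ := h x hx
    have h1 := (isOfClassOn_frameCov he hV).contMDiff (hZ.mono hVU)
    refine ((h1 x hxV).contMDiffAt (hV.mem_nhds hxV)).contMDiffWithinAt.congr_of_eventuallyEq ?_ ?_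
    · filter_upwards [mem_nhdsWithin_of_mem_nhds (hV.mem_nhds hxV)] with y hy
      rw [hc y hy Z (((hZ y (hVU hy)).contMDiffAt (hU.mem_nhds (hVU hy))).mdifferentiableAt
        (by simp))]
    · rw [hc x hxV Z (((hZ x hx).contMDiffAt (hU.mem_nhds hx)).mdifferentiableAt (by simp))]
  · obtain ⟨V, e, he, hV, hpV, hVU, hc, -⟩ := h p hp
    have hZd : ∀ q ∈ V, cov Z q = frameCov he Z q := fun q hq =>
      hc q hq Z (((hZ q (hVU hq)).contMDiffAt (hU.mem_nhds (hVU hq))).mdifferentiableAt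
        two_ne_zero)
    have hZ' : ContMDiffOn (𝓡 n) ((𝓡 n).prod (𝓡 n)) (1 + 1)
        (fun p => (⟨p, Z p⟩ : TangentBundle (𝓡 n) M)) V :=
      (hZ.mono hVU).of_le one_add_one_eq_two.le
    have hcl := (isOfClassOn_frameCov (isLocalFrameOn_of_le he hk2) hV).contMDiff hZ'
    -- The agreement with `frameCov` is known for differentiable sections only, so the inner section
    -- `∇_Y Z` must first be shown to be differentiable at `p`.
    have hW : ∀ {Y : (p : M) → TangentSpace (𝓡 n) p}, IsVectorFieldOn 1 Y U →
        cov (fun q => cov Z q (Y q)) p = frameCov he (fun q => frameCov he Z q (Y q)) p := by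
      intro Y hY
      have h1 : ContMDiffOn (𝓡 n) ((𝓡 n).prod (𝓡 n)) 1
          (fun q => (⟨q, frameCov he Z q (Y q)⟩ : TangentBundle (𝓡 n) M)) V :=
        hcl.clm_bundle_apply (hY.mono hVU)
      have hev : ∀ᶠ q in 𝓝 p, cov Z q (Y q) = frameCov he Z q (Y q) := by
        filter_upwards [hV.mem_nhds hpV] with q hq
        rw [hZd q hq]
      have h2 : MDifferentiableAt (𝓡 n) ((𝓡 n).prod (𝓡 n))
          (fun q => (⟨q, cov Z q (Y q)⟩ : TangentBundle (𝓡 n) M)) p := by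
        refine (((h1 p hpV).contMDiffAt (hV.mem_nhds hpV)).mdifferentiableAt
          one_ne_zero).congr_of_eventuallyEq ?_
        filter_upwards [hev] with q hq
        rw [hq]
      rw [hc p hpV _ h2, frameCov_congr he hev]
    rw [hW hX, hW hY, hZd p hpV]
    exact frameCov_curvature hk he hV hpV
      (((hX p hp).contMDiffAt (hU.mem_nhds hp)).mdifferentiableAt one_ne_zero)
      (((hY p hp).contMDiffAt (hU.mem_nhds hp)).mdifferentiableAt one_ne_zero)
      ((hZ p hp).contMDiffAt (hU.mem_nhds hp))
  · obtain ⟨V, e, he, hV, htV, -, hc, htr⟩ := h (γ t) (hγ t.2)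
    set w := L.tr γ s t u with hw
    have hsum : w = ∑ i, he.coeff i (γ t) w • e i (γ t) := by
      have h2 := (he.toBasisAt htV).sum_repr w
      simp only [IsLocalFrameOn.toBasisAt_coe] at h2
      conv_lhs => rw [← h2]
      simp [IsLocalFrameOn.coeff, htV]
    -- Near `t` the lifting has constant components in `e`, whose covariant derivatives vanish.
    refine ⟨V, e, fun i _ => he.coeff i (γ t) w, fun _ => 0, hV, htV, isLocalFrameOn_of_le he hk1,
      ?_, fun i => hasDerivWithinAt_const _ _ _, ?_⟩
    · filter_upwards [htr γ hγ t htV] with τ hτ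
      rw [← L.tr_tr γ s t τ u, ← hw]
      conv_lhs => rw [hsum]
      simp only [map_sum, map_smul, hτ]
    · have h0 : ∀ i, cov (e i) (γ t) = 0 := fun i => by
        rw [hc _ htV _ (mdifferentiableAt_frame (by simp) he hV htV i), frameCov_frame he hV htV]
      simp [h0]

lemma IsNormalFrame.isFlatParallelTransportOn (hk : 1 ≤ k) (hU : IsOpen U)
    (he : L.IsNormalFrame (k + 1) e U) : L.IsFlatParallelTransportOn k U :=
  isFlatParallelTransportOn_of_frames (cov := frameCov he.frame) hk hU fun _ hp =>
    ⟨U, e, he.frame, hU, hp, subset_rfl, fun _ _ _ _ => rfl,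
      fun γ hγ t _ => Eventually.of_forall fun τ i => he.transport γ hγ t τ i⟩

end FlatConnection

/-! ### Gluing local normal frames when the transport is local -/

section LocalTransports

variable {S S' U V : Set M} {e e' : Fin n → (p : M) → TangentSpace (𝓡 n) p}
  [IsManifold (𝓡 n) 1 M] [IsManifold (𝓡 n) 2 M] {p q : M} {k : ℕ∞ω}
  {Z : (p : M) → TangentSpace (𝓡 n) p} {L : LinearTransport n M}

lemma isSubmanifold_univ {r : ℕ∞ω} [IsManifold (𝓡 n) r M] :
    IsSubmanifold n r (univ : Set M) :=
  ⟨⊤, fun p _ => ⟨chartAt _ p, chart_mem_maximalAtlas p, mem_chart_source _ p, by simp⟩⟩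

/-- Two frames which are normal for the same transport define the same connection. -/
lemma frameCov_eq_of_isNormalFrame (he : L.IsNormalFrame 1 e S) (he' : L.IsNormalFrame 1 e' S')
    (hS : IsOpen S) (hS' : IsOpen S') (hp : p ∈ S) (hp' : p ∈ S')
    (hZ : MDifferentiableAt (𝓡 n) ((𝓡 n).prod (𝓡 n))
      (fun p => (⟨p, Z p⟩ : TangentBundle (𝓡 n) M)) p) :
    frameCov he.frame Z p = frameCov he'.frame Z p := by
  -- The transition matrix is constant along paths in the overlap, as both frames are transported
  -- there; hence it is locally constant and `e'` is parallel for the connection of `e`.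
  let a : M → Fin n → Fin n → ℝ := fun q i j => he.frame.coeff j q (e' i q)
  have hO : IsOpen (S ∩ S') := hS.inter hS'
  have hconst : ∀ γ : Path n M, γ.LiesIn (univ ∩ (S ∩ S')) → ∀ s t : γ.dom,
      a (γ s) = a (γ t) := by
    intro γ hγ s t
    rw [univ_inter] at hγ
    ext i j
    have h1 : e' i (γ s) = ∑ j, a (γ s) i j • e j (γ s) :=
      he.frame.coeff_sum_eq (e' i) (hγ s.2).1
    have h2 := he'.transport γ (fun u hu => (hγ hu).2) s t i
    rw [h1, map_sum] at h2
    simp only [map_smul, he.transport γ (fun u hu => (hγ hu).1) s t] at h2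
    change _ = he.frame.coeff j (γ t) (e' i (γ t))
    rw [← h2, coeff_sum he.frame (hγ t.2).1]
  have : IsManifold (𝓡 n) (1 + 1) M := IsManifold.of_le one_add_one_eq_two.le
  obtain ⟨V, hV, hpV, hVO, ha⟩ := IsSubmanifold.exists_eqOn_of_const_along_paths
    (isSubmanifold_univ (r := 1 + 1)) hconst (mem_univ p) hO ⟨hp, hp'⟩
  have h0 : ∀ i, frameCov he.frame (e' i) p = 0 := by
    intro i
    refine Finset.sum_eq_zero fun j _ => ?_
    have h1 : (fun q => he.frame.coeff j q (e' i q)) =ᶠ[𝓝 p] fun _ => a p i j := by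
      filter_upwards [hV.mem_nhds hpV] with q hq
      exact congrFun (congrFun (ha q ⟨mem_univ q, hq⟩) i) j
    rw [mvfderiv_congr h1, mvfderiv_const (I := 𝓡 n)]
    ext v
    simp
  rw [cov_eq_sum_of_eventuallyEq (isLinearConnectionOn_frameCov he.frame hS) hS hp
    (fun i => mdifferentiableAt_frame one_ne_zero he'.frame hS' hp' i)
    (fun i => mdifferentiableAt_coeff he'.frame hS' hp' hZ i)
    (he'.frame.eventually_eq_sum_coeff_smul Z (hS'.mem_nhds hp'))]
  simp only [h0, smul_zero, zero_add]
  rfl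

/-- A local transport moves a normal frame along the pieces of a path which lie in its domain. -/
lemma LinearTransport.IsLocal.eventually_tr_eq {r : ℕ∞ω} (hL : L.IsLocal)
    (he : L.IsNormalFrame r e V) (hV : IsOpen V) (γ : Path n M) (t : γ.dom) (ht : γ t ∈ V) :
    ∀ᶠ τ in 𝓝 t, ∀ i, L.tr γ t τ (e i (γ t)) = e i (γ τ) := by
  have hc : ∀ᶠ u in 𝓝[γ.dom] (t : ℝ), γ u ∈ V :=
    γ.contMDiffOn.continuousOn t t.2 (hV.mem_nhds ht)
  obtain ⟨ε, hε, hεV⟩ := Metric.mem_nhdsWithin_iff.1 hc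
  let J := Metric.ball (t : ℝ) ε ∩ γ.dom
  have hJ : J.OrdConnected := by
    have : (Metric.ball (t : ℝ) ε).OrdConnected := by
      rw [Real.ball_eq_Ioo]; exact ordConnected_Ioo
    exact this.inter γ.ordConnected
  have htJ : (t : ℝ) ∈ J := ⟨Metric.mem_ball_self hε, t.2⟩
  have hJ' : J.Nontrivial := by
    -- An end point of the interval is also an accumulation point of it, so the subinterval around
    -- `t` is non-degenerate.
    obtain ⟨y, hy, hyt⟩ := accPt_iff_nhds.1 (uniqueDiffWithinAt_iff_accPt.1
      (γ.uniqueDiffOn t t.2)) _ (Metric.ball_mem_nhds _ hε)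
    exact ⟨y, hy, t, htJ, hyt⟩
  have hJd : J ⊆ γ.dom := inter_subset_right
  have hlies : (γ.restrict J hJ hJ' hJd).LiesIn V := fun u hu => hεV hu
  have hev : ∀ᶠ τ : γ.dom in 𝓝 t, (τ : ℝ) ∈ Metric.ball (t : ℝ) ε :=
    continuous_subtype_val.continuousAt (Metric.ball_mem_nhds _ hε)
  filter_upwards [hev] with τ hτ i
  have h1 := LinearMap.congr_fun (hL γ J hJ hJ' hJd ⟨t, htJ⟩ ⟨τ, hτ, τ.2⟩) (e i (γ t))
  exact h1.symm.trans (he.transport (γ.restrict J hJ hJ' hJd) hlies ⟨t, htJ⟩ ⟨τ, hτ, τ.2⟩ i)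

lemma LinearTransport.AdmitsNormalFrames.isFlatParallelTransportOn
    [IsManifold (𝓡 n) (k + 1) M] [IsManifold (𝓡 n) (k + 1 + 1) M] (hk : 1 ≤ k) (hU : IsOpen U)
    (hL : L.IsLocal) (h : L.AdmitsNormalFrames (k + 1) U) : L.IsFlatParallelTransportOn k U := by
  classical
  have hk1 : (1 : ℕ∞ω) ≤ k + 1 := le_add_self
  choose! V hV hpV e he using h
  have he1 : ∀ p ∈ U, L.IsNormalFrame 1 (e p) (U ∩ V p) := fun p hp =>
    ⟨isLocalFrameOn_of_le (he p hp).frame hk1, (he p hp).transport⟩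
  -- At each point the connection is that of the frame chosen at this very point. On overlaps the
  -- choice does not matter, so near `p` it is the connection of the single frame `e p`.
  let cov : Cov n M := fun Z p => if hp : p ∈ U then frameCov (he p hp).frame Z p else 0
  refine isFlatParallelTransportOn_of_frames (cov := cov) hk hU fun p hp =>
    ⟨U ∩ V p, e p, (he p hp).frame, hU.inter (hV p hp), ⟨hp, hpV p hp⟩, inter_subset_left,
      fun q hq Z hZ => ?_, fun γ _ t ht => hL.eventually_tr_eq (he p hp) (hU.inter (hV p hp)) γ t ht⟩
  simp only [cov, hq.1, dite_true]
  exact frameCov_eq_of_isNormalFrame (he1 q hq.1) (he1 p hp) (hU.inter (hV q hq.1))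
    (hU.inter (hV p hp)) ⟨hq.1, hpV q hq.1⟩ hq hZ

end LocalTransports

/-! ### Extension of local vector fields; commuting coordinate fields -/

section Extension

variable [IsManifold (𝓡 n) 1 M] {p : M} {X : (p : M) → TangentSpace (𝓡 n) p}
  {φ : OpenPartialHomeomorph M (EuclideanSpace ℝ (Fin n))}

/-- A local vector field agrees near a given point with a global one. -/
lemma exists_contMDiff_section_eventuallyEq [T2Space M] {r : ℕ∞}
    (hφ : φ ∈ maximalAtlas (𝓡 n) ((r : ℕ∞ω) + 1) M) (hp : p ∈ φ.source)
    (hX : IsVectorFieldOn r X φ.source) :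
    ∃ Y : (p : M) → TangentSpace (𝓡 n) p, IsVectorFieldOn r Y univ ∧ ∀ᶠ q in 𝓝 p, Y q = X q := by
  classical
  obtain ⟨ε, hε, hball⟩ := Metric.isOpen_iff.1 φ.open_target (φ p) (φ.map_source hp)
  let χ : ContDiffBump (φ p) := ⟨ε / 3, ε / 2, by positivity, by linarith⟩
  have hsub : Metric.closedBall (φ p) (ε / 2) ⊆ φ.target :=
    (Metric.closedBall_subset_ball (by linarith)).trans hball
  let K := φ.symm '' Metric.closedBall (φ p) (ε / 2)
  -- Closedness of the compact set uses that `M` is Hausdorff; it makes extension by zero smooth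
  -- outside the chart domain.
  have hK : IsClosed K := ((isCompact_closedBall _ _).image_of_continuousOn
    (φ.continuousOn_symm.mono hsub)).isClosed
  have hKs : K ⊆ φ.source := by
    rintro _ ⟨y, hy, rfl⟩
    exact φ.map_target (hsub hy)
  let f : M → ℝ := fun q => if q ∈ φ.source then χ (φ q) else 0
  refine ⟨fun q => f q • X q, fun q _ => ContMDiffAt.contMDiffWithinAt ?_, ?_⟩
  · by_cases hq : q ∈ φ.source
    · have hf : ContMDiffAt (𝓡 n) 𝓘(ℝ, ℝ) r f q := by
        have h1 : ContMDiffAt (𝓡 n) 𝓘(ℝ, ℝ) r (fun q => χ (φ q)) q :=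
          (χ.contDiff (n := (r : ℕ∞))).contMDiff.contMDiffAt.comp q
            ((contMDiffAt_of_mem_maximalAtlas hφ hq).of_le le_self_add)
        refine h1.congr_of_eventuallyEq ?_
        filter_upwards [φ.open_source.mem_nhds hq] with x hx
        simp [f, hx]
      exact hf.smul_section ((hX q hq).contMDiffAt (φ.open_source.mem_nhds hq))
    · have h0 : ContMDiffAt (𝓡 n) ((𝓡 n).prod (𝓡 n)) r
          (fun q => (⟨q, 0⟩ : TangentBundle (𝓡 n) M)) q :=
        (Bundle.contMDiff_zeroSection ℝ (TangentSpace (𝓡 n) : M → Type _)).contMDiffAt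
      refine h0.congr_of_eventuallyEq ?_
      filter_upwards [hK.isOpen_compl.mem_nhds fun h => hq (hKs h)] with x hx
      have hfx : f x = 0 := by
        by_cases hxs : x ∈ φ.source
        · simp only [f, hxs, if_true]
          refine χ.zero_of_le_dist (le_of_not_gt fun hlt => hx ⟨φ x, ?_, φ.left_inv hxs⟩)
          exact Metric.mem_closedBall.2 (le_of_lt hlt)
        · simp [f, hxs]
      simp [hfx]
  · have h1 : ∀ᶠ q in 𝓝 p, φ q ∈ Metric.closedBall (φ p) (ε / 3) :=
      (φ.continuousAt hp) (Metric.closedBall_mem_nhds _ (by positivity))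
    filter_upwards [h1, φ.open_source.mem_nhds hp] with q hq hqs
    simp [f, hqs, χ.one_of_mem_closedBall hq]

open VectorField in
/-- Vector fields with constant components in a chart commute. -/
lemma mlieBracket_eq_zero_of_differential_eq_const [IsManifold (𝓡 n) 2 M]
    {Y : (p : M) → TangentSpace (𝓡 n) p}
    (hφ : φ ∈ maximalAtlas (𝓡 n) (1 + 1) M) (hp : p ∈ φ.source) {u v : EuclideanSpace ℝ (Fin n)}
    (hX : ∀ᶠ q in 𝓝 p, differential φ q (X q) = u) (hY : ∀ᶠ q in 𝓝 p, differential φ q (Y q) = v) :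
    mlieBracket (𝓡 n) X Y p = 0 := by
  have hφ1 := mem_maximalAtlas_one hφ
  have hd : ∀ {X : (p : M) → TangentSpace (𝓡 n) p} {u : EuclideanSpace ℝ (Fin n)},
      (∀ᶠ q in 𝓝 p, differential φ q (X q) = u) →
      MDifferentiableAt (𝓡 n) ((𝓡 n).prod (𝓡 n))
        (fun p => (⟨p, X p⟩ : TangentBundle (𝓡 n) M)) p := fun {X u} h =>
    (mdifferentiableAt_section_iff le_rfl hφ hp).2
      ((mdifferentiableAt_const (c := u)).congr_of_eventuallyEq h)
  let c : Fin n → M → ℝ := fun i q => φ q i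
  have hφ2 : φ ∈ maximalAtlas (𝓡 n) 2 M := by
    have h := maximalAtlas_subset_of_le (I := 𝓡 n) (M := M) one_add_one_eq_two.ge hφ
    exact h
  have hc : ∀ i, ContMDiffAt (𝓡 n) 𝓘(ℝ, ℝ) 2 (c i) p := fun i =>
    ((EuclideanSpace.proj i : EuclideanSpace ℝ (Fin n) →L[ℝ] ℝ).contDiff (n := 2)
      ).contMDiff.contMDiffAt.comp p (contMDiffAt_of_mem_maximalAtlas hφ2 hp)
  have hcd : ∀ i, ∀ q ∈ φ.source, ∀ w : TangentSpace (𝓡 n) q,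
      mvfderiv (𝓡 n) (c i) q w = differential φ q w i := by
    intro i q hq w
    have h1 := ((EuclideanSpace.proj i : EuclideanSpace ℝ (Fin n) →L[ℝ] ℝ).hasFDerivAt
      (x := φ q)).hasMFDerivAt.comp q (((mdifferentiable_of_mem_maximalAtlas hφ1
        ).1.mdifferentiableAt (φ.open_source.mem_nhds hq)).hasMFDerivAt)
    have h2 := h1.mfderiv
    exact DFunLike.congr_fun h2 w
  -- The bracket is tested on the coordinate functions: their derivatives along both fields are
  -- constant near `p`, so the commutator kills them.
  have h0 : ∀ i, mvfderiv (𝓡 n) (c i) p (mlieBracket (𝓡 n) X Y p) = 0 := by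
    intro i
    have hconst : ∀ {X : (p : M) → TangentSpace (𝓡 n) p} {u : EuclideanSpace ℝ (Fin n)},
        (∀ᶠ q in 𝓝 p, differential φ q (X q) = u) →
        mvfderiv (𝓡 n) (fun q => mvfderiv (𝓡 n) (c i) q (X q)) p = 0 := by
      intro X u h
      have h1 : (fun q => mvfderiv (𝓡 n) (c i) q (X q)) =ᶠ[𝓝 p] fun _ => u i := by
        filter_upwards [h, φ.open_source.mem_nhds hp] with q hq hqs
        rw [hcd i q hqs, hq]
      rw [mvfderiv_congr h1]
      exact mvfderiv_const (I := 𝓡 n) _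
    rw [mvfderiv_mlieBracket (hc i) (hd hX) (hd hY), hconst hX, hconst hY]
    simp
  apply differential_injective hφ1 hp
  rw [map_zero]
  ext i
  rw [← hcd i p hp, h0]
  rfl

end Extension

/-! ### Trilinear identities checked on a basis -/

section Bilinear

variable {E F G H : Type*} [NormedAddCommGroup E] [NormedSpace ℝ E] [NormedAddCommGroup F]
  [NormedSpace ℝ F] [NormedAddCommGroup G] [NormedSpace ℝ G] [NormedAddCommGroup H]
  [NormedSpace ℝ H] {Γ : H → E →L[ℝ] F →L[ℝ] G} {y : H}

lemma differentiableAt_apply_apply (hΓ : DifferentiableAt ℝ Γ y) (b : E) (c : F) :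
    DifferentiableAt ℝ (fun y => Γ y b c) y :=
  (hΓ.clm_apply (differentiableAt_const b)).clm_apply (differentiableAt_const c)

lemma fderiv_apply_apply (hΓ : DifferentiableAt ℝ Γ y) (b : E) (c : F) (u : H) :
    fderiv ℝ (fun y => Γ y b c) y u = fderiv ℝ Γ y u b c := by
  have h := ((hΓ.hasFDerivAt.clm_apply (hasFDerivAt_const b y)).clm_apply
    (hasFDerivAt_const c y)).fderiv
  rw [h]
  simp

lemma integrability_of_basis {ι : Type*} (e : Module.Basis ι ℝ E) {D : E →L[ℝ] E →L[ℝ] E →L[ℝ] E}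
    {A : E →L[ℝ] E →L[ℝ] E}
    (h : ∀ a b c, D (e a) (e b) (e c) + A (e a) (A (e b) (e c)) =
      D (e b) (e a) (e c) + A (e b) (A (e a) (e c))) (u v : E) :
    D u v + A u * A v = D v u + A v * A u := by
  let T := D + (ContinuousLinearMap.mul ℝ (E →L[ℝ] E)).bilinearComp A A
  have hext : ∀ {F : Type _} [NormedAddCommGroup F] [NormedSpace ℝ F] {B B' : E →L[ℝ] F},
      (∀ i, B (e i) = B' (e i)) → B = B' := fun h => ContinuousLinearMap.coe_injective (e.ext h)
  have hT : T = T.flip := hext fun a => hext fun b => hext fun c => h a b c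
  exact DFunLike.congr_fun (DFunLike.congr_fun hT u) v

end Bilinear

/-! ### The connection form in a chart and its integrability condition -/

section Christoffel

variable [IsManifold (𝓡 n) 1 M] [IsManifold (𝓡 n) 2 M] {cov : Cov n M} {U O : Set M} {p q : M}
  {X : (p : M) → TangentSpace (𝓡 n) p} {Z : Fin n → (p : M) → TangentSpace (𝓡 n) p}
  {φ : OpenPartialHomeomorph M (EuclideanSpace ℝ (Fin n))} {k : ℕ∞ω}

lemma chartField_apply (hq : q ∈ φ.source) :
    chartField φ X (φ q) = differential φ q (X q) := by
  rw [chartField, φ.left_inv hq]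

/-- The connection form of `cov` in the chart `φ`, computed with the fields `Z`, which are meant to
be extensions of the coordinate fields. -/
def christoffel (cov : Cov n M) (φ : OpenPartialHomeomorph M (EuclideanSpace ℝ (Fin n)))
    (Z : Fin n → (p : M) → TangentSpace (𝓡 n) p) (y : EuclideanSpace ℝ (Fin n)) :
    EuclideanSpace ℝ (Fin n) →L[ℝ] EuclideanSpace ℝ (Fin n) →L[ℝ] EuclideanSpace ℝ (Fin n) :=
  ∑ i, ∑ j, (EuclideanSpace.proj i : EuclideanSpace ℝ (Fin n) →L[ℝ] ℝ).smulRight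
    ((EuclideanSpace.proj j : EuclideanSpace ℝ (Fin n) →L[ℝ] ℝ).smulRight
      (chartField φ (fun q => cov (Z j) q (Z i q)) y))

lemma christoffel_apply (y u v : EuclideanSpace ℝ (Fin n)) :
    christoffel cov φ Z y u v =
      ∑ i, ∑ j, u i • v j • chartField φ (fun q => cov (Z j) q (Z i q)) y := by
  simp [christoffel]

lemma christoffel_single (y : EuclideanSpace ℝ (Fin n)) (i j : Fin n) :
    christoffel cov φ Z y (EuclideanSpace.single i 1) (EuclideanSpace.single j 1) =
      chartField φ (fun q => cov (Z j) q (Z i q)) y := by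
  rw [christoffel_apply, Finset.sum_eq_single i, Finset.sum_eq_single j] <;>
    simp +contextual [PiLp.single_apply]

lemma contDiffOn_chartField (hφ : φ ∈ maximalAtlas (𝓡 n) (k + 1) M) (hOs : O ⊆ φ.source)
    (hX : IsVectorFieldOn k X O) {B : Set (EuclideanSpace ℝ (Fin n))} (hB : B ⊆ φ.target)
    (hBO : ∀ y ∈ B, φ.symm y ∈ O) : ContDiffOn ℝ k (chartField φ X) B := by
  rw [← contMDiffOn_iff_contDiffOn]
  have h1 : ContMDiffOn (𝓡 n) (𝓡 n) k (fun q => differential φ q (X q)) O := fun q hq =>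
    (contMDiffWithinAt_section_iff hφ (hOs hq)).1 (hX q hq)
  exact h1.comp (((contMDiffOn_symm_of_mem_maximalAtlas hφ).of_le le_self_add).mono hB) hBO

lemma contDiffOn_christoffel (hφ : φ ∈ maximalAtlas (𝓡 n) (k + 1) M) (hOs : O ⊆ φ.source)
    (hOU : O ⊆ U) (hcov : IsOfClassOn k cov U) (hZ : ∀ i, IsVectorFieldOn (k + 1) (Z i) U)
    {B : Set (EuclideanSpace ℝ (Fin n))} (hB : B ⊆ φ.target) (hBO : ∀ y ∈ B, φ.symm y ∈ O) :
    ContDiffOn ℝ k (christoffel cov φ Z) B := by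
  refine ContDiffOn.sum fun i _ => ContDiffOn.sum fun j _ => contDiffOn_const.smulRight
    (contDiffOn_const.smulRight (contDiffOn_chartField hφ hOs ?_ hB hBO))
  exact ((hcov.contMDiff (hZ j)).clm_bundle_apply ((hZ i).of_le le_self_add)).mono hOU

/-- The covariant derivative of a vector field in terms of its components in a chart. -/
lemma differential_cov_eq (hcov : IsLinearConnectionOn cov U) (hU : IsOpen U)
    (hφ : φ ∈ maximalAtlas (𝓡 n) (1 + 1) M) (hO : IsOpen O) (hOs : O ⊆ φ.source) (hOU : O ⊆ U)
    (hZ : ∀ q ∈ O, ∀ j, differential φ q (Z j q) = EuclideanSpace.single j 1) (hq : q ∈ O)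
    (hX : DifferentiableAt ℝ (chartField φ X) (φ q)) (w : TangentSpace (𝓡 n) q) :
    differential φ q (cov X q w) =
      christoffel cov φ Z (φ q) (differential φ q w) (chartField φ X (φ q)) +
        fderiv ℝ (chartField φ X) (φ q) (differential φ q w) := by
  have hφ1 := mem_maximalAtlas_one hφ
  have hqs := hOs hq
  have hexp : ∀ p ∈ O, ∀ v : TangentSpace (𝓡 n) p,
      v = ∑ j, differential φ p v j • Z j p := by
    intro p hp v
    apply differential_injective hφ1 (hOs hp)
    simp only [map_sum, map_smul, hZ p hp]
    ext i
    simp [Pi.single_apply]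
  have hZd : ∀ j, MDifferentiableAt (𝓡 n) ((𝓡 n).prod (𝓡 n))
      (fun p => (⟨p, Z j p⟩ : TangentBundle (𝓡 n) M)) q := fun j =>
    (mdifferentiableAt_section_iff le_rfl hφ hqs).2
      ((mdifferentiableAt_const (c := EuclideanSpace.single j 1)).congr_of_eventuallyEq (by
        filter_upwards [hO.mem_nhds hq] with p hp using hZ p hp j))
  let a : Fin n → M → ℝ := fun j p => differential φ p (X p) j
  have haX : ∀ j, a j =ᶠ[𝓝 q] fun p => chartField φ X (φ p) j := by
    intro j
    filter_upwards [hO.mem_nhds hq] with p hp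
    rw [chartField_apply (hOs hp)]
  have had : ∀ j, MDifferentiableAt (𝓡 n) 𝓘(ℝ, ℝ) (a j) q := by
    intro j
    have h1 : DifferentiableAt ℝ (fun y => chartField φ X y j) (φ q) :=
      (EuclideanSpace.proj j : EuclideanSpace ℝ (Fin n) →L[ℝ] ℝ).differentiableAt.comp _ hX
    exact (h1.mdifferentiableAt.comp q ((mdifferentiable_of_mem_maximalAtlas hφ1
      ).1.mdifferentiableAt (φ.open_source.mem_nhds hqs))).congr_of_eventuallyEq (haX j)
  have hda : ∀ j, mvfderiv (𝓡 n) (a j) q w =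
      fderiv ℝ (chartField φ X) (φ q) (differential φ q w) j := by
    intro j
    have h1 := hasFDerivAt_comp_symm hφ1 hqs (had j)
    have h2 := (EuclideanSpace.proj j : EuclideanSpace ℝ (Fin n) →L[ℝ] ℝ).hasFDerivAt.comp (φ q)
      hX.hasFDerivAt
    have h3 := DFunLike.congr_fun (h1.unique h2) (differential φ q w)
    rw [ContinuousLinearMap.comp_apply, ContinuousLinearEquiv.coe_coe,
      differentialEquiv_symm_differential hφ1 hqs] at h3
    exact h3
  have hcw : ∀ j, differential φ q (cov (Z j) q w) =
      ∑ i, differential φ q w i • differential φ q (cov (Z j) q (Z i q)) := by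
    intro j
    conv_lhs => rw [hexp q hq w]
    simp only [map_sum, map_smul]
  rw [cov_eq_sum_of_eventuallyEq hcov hU (hOU hq) hZd had (by
    filter_upwards [hO.mem_nhds hq] with p hp using hexp p hp (X p))]
  simp only [_root_.sum_apply, _root_.add_apply, _root_.smul_apply,
    ContinuousLinearMap.smulRight_apply, map_sum, map_add, map_smul, hZ q hq, hda,
    Finset.sum_add_distrib, christoffel_apply, chartField_apply hqs, hcw, Finset.smul_sum]
  congr 1
  · rw [Finset.sum_comm]
    refine Finset.sum_congr rfl fun i _ => Finset.sum_congr rfl fun j _ => ?_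
    rw [smul_comm]
  · ext i
    simp [Pi.single_apply]

/-- The connection form of a flat connection satisfies the integrability condition. -/
lemma christoffel_flat (hcov : IsLinearConnectionOn cov U) (hU : IsOpen U)
    (hflat : IsFlatOn cov U)
    (hφ : φ ∈ maximalAtlas (𝓡 n) (1 + 1) M) (hO : IsOpen O) (hOs : O ⊆ φ.source) (hOU : O ⊆ U)
    (hZ : ∀ q ∈ O, ∀ j, differential φ q (Z j q) = EuclideanSpace.single j 1)
    (hZU : ∀ j, IsVectorFieldOn 2 (Z j) U) (hq : q ∈ O)
    (hΓ : DifferentiableAt ℝ (christoffel cov φ Z) (φ q)) (u v : EuclideanSpace ℝ (Fin n)) :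
    fderiv ℝ (christoffel cov φ Z) (φ q) u v +
        christoffel cov φ Z (φ q) u * christoffel cov φ Z (φ q) v =
      fderiv ℝ (christoffel cov φ Z) (φ q) v u +
        christoffel cov φ Z (φ q) v * christoffel cov φ Z (φ q) u := by
  have hφ1 := mem_maximalAtlas_one hφ
  set Γ := christoffel cov φ Z with hΓdef
  have hchart : ∀ b c, chartField φ (fun q => cov (Z c) q (Z b q)) = fun y =>
      Γ y (EuclideanSpace.single b 1) (EuclideanSpace.single c 1) := fun b c =>
    funext fun y => (christoffel_single y b c).symm
  -- In the chart, `∇_a ∇_b ∂_c` is `Γ_a Γ_b ∂_c + (∂_a Γ_b) ∂_c`. Coordinate fields commute, so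
  -- zero curvature is the symmetry of this expression in `a` and `b`.
  have hsecond : ∀ a b c, differential φ q (cov (fun q => cov (Z c) q (Z b q)) q (Z a q)) =
      Γ (φ q) (EuclideanSpace.single a 1) (Γ (φ q) (EuclideanSpace.single b 1)
        (EuclideanSpace.single c 1)) + fderiv ℝ Γ (φ q) (EuclideanSpace.single a 1)
          (EuclideanSpace.single b 1) (EuclideanSpace.single c 1) := by
    intro a b c
    rw [differential_cov_eq hcov hU hφ hO hOs hOU hZ hq
      (by rw [hchart]; exact differentiableAt_apply_apply hΓ _ _), hchart, fderiv_apply_apply hΓ,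
      hZ q hq]
  have hbr : ∀ a b, VectorField.mlieBracket (𝓡 n) (Z a) (Z b) q = 0 := fun a b =>
    mlieBracket_eq_zero_of_differential_eq_const hφ (hOs hq)
      (by filter_upwards [hO.mem_nhds hq] with p hp using hZ p hp a)
      (by filter_upwards [hO.mem_nhds hq] with p hp using hZ p hp b)
  have hbasis : ∀ a b c,
      Γ (φ q) (EuclideanSpace.single a 1) (Γ (φ q) (EuclideanSpace.single b 1)
        (EuclideanSpace.single c 1)) + fderiv ℝ Γ (φ q) (EuclideanSpace.single a 1)
          (EuclideanSpace.single b 1) (EuclideanSpace.single c 1) =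
      Γ (φ q) (EuclideanSpace.single b 1) (Γ (φ q) (EuclideanSpace.single a 1)
        (EuclideanSpace.single c 1)) + fderiv ℝ Γ (φ q) (EuclideanSpace.single b 1)
          (EuclideanSpace.single a 1) (EuclideanSpace.single c 1) := by
    intro a b c
    have h1 := hflat (Z a) (Z b) (Z c) ((hZU a).of_le one_le_two) ((hZU b).of_le one_le_two)
      (hZU c) q (hOU hq)
    rw [hbr, map_zero, sub_zero, sub_eq_zero] at h1
    rw [← hsecond, ← hsecond, h1]
  refine integrability_of_basis (EuclideanSpace.basisFun (Fin n) ℝ).toBasis (fun a b c => ?_) u v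
  simp only [OrthonormalBasis.coe_toBasis, EuclideanSpace.basisFun_apply]
  rw [add_comm, hbasis, add_comm]

end Christoffel

/-! ### Parallel frames of a flat connection -/

section ParallelFrames

/-- The total differential equation in the algebra of endomorphisms; since `Φ y` is a unit there,
its columns are independent. -/
lemma exists_parallel_matrix {E : Type*} [NormedAddCommGroup E] [NormedSpace ℝ E]
    [FiniteDimensional ℝ E] {k : ℕ∞} (hk : 1 ≤ k) {Γ : E → E →L[ℝ] E →L[ℝ] E} {y₀ : E} {ε : ℝ}
    (hε : 0 < ε) (hΓ : ContDiffOn ℝ k Γ (Metric.ball y₀ ε))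
    (hflat : ∀ y ∈ Metric.ball y₀ ε, ∀ u v, fderiv ℝ Γ y u v + Γ y u * Γ y v =
      fderiv ℝ Γ y v u + Γ y v * Γ y u) :
    ∃ δ > 0, δ ≤ ε ∧ ∃ Φ : E → E →L[ℝ] E, ContDiffOn ℝ (k + 1) Φ (Metric.ball y₀ δ) ∧
      ∀ y ∈ Metric.ball y₀ δ, Function.Injective (Φ y) ∧
        ∀ v, HasFDerivAt (fun y => Φ y v) (-(Γ y).flip (Φ y v)) y := by
  obtain ⟨δ, hδ, hδε, Φ, hΦ, h⟩ := exists_pfaff_solution hk hε hΓ hflat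
  refine ⟨δ, hδ, hδε, Φ, hΦ, fun y hy => ⟨?_, fun v => ?_⟩⟩
  · obtain ⟨Ψ, hΨ⟩ := (h y hy).1.exists_left_inv
    exact Function.LeftInverse.injective (g := Ψ) fun v => DFunLike.congr_fun hΨ v
  · have h1 := (h y hy).2.clm_apply (hasFDerivAt_const v y)
    refine h1.congr_fderiv ?_
    ext u
    simp

variable [IsManifold (𝓡 n) 1 M] [IsManifold (𝓡 n) 2 M] {U : Set M} {L : LinearTransport n M}

/-- The columns of a solution of `dΦ = -ΓΦ` are the components of a parallel frame. Restricted to a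
path it consists of parallel liftings, which `L` must transport. -/
lemma LinearTransport.IsFlatParallelTransportOn.admitsNormalFrames [T2Space M] {k : ℕ∞}
    [IsManifold (𝓡 n) ((k : ℕ∞ω) + 1 + 1) M] (hk : 1 ≤ k) (hU : IsOpen U)
    (h : L.IsFlatParallelTransportOn k U) : L.AdmitsNormalFrames ((k : ℕ∞ω) + 1) U := by
  obtain ⟨cov, hcov, hcl, hflat, hL⟩ := h
  intro p hp
  have hkω : (1 : ℕ∞ω) ≤ k := by exact_mod_cast hk
  have hk2 : (1 + 1 : ℕ∞ω) ≤ (k : ℕ∞ω) + 1 := add_le_add_left hkω 1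
  have hk1 : (1 : ℕ∞ω) ≤ (k : ℕ∞ω) + 1 := le_add_self
  have hφ : chartAt (EuclideanSpace ℝ (Fin n)) p ∈ maximalAtlas (𝓡 n) ((k : ℕ∞ω) + 1 + 1) M :=
    chart_mem_maximalAtlas p
  have hps := mem_chart_source (EuclideanSpace ℝ (Fin n)) p
  set φ := chartAt (EuclideanSpace ℝ (Fin n)) p
  have hφk : φ ∈ maximalAtlas (𝓡 n) ((k : ℕ∞ω) + 1) M :=
    maximalAtlas_subset_of_le le_self_add hφ
  have hφ2 : φ ∈ maximalAtlas (𝓡 n) (1 + 1) M := maximalAtlas_subset_of_le hk2 hφk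
  have hφ1 := mem_maximalAtlas_one hφ
  -- The regularity and the flatness of `cov` are conditions on fields regular on all of `U`, so the
  -- coordinate fields are replaced by global fields with the same germs at `p`.
  choose Z hZ hZφ using fun j => exists_contMDiff_section_eventuallyEq (r := k + 1)
    (X := coordFrame φ j) (by simpa using hφ) hps
    (by simpa [IsVectorFieldOn] using (isLocalFrameOn_coordFrame hφ subset_rfl).contMDiffOn j)
  have hZ' : ∀ j (S : Set M), IsVectorFieldOn ((k : ℕ∞ω) + 1) (Z j) S := fun j S => by
    simpa [IsVectorFieldOn] using (hZ j).mono (subset_univ S)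
  obtain ⟨O, hO, hOo, hpO⟩ := eventually_nhds_iff.1
    ((eventually_all.2 hZφ).and ((φ.open_source.inter hU).mem_nhds ⟨hps, hp⟩))
  have hOs : O ⊆ φ.source := fun q hq => (hO q hq).2.1
  have hOU : O ⊆ U := fun q hq => (hO q hq).2.2
  have hZO : ∀ q ∈ O, ∀ j, differential φ q (Z j q) = EuclideanSpace.single j 1 := by
    intro q hq j
    rw [(hO q hq).1 j, differential_coordFrame hφ1 (hOs hq)]
  obtain ⟨ε, hε, hball⟩ := Metric.isOpen_iff.1 (φ.isOpen_inter_preimage_symm hOo) (φ p)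
    ⟨φ.map_source hps, by simpa [φ.left_inv hps] using hpO⟩
  have hΓ : ContDiffOn ℝ k (christoffel cov φ Z) (Metric.ball (φ p) ε) :=
    contDiffOn_christoffel hφk hOs hOU hcl (fun j => hZ' j U)
      (fun y hy => (hball hy).1) (fun y hy => (hball hy).2)
  have hΓd : ∀ y ∈ Metric.ball (φ p) ε, DifferentiableAt ℝ (christoffel cov φ Z) y := fun y hy =>
    (hΓ.contDiffAt (Metric.isOpen_ball.mem_nhds hy)).differentiableAt
      (by exact_mod_cast (one_pos.trans_le hk).ne')
  obtain ⟨δ, hδ, hδε, Φ, hΦ, hΦ'⟩ := exists_parallel_matrix hk hε hΓ fun y hy u v => by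
    have h1 := christoffel_flat hcov hU hflat hφ2 hOo hOs hOU hZO
      (fun j => (hZ' j U).of_le (one_add_one_eq_two (R := ℕ∞ω) ▸ hk2)) (hball hy).2
    rw [φ.right_inv (hball hy).1] at h1
    exact h1 (hΓd y hy) u v
  let V := φ.source ∩ φ ⁻¹' Metric.ball (φ p) δ
  have hV : IsOpen V := φ.isOpen_inter_preimage Metric.isOpen_ball
  have hVε : ∀ q ∈ V, φ q ∈ Metric.ball (φ p) ε := fun q hq => Metric.ball_subset_ball hδε hq.2
  have hVO : V ⊆ O := fun q hq => by simpa [φ.left_inv hq.1] using (hball (hVε q hq)).2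
  let e : Fin n → (q : M) → TangentSpace (𝓡 n) q := fun i q =>
    ∑ j, Φ (φ q) (EuclideanSpace.single i 1) j • Z j q
  have he : ∀ q ∈ O, ∀ i, differential φ q (e i q) = Φ (φ q) (EuclideanSpace.single i 1) := by
    intro q hq i
    simp only [e, map_sum, map_smul, hZO q hq]
    ext l
    simp [Pi.single_apply]
  have hei : ∀ i, ∀ q ∈ V, chartField φ (e i) =ᶠ[𝓝 (φ q)]
      fun y => Φ y (EuclideanSpace.single i 1) := by
    intro i q hq
    filter_upwards [Metric.isOpen_ball.mem_nhds hq.2] with y hy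
    have hy' := hball (Metric.ball_subset_ball hδε hy)
    rw [chartField, he _ hy'.2, φ.right_inv hy'.1]
  have hpar : ∀ i, ∀ q ∈ V, cov (e i) q = 0 := by
    intro i q hq
    ext1 w
    apply differential_injective hφ1 hq.1
    -- The derivative `-Γ Φ` of the components cancels the connection term `Γ Φ`.
    have hd := ((hΦ' (φ q) hq.2).2 (EuclideanSpace.single i 1)).congr_of_eventuallyEq (hei i q hq)
    rw [differential_cov_eq hcov hU hφ2 hOo hOs hOU hZO (hVO hq) hd.differentiableAt, hd.fderiv,
      (hei i q hq).self_of_nhds]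
    simp
  have hframe : IsLocalFrameOn (𝓡 n) (EuclideanSpace ℝ (Fin n)) ((k : ℕ∞ω) + 1) e V := by
    refine isLocalFrameOn_of_differential hφ inter_subset_left (fun q hq => ?_) fun i => ?_
    · simp only [he q (hVO hq)]
      exact linearIndependent_single.map' (Φ (φ q)).toLinearMap
        (LinearMap.ker_eq_bot.2 (hΦ' _ hq.2).1)
    · have h1 : ContMDiffOn (𝓡 n) (𝓡 n) ((k : ℕ∞ω) + 1)
          (fun q => Φ (φ q) (EuclideanSpace.single i 1)) V :=
        (hΦ.clm_apply contDiffOn_const).contMDiffOn.comp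
          (((contMDiffOn_of_mem_maximalAtlas hφk)).mono inter_subset_left) fun q hq => hq.2
      exact h1.congr fun q hq => he q (hVO hq) i
  refine ⟨V, hV, ⟨hps, Metric.mem_ball_self hδ⟩, e, hframe.mono inter_subset_right,
    fun γ hγ s t i => ?_⟩
  refine tr_eq_of_parallel (X := fun τ => e i (γ τ)) hcov hU hL (fun u hu => (hγ hu).1)
    (fun s => ⟨V, e, fun j _ => if j = i then 1 else 0, fun _ => 0, hV, (hγ s.2).2,
      isLocalFrameOn_of_le hframe hk1, Eventually.of_forall fun τ => by simp,
      fun j => hasDerivWithinAt_const _ _ _, ?_⟩) s t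
  simp [hpar _ _ (hγ s.2).2]

end ParallelFrames

end

end NormalFrames

/-! ### Assembly of the theorem -/

theorem mainTheorem10 {n : ℕ} {M : Type*} [TopologicalSpace M] [T2Space M]
    [ChartedSpace (EuclideanSpace ℝ (Fin n)) M] (k : ℕ∞)
    [IsManifold (𝓡 n) 1 M] [IsManifold (𝓡 n) ((k : ℕ∞ω) + 1 + 1) M]
    (L : NormalFrames.LinearTransport n M) :
    -- Torsion and normal coordinates on a submanifold
    (∀ N : Set M, NormalFrames.IsSubmanifold n ((k : ℕ∞ω) + 1 + 1) N →
      -- coordinates exist iff, locally, frames exist and the torsion vanishes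
      (L.AdmitsNormalCoords ((k : ℕ∞ω) + 1) N ↔
        ∀ p ∈ N, ∃ V : Set M, IsOpen V ∧ p ∈ V ∧
          (∃ e, L.IsNormalFrame ((k : ℕ∞ω) + 1) e (N ∩ V)) ∧ L.TorsionFreeOn (N ∩ V)) ∧
      -- the case of a transport with a normal frame on the whole of the submanifold
      (∀ e, L.IsNormalFrame ((k : ℕ∞ω) + 1) e N →
        (L.AdmitsNormalCoords ((k : ℕ∞ω) + 1) N ↔ L.TorsionFreeOn N) ∧
        -- all normal coordinates in terms of the normal frame
        (∀ φ ∈ IsManifold.maximalAtlas (𝓡 n) ((k : ℕ∞ω) + 1 + 1) M,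
          IsPreconnected (N ∩ φ.source) →
          (L.IsNormalCoord ((k : ℕ∞ω) + 1) φ N ↔
            ∃ B : Fin n → EuclideanSpace ℝ (Fin n), ∀ p ∈ N ∩ φ.source, ∀ j,
              NormalFrames.differential φ p (e j p) = B j)) ∧
        (∀ φ ∈ IsManifold.maximalAtlas (𝓡 n) ((k : ℕ∞ω) + 1 + 1) M,
          ∀ B : Fin n → EuclideanSpace ℝ (Fin n),
          (∀ p ∈ N ∩ φ.source, ∀ j, NormalFrames.differential φ p (e j p) = B j) →
          ∀ γ : NormalFrames.Path n M, γ.LiesIn (N ∩ φ.source) →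
          ∀ c : ℝ → Fin n → ℝ, (∀ u ∈ γ.dom, γ.velocity u = ∑ j, c u j • e j (γ u)) →
          ∀ s ∈ γ.dom, ∀ t ∈ γ.dom,
            φ (γ t) = φ (γ s) + ∑ j, (∫ u in s..t, c u j) • B j) ∧
        (L.TorsionFreeOn N → ∀ p ∈ N, ∀ B : Fin n → EuclideanSpace ℝ (Fin n),
          LinearIndependent ℝ B → ∀ b : EuclideanSpace ℝ (Fin n),
          ∃ φ : OpenPartialHomeomorph M (EuclideanSpace ℝ (Fin n)),
            p ∈ φ.source ∧ L.IsNormalCoord ((k : ℕ∞ω) + 1) φ N ∧ φ p = b ∧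
            ∀ q ∈ N ∩ φ.source, ∀ j, NormalFrames.differential φ q (e j q) = B j)) ∧
      -- all normal coordinates near a point in terms of given ones
      (∀ p ∈ N, ∀ φ : OpenPartialHomeomorph M (EuclideanSpace ℝ (Fin n)),
        p ∈ φ.source → L.IsNormalCoord ((k : ℕ∞ω) + 1) φ N →
        (∀ ψ : OpenPartialHomeomorph M (EuclideanSpace ℝ (Fin n)),
          p ∈ ψ.source → L.IsNormalCoord ((k : ℕ∞ω) + 1) ψ N →
          ∃ (A : EuclideanSpace ℝ (Fin n) ≃L[ℝ] EuclideanSpace ℝ (Fin n))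
            (b : EuclideanSpace ℝ (Fin n)) (f : M → EuclideanSpace ℝ (Fin n)) (V : Set M),
            IsOpen V ∧ p ∈ V ∧ V ⊆ φ.source ∩ ψ.source ∧
            ContMDiffOn (𝓡 n) (𝓡 n) ((k : ℕ∞ω) + 1 + 1) f V ∧
            (∀ q ∈ N ∩ V, f q = 0 ∧ NormalFrames.differential f q = 0) ∧
            ∀ q ∈ V, ψ q = A (φ q) + b + f q) ∧
        (∀ (A : EuclideanSpace ℝ (Fin n) ≃L[ℝ] EuclideanSpace ℝ (Fin n))
          (b : EuclideanSpace ℝ (Fin n)) (f : M → EuclideanSpace ℝ (Fin n)) (V : Set M),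
          IsOpen V → p ∈ V →
          ContMDiffOn (𝓡 n) (𝓡 n) ((k : ℕ∞ω) + 1 + 1) f V →
          (∀ q ∈ N ∩ V, f q = 0 ∧ NormalFrames.differential f q = 0) →
          ∃ ψ : OpenPartialHomeomorph M (EuclideanSpace ℝ (Fin n)),
            p ∈ ψ.source ∧ ψ.source ⊆ φ.source ∩ V ∧ L.IsNormalCoord ((k : ℕ∞ω) + 1) ψ N ∧
            ∀ q ∈ ψ.source, ψ q = A (φ q) + b + f q))) ∧
    -- Flat parallel transports are the only linear transports that admit normal frames
    (1 ≤ k → ∀ U : Set M, IsOpen U →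
      (∀ e, L.IsNormalFrame ((k : ℕ∞ω) + 1) e U → L.IsFlatParallelTransportOn k U) ∧
      (L.IsFlatParallelTransportOn k U → L.AdmitsNormalFrames ((k : ℕ∞ω) + 1) U) ∧
      (L.IsLocal →
        (L.AdmitsNormalFrames ((k : ℕ∞ω) + 1) U ↔ L.IsFlatParallelTransportOn k U))) ∧
    -- Autoparallels of a parallel transport are the geodesics of the generating connection
    (∀ (U : Set M) (cov : NormalFrames.Cov n M), IsOpen U →
      NormalFrames.IsLinearConnectionOn cov U → L.IsParallelTransportOn cov U →
      ∀ γ : NormalFrames.Path n M, γ.LiesIn U →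
        (L.IsAutoparallel γ ↔ NormalFrames.IsGeodesic cov γ)) := by
  have : IsManifold (𝓡 n) 2 M := IsManifold.of_le (NormalFrames.two_le_add k)
  refine ⟨?_, ?_, fun U cov hU hcov hL γ hγ =>
    NormalFrames.isAutoparallel_iff_isGeodesic hcov hU hL hγ⟩
  · intro N hN
    refine ⟨NormalFrames.admitsNormalCoords_iff hN, fun e he =>
      ⟨NormalFrames.admitsNormalCoords_iff_torsionFreeOn hN he,
      fun φ hφ hconn => NormalFrames.isNormalCoord_iff_exists_const hN he hφ hconn,
      fun φ hφ B hB γ hγ c hc s hs t ht => ?_, fun hT p hp B hB b => ?_⟩,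
      fun p hp φ hpφ hφ => ⟨fun ψ hpψ hψ =>
        NormalFrames.exists_affine_of_isNormalCoord hN hp hpφ hφ hpψ hψ,
        fun A b f V hV hpV hf hf0 =>
          NormalFrames.exists_isNormalCoord_affine hp hpφ hφ A b hV hpV hf
          fun q hq => (hf0 q hq).2⟩⟩
    · have hφ1 := NormalFrames.mem_maximalAtlas_one hφ
      -- The path provides a point of `N ∩ φ.source`, where `B` is the image of a basis under the
      -- injective map `dφ`.
      have hBi : LinearIndependent ℝ B := by
        have h := NormalFrames.linearIndependent_differential he.frame hφ1 (hγ hs).1 (hγ hs).2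
        rwa [show (fun j => NormalFrames.differential φ (γ s) (e j (γ s))) = B from
          funext fun j => hB _ (hγ hs) j] at h
      exact NormalFrames.chart_eq_add_integral hφ1 (fun u hu => (hγ hu).2) (fun u hu => hB _ (hγ hu))
        hBi hc hs ht
    · have he' : L.IsNormalFrame ((k : ℕ∞ω) + 1) e (N ∩ univ) := by rwa [inter_univ]
      have hT' : L.TorsionFreeOn (N ∩ univ) := by rwa [inter_univ]
      exact NormalFrames.exists_isNormalCoord_of_torsionFree hN isOpen_univ he' hT'
        ⟨hp, mem_univ p⟩ hB b
  · intro hk U hU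
    have hkω : (1 : ℕ∞ω) ≤ k := by exact_mod_cast hk
    have : IsManifold (𝓡 n) ((k : ℕ∞ω) + 1) M :=
      IsManifold.of_le (n := (k : ℕ∞ω) + 1 + 1) le_self_add
    exact ⟨fun e he => NormalFrames.IsNormalFrame.isFlatParallelTransportOn hkω hU he,
      fun h => h.admitsNormalFrames hk hU, fun hL =>
        ⟨fun h => h.isFlatParallelTransportOn hkω hU hL, fun h => h.admitsNormalFrames hk hU⟩⟩
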